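/- Let $k$ be a field of characteristic $0$ and let $\sigma\in\{1,-1\}$. Let $\mathfrak a$ be the Lie algebra with basis $e_1,\dots,e_5$ whose only nonzero bracket of basis vectors (up to antisymmetry) is $[e_2,e_4]=2e_1$, and write $[e_i,e_j]=\sum_a C_{i,j}^a e_a$. Let $U_h(\mathfrak a)$ be the quotient of the $h$-adically completed tensor algebra of the free $k[[h]]$-module on $e_1,\dots,e_5$ by the ($h$-adic) closure of the two-sided ideal generated by the elements $$e_i\otimes e_j-e_j\otimes e_i-\sum_a C_{i,j}^a e_a-P_{i,j}\qquad(1\le i,j\le 5),$$ where $P_{j,i}=-P_{i,j}$, $$P_{3,5}=\tfrac23h^2e_1^3,\quad P_{4,5}=\tfrac{\sigma}{6}h^3e_1^4,\quad P_{2,5}=-he_1^2,\quad P_{3,4}=-he_1^2,$$ and $P_{i,j}=0$ for all other pairs $i<j$. (For $\sigma=-1$ this is the quantized enveloping algebra dual to the twist of $U(\mathfrak g)[[h]]$ by $\exp(h(X_2\otimes X_3-X_3\otimes X_2))$, where $\mathfrak g$ has the nonzero brackets $[X_1,X_2]=X_3$, $[X_1,X_3]=X_4$, $[X_1,X_4]=X_5$.)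 Write $P_{i,j}/e_1$ for the monomial obtained by dividing by $e_1$. Let $\epsilon_h:U_h(\mathfrak a)\to k[[h]]$ be the $k[[h]]$-algebra morphism with $\epsilon_h(e_i)=0$; it makes $k[[h]]$ the trivial left $U_h(\mathfrak a)$-module. For $p_1<\dots<p_n$ put $$\partial_n(1\otimes e_{p_1}\wedge\dots\wedge e_{p_n})=\sum_{i=1}^n(-1)^{i-1}e_{p_i}\otimes e_{p_1}\wedge\dots\widehat{e_{p_i}}\dots\wedge e_{p_n}+\sum_{r<s}(-1)^{r+s}\sum_a C_{p_r,p_s}^a\,1\otimes e_a\wedge e_{p_1}\wedge\dots\widehat{e_{p_r}}\dots\widehat{e_{p_s}}\dots\wedge e_{p_n},$$ and define morphisms of left $U_h(\mathfrak a)$-modules by $\partial_0^h=\epsilon_h$, $\partial_1^h(1\otimes e_i)=e_i$ and, for increasing indices, $$\partial_2^h(1\otimes e_i\wedge e_j)=\partial_2(1\otimes e_i\wedge e_j)-\tfrac{P_{i,j}}{e_1}\otimes e_1,$$ $$\partial_3^h(1\otimes e_i\wedge e_j\wedge e_l)=\partial_3(1\otimes e_i\wedge e_j\wedge e_l)-\tfrac{P_{i,j}}{e_1}\otimes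 e_1\wedge e_l+\tfrac{P_{i,l}}{e_1}\otimes e_1\wedge e_j-\tfrac{P_{j,l}}{e_1}\otimes e_1\wedge e_i,$$ $$\partial_4^h(1\otimes e_1\wedge e_i\wedge e_j\wedge e_l)=\partial_4(1\otimes e_1\wedge e_i\wedge e_j\wedge e_l),$$ $$\partial_4^h(1\otimes e_2\wedge e_3\wedge e_4\wedge e_5)=\partial_4(1\otimes e_2\wedge e_3\wedge e_4\wedge e_5)+\tfrac{P_{3,5}}{e_1}\otimes e_1\wedge e_2\wedge e_4-\tfrac{P_{3,4}}{e_1}\otimes e_1\wedge e_2\wedge e_5-\tfrac{P_{4,5}}{e_1}\otimes e_1\wedge e_2\wedge e_3-\tfrac{P_{2,5}}{e_1}\otimes e_1\wedge e_3\wedge e_4,$$ $$\partial_5^h(1\otimes e_1\wedge\dots\wedge e_5)=\partial_5(1\otimes e_1\wedge\dots\wedge e_5).$$ Then $$0\to U_h(\mathfrak a)\otimes\wedge^5\mathfrak a\xrightarrow{\partial_5^h}U_h(\mathfrak a)\otimes\wedge^4\mathfrak a\xrightarrow{\partial_4^h}\cdots\xrightarrow{\partial_2^h}U_h(\mathfrak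 a)\otimes\mathfrak a\xrightarrow{\partial_1^h}U_h(\mathfrak a)\xrightarrow{\partial_0^h}k[[h]]\to0$$ is exact, i.e. a resolution of the trivial module. Moreover $\mathrm{Ext}^5_{U_h(\mathfrak a)}(k[[h]],U_h(\mathfrak a))$ is a free $k[[h]]$-module of rank one, and the character $\theta:U_h(\mathfrak a)\to k[[h]]$ through which $U_h(\mathfrak a)$ acts on it by right multiplication is zero, in the sense that $\theta(e_i)=0$ for $i=1,\dots,5$, i.e. $\theta=\epsilon_h$. -/

import Mathlib

open scoped TensorProduct ModuleCat.Algebra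
open CategoryTheory PowerSeries

universe u

namespace QuantumKoszul

noncomputable section

variable (k : Type u) [Field k]

/-! ### The completed tensor algebra

The vector `e_{i+1}` of the text is indexed by `i : Fin 5`; the deformation parameter `h` is the
formal variable of `k⟦X⟧ = k[[h]]`. -/

/-- The `h`-adic completion of the tensor algebra of the free `k[[h]]`-module on `e_1, …, e_5`.
Modulo `h ^ n` that tensor algebra is `T(k ^ 5) ⊗ k[h] / h ^ n`, so its completion is the algebra
of power series in the central variable `h` with coefficients in the free algebra `T(k ^ 5)`. -/
abbrev CompletedTensor : Type u := PowerSeries (FreeAlgebra k (Fin 5))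

/-- The `k[[h]]`-algebra structure: `k[[h]]` acts through its coefficientwise inclusion. -/
instance instAlgebraCompletedTensor : Algebra (PowerSeries k) (CompletedTensor k) :=
  RingHom.toAlgebra' (PowerSeries.map (algebraMap k (FreeAlgebra k (Fin 5)))) (by
    intro c x
    ext n
    rw [PowerSeries.coeff_mul, PowerSeries.coeff_mul, ← Finset.Nat.sum_antidiagonal_swap]
    refine Finset.sum_congr rfl fun p _ => ?_
    simp only [PowerSeries.coeff_map, Prod.fst_swap, Prod.snd_swap]
    exact Algebra.commutes _ _)

/-- The deformation parameter in the completed tensor algebra. -/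
def hT : CompletedTensor k := PowerSeries.X

/-- The generators in the completed tensor algebra. -/
def genT (i : Fin 5) : CompletedTensor k := PowerSeries.C (FreeAlgebra.ι k i)

/-! ### Relations -/

/-- Structure constants: `[e_i, e_j] = ∑ a, C i j a • e_a` in the Lie algebra `𝔞`, whose only
nonzero bracket of basis vectors is `[e_2, e_4] = 2 e_1`. -/
def structConst (i j a : Fin 5) : k :=
  if (i, j, a) = (1, 3, 0) then 2 else if (i, j, a) = (3, 1, 0) then -2 else 0

/-- The elements `P_{i,j} / e_1` for `(i,j)` equal to `(3,5)`, `(4,5)`, `(2,5)`, `(3,4)`;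
zero for the other pairs. -/
def halfQuotT (σ : ℤˣ) : Fin 5 → Fin 5 → CompletedTensor k
  | 2, 4 => (2 / 3 : k) • (hT k ^ 2 * genT k 0 ^ 2)
  | 3, 4 => (((σ : ℤ) : k) / 6) • (hT k ^ 3 * genT k 0 ^ 3)
  | 1, 4 => -(hT k * genT k 0)
  | 2, 3 => -(hT k * genT k 0)
  | _, _ => 0

/-- The elements `P_{i,j} / e_1`, antisymmetric in `(i, j)`. -/
def quotT (σ : ℤˣ) (i j : Fin 5) : CompletedTensor k := halfQuotT k σ i j - halfQuotT k σ j i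

/-- The monomials `P_{i,j}` in `e_1`. -/
def monT (σ : ℤˣ) (i j : Fin 5) : CompletedTensor k := quotT k σ i j * genT k 0

/-- The defining relators `e_i e_j - e_j e_i - ∑ a, C_{i,j}^a e_a - P_{i,j}`. -/
def relator (σ : ℤˣ) (i j : Fin 5) : CompletedTensor k :=
  genT k i * genT k j - genT k j * genT k i
    - ∑ a, structConst k i j a • genT k a - monT k σ i j

/-- The closure in the `h`-adic topology of the two-sided ideal `J` generated by the relators,
namely the intersection of the ideals `J + (h ^ n)`. -/
def relIdeal (σ : ℤˣ) : TwoSidedIdeal (CompletedTensor k) :=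
  ⨅ n : ℕ, TwoSidedIdeal.span
    (Set.range (fun p : Fin 5 × Fin 5 => relator k σ p.1 p.2) ∪ {hT k ^ n})

/-! ### The quantized enveloping algebra -/

/-- The quantized enveloping algebra `U_h(𝔞)`. -/
def U (σ : ℤˣ) : Type u := (relIdeal k σ).ringCon.Quotient

instance (σ : ℤˣ) : Ring (U k σ) :=
  inferInstanceAs (Ring (relIdeal k σ).ringCon.Quotient)

instance (σ : ℤˣ) : Algebra k (U k σ) :=
  inferInstanceAs (Algebra k (relIdeal k σ).ringCon.Quotient)

instance (σ : ℤˣ) : Algebra (PowerSeries k) (U k σ) :=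
  inferInstanceAs (Algebra (PowerSeries k) (relIdeal k σ).ringCon.Quotient)

/-- The projection from the completed tensor algebra. -/
def proj (σ : ℤˣ) : CompletedTensor k →ₐ[PowerSeries k] U k σ :=
  (relIdeal k σ).ringCon.mkₐ (α := PowerSeries k)

/-- The generators of `U_h(𝔞)`. -/
def e (σ : ℤˣ) (i : Fin 5) : U k σ := proj k σ (genT k i)

/-- The elements `P_{i,j} / e_1` of `U_h(𝔞)`. -/
def Q (σ : ℤˣ) (i j : Fin 5) : U k σ := proj k σ (quotT k σ i j)

/-! ### The counit -/

/-- The counit on the completed tensor algebra. -/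
def counitT : CompletedTensor k →ₐ[PowerSeries k] PowerSeries k where
  __ := PowerSeries.map
    (FreeAlgebra.lift k (fun _ : Fin 5 => (0 : k)) : FreeAlgebra k (Fin 5) →ₐ[k] k).toRingHom
  commutes' := fun r => by
    ext n
    change PowerSeries.coeff n (PowerSeries.map _ (PowerSeries.map _ r)) = PowerSeries.coeff n r
    simp

lemma counitT_genT (i : Fin 5) : counitT k (genT k i) = 0 := by
  change PowerSeries.map _ (PowerSeries.C _) = 0
  simp

lemma counitT_hT : counitT k (hT k) = PowerSeries.X := by
  change PowerSeries.map _ PowerSeries.X = PowerSeries.X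
  simp

lemma counitT_smul (c : k) (x : CompletedTensor k) : counitT k (c • x) = c • counitT k x := by
  ext n
  change PowerSeries.coeff n (PowerSeries.map _ (c • x)) =
    PowerSeries.coeff n (c • PowerSeries.map _ x)
  simp

lemma counitT_relator (σ : ℤˣ) (i j : Fin 5) : counitT k (relator k σ i j) = 0 := by
  simp [relator, monT, counitT_genT, counitT_smul]

lemma counitT_eq_zero (σ : ℤˣ) {x : CompletedTensor k} (hx : x ∈ relIdeal k σ) :
    counitT k x = 0 := by
  have key : ∀ n : ℕ, (PowerSeries.X : PowerSeries k) ^ n ∣ counitT k x := by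
    intro n
    have h1 := (iInf_le (fun n : ℕ => TwoSidedIdeal.span
      (Set.range (fun p : Fin 5 × Fin 5 => relator k σ p.1 p.2) ∪ {hT k ^ n})) n) hx
    have h2 : TwoSidedIdeal.span
        (Set.range (fun p : Fin 5 × Fin 5 => relator k σ p.1 p.2) ∪ {hT k ^ n}) ≤
        TwoSidedIdeal.ker ((Ideal.Quotient.mk
          (Ideal.span {(PowerSeries.X : PowerSeries k) ^ n})).comp
            (counitT k : CompletedTensor k →+* PowerSeries k)) := by
      rw [TwoSidedIdeal.span_le]
      rintro y (⟨p, rfl⟩ | rfl)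
      · rw [SetLike.mem_coe, TwoSidedIdeal.mem_ker]
        simp [counitT_relator]
      · rw [SetLike.mem_coe, TwoSidedIdeal.mem_ker]
        simp only [RingHom.coe_comp, Function.comp_apply, RingHom.coe_coe, map_pow, counitT_hT]
        rw [← map_pow, Ideal.Quotient.eq_zero_iff_mem]
        exact Ideal.mem_span_singleton_self _
    have h3 := (TwoSidedIdeal.mem_ker _).mp (h2 h1)
    simp only [RingHom.coe_comp, Function.comp_apply, RingHom.coe_coe] at h3
    rwa [Ideal.Quotient.eq_zero_iff_mem, Ideal.mem_span_singleton] at h3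
  ext n
  have := (PowerSeries.X_pow_dvd_iff.mp (key (n + 1))) n (Nat.lt_succ_self n)
  simpa using this

/-- The counit `ε_h : U_h(𝔞) → k[[h]]`, the `k[[h]]`-algebra morphism killing each `e_i`. -/
def counit (σ : ℤˣ) : U k σ →ₐ[PowerSeries k] PowerSeries k :=
  RingCon.liftₐ (relIdeal k σ).ringCon (counitT k) (by
    intro x y hxy
    have h := counitT_eq_zero k σ ((TwoSidedIdeal.rel_iff _ _ _).mp hxy)
    rw [map_sub, sub_eq_zero] at h
    exact h)

/-- The trivial `U_h(𝔞)`-module `k[[h]]`, on which `U_h(𝔞)` acts through the counit. -/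
def Triv (_σ : ℤˣ) : Type u := PowerSeries k

instance (σ : ℤˣ) : AddCommGroup (Triv k σ) := inferInstanceAs (AddCommGroup (PowerSeries k))

instance (σ : ℤˣ) : Module (U k σ) (Triv k σ) :=
  Module.compHom (PowerSeries k) (counit k σ : U k σ →+* PowerSeries k)

/-! ### The deformed Koszul complex -/

/-- The left `U_h(𝔞)`-module `U_h(𝔞) ⊗ ⋀^n 𝔞`, where `𝔞` has underlying space `k ^ 5`. -/
abbrev Kos (σ : ℤˣ) (n : ℕ) : Type u := U k σ ⊗[k] (⋀[k]^n (Fin 5 → k))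

/-- The element `e_{p 0} ∧ ⋯ ∧ e_{p (n-1)}` of `⋀^n 𝔞`. -/
def wedge {n : ℕ} (p : Fin n → Fin 5) : ⋀[k]^n (Fin 5 → k) :=
  exteriorPower.ιMulti k n (fun i => Pi.basisFun k (Fin 5) (p i))

/-- The `U_h(𝔞)`-basis of `U_h(𝔞) ⊗ ⋀^n 𝔞` consisting of the `1 ⊗ e_{p_1} ∧ ⋯ ∧ e_{p_n}` with
`p_1 < ⋯ < p_n`. -/
def kosBasis (σ : ℤˣ) (n : ℕ) : Module.Basis (Set.powersetCard (Fin 5) n) (U k σ) (Kos k σ n) :=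
  ((Pi.basisFun k (Fin 5)).exteriorPower n).baseChange (U k σ)

/-- The `U_h(𝔞)`-linear map with `1 ⊗ e_{p_1} ∧ ⋯ ∧ e_{p_n} ↦ f p` for `p_1 < ⋯ < p_n`. -/
def kosLift (σ : ℤˣ) {n : ℕ} {N : Type u} [AddCommGroup N] [Module (U k σ) N]
    (f : (Fin n → Fin 5) → N) : Kos k σ n →ₗ[U k σ] N :=
  (kosBasis k σ n).constr ℕ (fun s => f (Set.powersetCard.ofFinEmbEquiv.symm s))

lemma kosLift_apply (σ : ℤˣ) {n : ℕ} {N : Type u} [AddCommGroup N] [Module (U k σ) N]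
    (f : (Fin n → Fin 5) → N) (p : Fin n → Fin 5) (hp : StrictMono p) :
    kosLift k σ f (1 ⊗ₜ wedge k p) = f p := by
  have h : (1 : U k σ) ⊗ₜ[k] wedge k p = kosBasis k σ n
      (Set.powersetCard.ofFinEmbEquiv (OrderEmbedding.ofStrictMono p hp)) := by
    rw [kosBasis, Module.Basis.baseChange_apply, exteriorPower.basis_apply,
      exteriorPower.ιMulti_family, Equiv.symm_apply_apply]
    rfl
  rw [h, kosLift, Module.Basis.constr_basis, Equiv.symm_apply_apply]
  rfl

/-- The Koszul expression `∂_{n+2} (1 ⊗ e_{p 0} ∧ ⋯ ∧ e_{p (n+1)})`, that is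
`∑ i, ± e_{p_i} ⊗ ⋯ ∧ omit e_{p_i} ∧ ⋯` plus
`∑ k < l, ± ∑ a, C_{p_k, p_l}^a ⊗ e_a ∧ ⋯ ∧ omit e_{p_k} ∧ ⋯ ∧ omit e_{p_l} ∧ ⋯`.
For `m.castSucc < l`, the tuple `p ∘ l.succAbove ∘ m.succAbove` is `p` with its entries at `m`
and `l` removed. Counting positions from 0 changes `(-1) ^ (i - 1)` to `(-1) ^ i` and leaves
`(-1) ^ (k + l)` as it is. -/
def koszul (σ : ℤˣ) (n : ℕ) (p : Fin (n + 2) → Fin 5) : Kos k σ (n + 1) :=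
  (∑ i : Fin (n + 2), ((-1 : ℤ) ^ (i : ℕ)) • (e k σ (p i) ⊗ₜ wedge k (p ∘ i.succAbove)))
  + ∑ l : Fin (n + 2), ∑ m : Fin (n + 1), if m.castSucc < l then
      ((-1 : ℤ) ^ ((m : ℕ) + (l : ℕ))) • ∑ a : Fin 5,
        structConst k (p m.castSucc) (p l) a •
          ((1 : U k σ) ⊗ₜ wedge k (Fin.cons a (p ∘ l.succAbove ∘ m.succAbove)))
    else 0

/-- `∂_0^h = ε_h`, as a morphism of `U_h(𝔞)`-modules. -/
def d0 (σ : ℤˣ) : U k σ →ₗ[U k σ] Triv k σ where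
  toFun := fun x => counit k σ x
  map_add' := fun x y => map_add (counit k σ) x y
  map_smul' := fun x y => map_mul (counit k σ) x y

/-- `∂_1^h`. -/
def d1 (σ : ℤˣ) : Kos k σ 1 →ₗ[U k σ] U k σ :=
  kosLift k σ fun p => e k σ (p 0)

/-- `∂_2^h`. -/
def d2 (σ : ℤˣ) : Kos k σ 2 →ₗ[U k σ] Kos k σ 1 :=
  kosLift k σ fun p => koszul k σ 0 p - Q k σ (p 0) (p 1) ⊗ₜ wedge k ![0]

/-- `∂_3^h`. -/
def d3 (σ : ℤˣ) : Kos k σ 3 →ₗ[U k σ] Kos k σ 2 :=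
  kosLift k σ fun p => koszul k σ 1 p
    - Q k σ (p 0) (p 1) ⊗ₜ wedge k ![0, p 2]
    + Q k σ (p 0) (p 2) ⊗ₜ wedge k ![0, p 1]
    - Q k σ (p 1) (p 2) ⊗ₜ wedge k ![0, p 0]

/-- `∂_4^h`: undeformed on `e_1 ∧ e_i ∧ e_j ∧ e_k`, deformed on `e_2 ∧ e_3 ∧ e_4 ∧ e_5`. -/
def d4 (σ : ℤˣ) : Kos k σ 4 →ₗ[U k σ] Kos k σ 3 :=
  kosLift k σ fun p =>
    if p 0 = 0 then koszul k σ 2 p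
    else koszul k σ 2 p
      + Q k σ 2 4 ⊗ₜ wedge k ![0, 1, 3]
      - Q k σ 2 3 ⊗ₜ wedge k ![0, 1, 4]
      - Q k σ 3 4 ⊗ₜ wedge k ![0, 1, 2]
      - Q k σ 1 4 ⊗ₜ wedge k ![0, 2, 3]

/-- `∂_5^h`. -/
def d5 (σ : ℤˣ) : Kos k σ 5 →ₗ[U k σ] Kos k σ 4 :=
  kosLift k σ fun p => koszul k σ 3 p

/-! ### The right action on `Ext` -/

/-- Right multiplication by `u`, an endomorphism of the left module `U_h(𝔞)`. -/
def rightMul (σ : ℤˣ) (u : U k σ) : U k σ →ₗ[U k σ] U k σ :=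
  LinearMap.toSpanSingleton (U k σ) (U k σ) u

/-- `Ext^5_{U_h(𝔞)} (k[[h]], U_h(𝔞))`, computed in the category of left `U_h(𝔞)`-modules. -/
abbrev Ext5 (σ : ℤˣ) : Type u :=
  Abelian.Ext (ModuleCat.of (U k σ) (Triv k σ)) (ModuleCat.of (U k σ) (U k σ)) 5

/-- The action of `u` on `Ext^5_{U_h(𝔞)} (k[[h]], U_h(𝔞))` by right multiplication, that is
the map induced functorially by right multiplication by `u` on the second argument. -/
def extRightMul (σ : ℤˣ) (u : U k σ) : Ext5 k σ →+ Ext5 k σ :=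
  (Abelian.Ext.mk₀ (ModuleCat.ofHom (rightMul k σ u))).postcomp
    (ModuleCat.of (U k σ) (Triv k σ)) (add_zero 5)

end

end QuantumKoszul

/-! Number the generators e_0, …, e_4 as in the code, so that e_0 is the e_1 of the statement, and
put c_{ij} = C_{ij}^0 + P_{ij}/e_0 (`cU`). The defining relations become [e_i, e_j] = c_{ij} e_0,
where e_0 and all c_{ij} are central and c_{0j} = 0. The deformed differentials are then the
Chevalley–Eilenberg formulas with these central structure constants (`d2_wedge`, `d3_wedge`,
`d4_wedge`, `d5_wedge`), and they square to zero because the terms produced by reordering generators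
cancel the bracket terms.

Exactness requires control of the size of U_h(𝔞), that is, a Poincaré–Birkhoff–Witt theorem. On
power series in h with coefficients in k[x_0, …, x_4], let e_i act by x_i + ∑_{j>i} [e_i, e_j] ∂_j,
which is left multiplication written on monomials ordered as e_4^* e_3^* e_2^* e_1^* e_0^*. These
operators satisfy the relations (`act_relator`), and acting on 1 inverts normal ordering
(`symU_act_one`, `act_one_symT`). Hence e_0 is not a zero divisor. The quotient by e_0 is k[y_0, …,
y_3][[h]], which is commutative, since every commutator is a multiple of e_0 (`toPoly`,
`exists_of_toPoly_eq_zero`).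

Every bracket term in a differential contains e_0 in its wedge, so the coordinates without e_0 of a
cycle reduce, modulo e_0, to a cycle of the ordinary Koszul complex of the regular sequence y_0, …,
y_3. That complex is exact (`polyH_exact41`, `polyH_exact42`, `polyH_exact43`). Subtracting one
boundary makes these coordinates divisible by e_0, subtracting a second one makes them zero, and a
cycle supported on wedges containing e_0 vanishes because e_0 is regular.

For Ext^5, a functional on the top term is its value u on the top wedge, and every functional is a
cocycle. Since `d5` has no bracket terms, the coboundaries are the values in ∑ e_i U = ker ε_h
(`topClass_eq_zero_iff`). Thus Ext^5 = U/ker ε_h = k[[h]], and right multiplication by u acts as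
ε_h(u). -/

namespace QuantumKoszul

/-! ### Additive maps commuting with the formal variable -/

section Extension

universe u₁ u₂ u₃
variable {A : Type u₁} [Ring A] {B : Type u₂} [Ring B] {M : Type u₃} [AddCommGroup M]

/-- Two additive maps out of `A⟦X⟧` into a separated group that intertwine multiplication by `X`
with the same operator agree as soon as they agree on constants. -/
lemma addMonoidHom_eq_of_C {t : M → M} (ht : ∀ m : M, (∀ n, ∃ m', m = t^[n] m') → m = 0)
    (t_sub : ∀ x y, t (x - y) = t x - t y)
    {f g : PowerSeries A →+ M} (hf : ∀ x, f (X * x) = t (f x)) (hg : ∀ x, g (X * x) = t (g x))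
    (hC : ∀ a, f (C a) = g (C a)) (x : PowerSeries A) : f x = g x := by
  have key : ∀ (n : ℕ) (x : PowerSeries A), ∃ x', f x - g x = t^[n] (f x' - g x') := by
    intro n
    induction n with
    | zero => exact fun x => ⟨x, rfl⟩
    | succ n ih =>
      intro x
      obtain ⟨y, hy⟩ := ih x
      -- The witness is the shift y' in y = X y' + constant. The two maps agree on the constant, so
      -- their difference at y is `t` applied to their difference at y'.
      refine ⟨PowerSeries.mk fun p => coeff (p + 1) y, ?_⟩
      rw [hy, Function.iterate_succ_apply, t_sub, ← hf, ← hg]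
      congr 1
      conv_lhs => rw [PowerSeries.eq_X_mul_shift_add_const y]
      simp only [map_add]
      rw [show f (C (constantCoeff y)) = g (C (constantCoeff y)) from hC _]
      abel
  refine sub_eq_zero.mp (ht _ fun n => ?_)
  obtain ⟨x', hx'⟩ := key n x
  exact ⟨_, hx'⟩

lemma X_mul_iterate_separated (v : PowerSeries B)
    (hv : ∀ n : ℕ, ∃ v', v = (fun w : PowerSeries B => X * w)^[n] v') : v = 0 := by
  ext n
  obtain ⟨v', hv'⟩ := hv (n + 1)
  rw [mul_left_iterate] at hv'
  exact PowerSeries.X_pow_dvd_iff.mp ⟨v', hv'⟩ n (Nat.lt_succ_self n)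

lemma powerSeries_addMonoidHom_eq {f g : PowerSeries A →+ PowerSeries B}
    (hf : ∀ x, f (X * x) = X * f x) (hg : ∀ x, g (X * x) = X * g x)
    (hC : ∀ a, f (C a) = g (C a)) (x : PowerSeries A) : f x = g x :=
  addMonoidHom_eq_of_C (t := fun w => X * w) X_mul_iterate_separated
    (fun _ _ => mul_sub _ _ _) hf hg hC x

/-- The extension of an additive map `A → B⟦X⟧` to `A⟦X⟧` commuting with `X`. -/
noncomputable def extend (φ : A →+ PowerSeries B) : PowerSeries A →+ PowerSeries B where
  toFun x := PowerSeries.mk fun n =>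
    ∑ p ∈ Finset.HasAntidiagonal.antidiagonal n, coeff p.2 (φ (coeff p.1 x))
  map_zero' := by ext; simp
  map_add' x y := by ext; simp [Finset.sum_add_distrib]

lemma coeff_extend (φ : A →+ PowerSeries B) (x : PowerSeries A) (n : ℕ) :
    coeff n (extend φ x) = ∑ p ∈ Finset.HasAntidiagonal.antidiagonal n, coeff p.2 (φ (coeff p.1 x))
        :=
  PowerSeries.coeff_mk n fun n =>
    ∑ p ∈ Finset.HasAntidiagonal.antidiagonal n, coeff p.2 (φ (coeff p.1 x))

lemma extend_X_mul (φ : A →+ PowerSeries B) (x : PowerSeries A) :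
    extend φ (X * x) = X * extend φ x := by
  ext n
  cases n with
  | zero => simp [coeff_extend]
  | succ n =>
    rw [PowerSeries.coeff_succ_X_mul, coeff_extend, coeff_extend, Finset.Nat.antidiagonal_succ]
    simp [PowerSeries.coeff_succ_X_mul]

lemma extend_C (φ : A →+ PowerSeries B) (a : A) : extend φ (C a) = φ a := by
  ext n
  rw [coeff_extend, Finset.sum_eq_single (0, n)]
  · simp
  · rintro ⟨i, j⟩ h1 h2
    have : i ≠ 0 := by
      rintro rfl
      simp at h1
      exact h2 (by simp [h1])
    simp [PowerSeries.coeff_C, this]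
  · simp

/-- The coefficientwise extension of an additive map. -/
noncomputable def mapCoeff (φ : A →+ B) : PowerSeries A →+ PowerSeries B where
  toFun x := PowerSeries.mk fun n => φ (coeff n x)
  map_zero' := by ext; simp
  map_add' x y := by ext; simp

@[simp] lemma coeff_mapCoeff (φ : A →+ B) (x : PowerSeries A) (n : ℕ) :
    coeff n (mapCoeff φ x) = φ (coeff n x) :=
  PowerSeries.coeff_mk n fun n => φ (coeff n x)

lemma mapCoeff_X_mul (φ : A →+ B) (x : PowerSeries A) :
    mapCoeff φ (X * x) = X * mapCoeff φ x := by
  ext n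
  cases n <;> simp [PowerSeries.coeff_succ_X_mul]

lemma mapCoeff_C (φ : A →+ B) (a : A) : mapCoeff φ (C a) = C (φ a) := by
  ext n
  simp only [coeff_mapCoeff, PowerSeries.coeff_C]
  split_ifs <;> simp

lemma powerSeries_X_mul_comm (x : PowerSeries A) : x * X = X * x :=
  (PowerSeries.commute_X x).eq

end Extension

/-- The commutator of two first order differential operators `x a + ∑ j, c a j ∂ j` whose
coefficients `c` are constant along each other. -/
lemma first_order_commutator {R : Type*} [CommRing R] {ι : Type*} [Fintype ι] [DecidableEq ι]
    (x : ι → R) (c : ι → ι → R) (p : ι → R →+ R)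
    (p_mul : ∀ j v w, p j (v * w) = p j v * w + v * p j w)
    (p_comm : ∀ i j v, p i (p j v) = p j (p i v))
    (p_x : ∀ m b, p m (x b) = if b = m then 1 else 0)
    (p_c : ∀ a m b l, c a m * p m (c b l) = 0) (i j : ι) (v : R) :
    (x i * (x j * v + ∑ l, c j l * p l v) + ∑ m, c i m * p m (x j * v + ∑ l, c j l * p l v)) -
      (x j * (x i * v + ∑ l, c i l * p l v) + ∑ m, c j m * p m (x i * v + ∑ l, c i l * p l v)) =
      (c i j - c j i) * v := by
  -- Leibniz expansion of the differential part of the operator `a` applied to the operator `b`. By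
  -- `p_c` no term survives in which a coefficient is differentiated.
  have aux : ∀ a b : ι, ∑ m, c a m * p m (x b * v + ∑ l, c b l * p l v) =
      c a b * v + x b * ∑ m, c a m * p m v + ∑ m, ∑ l, c a m * c b l * p m (p l v) := by
    intro a b
    have h : ∀ m, c a m * p m (x b * v + ∑ l, c b l * p l v) =
        (if b = m then c a m * v else 0) + x b * (c a m * p m v)
          + ∑ l, c a m * c b l * p m (p l v) := by
      intro m
      rw [map_add, p_mul, p_x, map_sum, mul_add, mul_add, Finset.mul_sum]
      congr 1
      · split_ifs <;> ring
      · refine Finset.sum_congr rfl fun l _ => ?_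
        rw [p_mul, mul_add, ← mul_assoc, p_c, zero_mul, zero_add, mul_assoc]
    rw [Finset.sum_congr rfl fun m _ => h m, Finset.sum_add_distrib, Finset.sum_add_distrib,
      Finset.sum_ite_eq, if_pos (Finset.mem_univ _), ← Finset.mul_sum]
  -- The second order part is symmetric in `i` and `j` because partial derivatives commute. The
  -- terms with x_i and x_j are visibly symmetric as well, so only the zeroth order terms c_{ij} and
  -- c_{ji} remain.
  have sym : ∑ m, ∑ l, c i m * c j l * p m (p l v) = ∑ m, ∑ l, c j m * c i l * p m (p l v) := by
    rw [Finset.sum_comm]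
    refine Finset.sum_congr rfl fun l _ => Finset.sum_congr rfl fun m _ => ?_
    rw [p_comm, mul_comm (c i m)]
  rw [aux, aux, sym]
  ring

/-! ### The normal ordering representation -/

noncomputable section

variable (k : Type u) [Field k]

/-- Power series in `h` with polynomial coefficients, the space of normally ordered symbols. -/
abbrev Symb : Type u := PowerSeries (MvPolynomial (Fin 5) k)

/-- The symbol of the `i`-th generator. -/
def sx (i : Fin 5) : Symb k := C (MvPolynomial.X i)

/-- Coefficientwise partial derivatives of symbols. -/
def pd (j : Fin 5) : Symb k →+ Symb k :=
  mapCoeff ((MvPolynomial.pderiv j).toLinearMap.toAddMonoidHom : _ →+ MvPolynomial (Fin 5) k)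

lemma coeff_pd (j : Fin 5) (v : Symb k) (n : ℕ) :
    coeff n (pd k j v) = MvPolynomial.pderiv j (coeff n v) := coeff_mapCoeff _ _ _

lemma pd_mul (j : Fin 5) (v w : Symb k) : pd k j (v * w) = pd k j v * w + v * pd k j w := by
  ext1 n
  simp only [coeff_pd, PowerSeries.coeff_mul, map_add, map_sum, Derivation.leibniz, smul_eq_mul]
  rw [← Finset.sum_add_distrib]
  exact Finset.sum_congr rfl fun _ _ => by ring

lemma pd_C (j : Fin 5) (p : MvPolynomial (Fin 5) k) :
    pd k j (C p) = C (MvPolynomial.pderiv j p) := mapCoeff_C _ _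

lemma pd_X_mul (j : Fin 5) (v : Symb k) : pd k j (X * v) = X * pd k j v := mapCoeff_X_mul _ _

lemma pd_sx (i j : Fin 5) : pd k j (sx k i) = if i = j then 1 else 0 := by
  rw [sx, pd_C, MvPolynomial.pderiv_X]
  by_cases h : i = j
  · subst h; simp
  · simp [h]

lemma pd_comm (i j : Fin 5) (v : Symb k) : pd k i (pd k j v) = pd k j (pd k i v) := by
  ext1 n
  simp only [coeff_pd]
  generalize coeff n v = p
  have h : ⁅(MvPolynomial.pderiv i : Derivation k (MvPolynomial (Fin 5) k) (MvPolynomial (Fin 5)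
      k)),
      (MvPolynomial.pderiv j : Derivation k (MvPolynomial (Fin 5) k) (MvPolynomial (Fin 5) k))⁆
      = 0 := by
    refine MvPolynomial.derivation_ext fun l => ?_
    rw [Derivation.commutator_apply, MvPolynomial.pderiv_X, MvPolynomial.pderiv_X]
    simp only [Pi.single_apply]
    split_ifs <;> simp
  have h2 := congrArg (fun D => D p) h
  simp only [Derivation.commutator_apply] at h2
  exact sub_eq_zero.mp h2

lemma pd_smul (j : Fin 5) (c : k) (v : Symb k) : pd k j (c • v) = c • pd k j v := by
  ext1 n
  simp [coeff_pd]

/-- The commutators `[e_i, e_j]` for `i < j`, as symbols. -/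
def comSymb (σ : ℤˣ) : Fin 5 → Fin 5 → Symb k
  | 1, 3 => (2 : k) • sx k 0
  | 2, 4 => (2 / 3 : k) • (X ^ 2 * sx k 0 ^ 3)
  | 3, 4 => (((σ : ℤ) : k) / 6) • (X ^ 3 * sx k 0 ^ 4)
  | 1, 4 => -(X * sx k 0 ^ 2)
  | 2, 3 => -(X * sx k 0 ^ 2)
  | _, _ => 0

/-- The action of the `i`-th generator on symbols. -/
def genAct (σ : ℤˣ) (i : Fin 5) : Module.End k (Symb k) where
  -- Left multiplication by e_i in normal order: e_i travels right past each e_j^n with j > i, and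
  -- each passage leaves [e_i, e_j] · n e_j^{n-1}. As `comSymb` vanishes unless i < j, the sum can
  -- run over all j.
  toFun v := sx k i * v + ∑ j, comSymb k σ i j * pd k j v
  map_add' v w := by
    simp only [map_add, mul_add, Finset.sum_add_distrib]; abel
  map_smul' c v := by
    simp [pd_smul, Finset.smul_sum]

lemma genAct_apply (σ : ℤˣ) (i : Fin 5) (v : Symb k) :
    genAct k σ i v = sx k i * v + ∑ j, comSymb k σ i j * pd k j v := rfl

lemma genAct_X_mul (σ : ℤˣ) (i : Fin 5) (v : Symb k) :
    genAct k σ i (X * v) = X * genAct k σ i v := by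
  simp only [genAct_apply, pd_X_mul, mul_add, Finset.mul_sum, mul_left_comm X]

lemma pd_X_pow_mul (j : Fin 5) (n : ℕ) (v : Symb k) : pd k j (X ^ n * v) = X ^ n * pd k j v := by
  induction n with
  | zero => simp
  | succ n ih => rw [pow_succ', mul_assoc, pd_X_mul, ih, mul_assoc]

lemma pd_sx_zero_pow (j : Fin 5) (hj : j ≠ 0) (n : ℕ) : pd k j (sx k 0 ^ n) = 0 := by
  induction n with
  | zero => rw [pow_zero, ← map_one (C (R := MvPolynomial (Fin 5) k)), pd_C]; simp
  | succ n ih => simp [pow_succ, pd_mul, ih, pd_sx, hj.symm]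

lemma pd_comSymb (σ : ℤˣ) (i j l : Fin 5) (hl : l ≠ 0) : pd k l (comSymb k σ i j) = 0 := by
  have h1 := pd_sx_zero_pow k l hl 1
  rw [pow_one] at h1
  unfold comSymb
  split <;> simp [pd_smul, pd_X_pow_mul, pd_X_mul, pd_sx_zero_pow k l hl, h1]

lemma comSymb_zero_right (σ : ℤˣ) (i : Fin 5) : comSymb k σ i 0 = 0 := by
  fin_cases i <;> rfl

/-- The coefficients involve only x_0 and h, while ∂_0 never occurs in the operators since `comSymb`
vanishes at j = 0. Hence no operator differentiates the coefficients of another, as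
`first_order_commutator` demands. -/
lemma genAct_commutator (σ : ℤˣ) (i j : Fin 5) (v : Symb k) :
    genAct k σ i (genAct k σ j v) - genAct k σ j (genAct k σ i v) =
      (comSymb k σ i j - comSymb k σ j i) * v := by
  refine first_order_commutator (sx k) (comSymb k σ) (pd k) (pd_mul k) (pd_comm k)
    (fun m b => pd_sx k b m) (fun a m b l => ?_) i j v
  by_cases hm : m = 0
  · subst hm; rw [comSymb_zero_right, zero_mul]
  · rw [pd_comSymb k σ b l m hm, mul_zero]

/-- The action of the free algebra on symbols. -/
def freeAct (σ : ℤˣ) : FreeAlgebra k (Fin 5) →ₐ[k] Module.End k (Symb k) :=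
  FreeAlgebra.lift k (genAct k σ)

lemma freeAct_X_mul (σ : ℤˣ) (a : FreeAlgebra k (Fin 5)) (v : Symb k) :
    freeAct k σ a (X * v) = X * freeAct k σ a v := by
  induction a generalizing v with
  | grade0 r => simp [Module.algebraMap_end_apply]
  | grade1 i => simp [freeAct, genAct_X_mul]
  | mul a b ha hb => simp [hb, ha]
  | add a b ha hb => simp [ha, hb, mul_add]

/-- The action of the completed tensor algebra on symbols. -/
def act (σ : ℤˣ) (v : Symb k) : CompletedTensor k →+ Symb k :=
  extend ((LinearMap.applyₗ v ∘ₗ (freeAct k σ).toLinearMap).toAddMonoidHom)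

lemma act_hT_mul (σ : ℤˣ) (v : Symb k) (x : CompletedTensor k) :
    act k σ v (hT k * x) = X * act k σ v x := extend_X_mul _ _

lemma act_C (σ : ℤˣ) (v : Symb k) (a : FreeAlgebra k (Fin 5)) :
    act k σ v (C a) = freeAct k σ a v := extend_C _ _

lemma act_X_mul (σ : ℤˣ) (v : Symb k) (x : CompletedTensor k) :
    act k σ (X * v) x = X * act k σ v x := by
  refine powerSeries_addMonoidHom_eq (f := act k σ (X * v))
    (g := (AddMonoidHom.mulLeft X).comp (act k σ v)) (fun y => ?_) (fun y => ?_) (fun a => ?_) x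
  · exact act_hT_mul k σ _ y
  · exact congrArg (X * ·) (act_hT_mul k σ _ y)
  · simp [act_C, freeAct_X_mul]

/-- Both sides commute with h in each variable, so it is enough to take first x and then y constant.
There the claim is multiplicativity of `freeAct`. -/
lemma act_mul (σ : ℤˣ) (v : Symb k) (x y : CompletedTensor k) :
    act k σ v (x * y) = act k σ (act k σ v y) x := by
  refine powerSeries_addMonoidHom_eq (f := (act k σ v).comp (AddMonoidHom.mulRight y))
    (g := act k σ (act k σ v y)) (fun z => ?_) (fun z => ?_) (fun a => ?_) x
  · simp only [AddMonoidHom.comp_apply, AddMonoidHom.coe_mulRight, mul_assoc]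
    exact act_hT_mul k σ _ _
  · exact act_hT_mul k σ _ z
  · simp only [AddMonoidHom.comp_apply, AddMonoidHom.coe_mulRight, act_C]
    refine powerSeries_addMonoidHom_eq (f := (act k σ v).comp (AddMonoidHom.mulLeft (C a)))
      (g := (freeAct k σ a).toAddMonoidHom.comp (act k σ v))
      (fun z => ?_) (fun z => ?_) (fun b => ?_) y
    · simp only [AddMonoidHom.comp_apply, AddMonoidHom.coe_mulLeft]
      rw [← mul_assoc, powerSeries_X_mul_comm, mul_assoc]
      exact act_hT_mul k σ _ _
    · simp only [AddMonoidHom.comp_apply, LinearMap.toAddMonoidHom_coe]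
      rw [← freeAct_X_mul]
      exact congrArg _ (act_hT_mul k σ _ _)
    · simp only [AddMonoidHom.comp_apply, AddMonoidHom.coe_mulLeft, LinearMap.toAddMonoidHom_coe]
      rw [← map_mul, act_C, act_C, map_mul]
      rfl

lemma act_genT (σ : ℤˣ) (v : Symb k) (i : Fin 5) : act k σ v (genT k i) = genAct k σ i v := by
  rw [genT, act_C, freeAct, FreeAlgebra.lift_ι_apply]

lemma act_smul (σ : ℤˣ) (v : Symb k) (c : k) (x : CompletedTensor k) :
    act k σ v (c • x) = c • act k σ v x := by
  ext1 n
  simp [act, coeff_extend, Finset.smul_sum]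

lemma act_one (σ : ℤˣ) (v : Symb k) : act k σ v 1 = v := by
  rw [← map_one (C (R := FreeAlgebra k (Fin 5))), act_C, map_one]; rfl

lemma act_genT_zero (σ : ℤˣ) (v : Symb k) : act k σ v (genT k 0) = sx k 0 * v := by
  have : ∀ j, comSymb k σ 0 j = 0 := fun j => by fin_cases j <;> rfl
  simp [act_genT, genAct_apply, this]

lemma act_hT_pow_mul (σ : ℤˣ) (v : Symb k) (n : ℕ) (x : CompletedTensor k) :
    act k σ v (hT k ^ n * x) = X ^ n * act k σ v x := by
  induction n with
  | zero => simp
  | succ n ih => rw [pow_succ', mul_assoc, act_hT_mul, ih, pow_succ', mul_assoc]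

/-- The commutator of two generators acts as multiplication by a polynomial in x_0 and h. Since e_0
acts as multiplication by x_0, the Lie bracket together with P_{ij} acts by that same polynomial. -/
lemma act_relator (σ : ℤˣ) (i j : Fin 5) (v : Symb k) : act k σ v (relator k σ i j) = 0 := by
  -- `comSymb` merges the deformation terms with the Lie bracket 2 e_0, which occurs at (1, 3) only.
  -- This equation separates the two contributions.
  have h : ∀ a b, act k σ v (halfQuotT k σ a b * genT k 0) +
      (if (a, b) = (1, 3) then (2 : k) • (sx k 0 * v) else 0) = comSymb k σ a b * v := by
    intro a b
    have hs1 : ∀ w : Symb k, act k σ w (hT k) = X * w := fun w => by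
      rw [← mul_one (hT k), act_hT_mul, act_one]
    fin_cases a <;> fin_cases b <;>
      simp [halfQuotT, comSymb, act_mul, act_smul, hs1, act_genT_zero, mul_assoc, pow_succ]
  have h1 := h i j
  have h2 := h j i
  have hs : act k σ v (∑ a, structConst k i j a • genT k a) =
      (if (i, j) = (1, 3) then (2 : k) • (sx k 0 * v) else 0) -
      (if (j, i) = (1, 3) then (2 : k) • (sx k 0 * v) else 0) := by
    rw [map_sum, Finset.sum_eq_single 0]
    · rw [act_smul, act_genT_zero]
      unfold structConst
      simp only [Prod.mk.injEq]
      split_ifs <;> simp_all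
    · intro b _ hb
      simp [structConst, hb]
    · simp
  rw [relator, monT, quotT, sub_mul, map_sub, map_sub, map_sub, hs, map_sub, act_mul, act_mul,
    act_genT, act_genT, act_genT, act_genT, genAct_commutator, sub_mul, ← h1, ← h2]
  abel

/-! ### The kernel of the action on symbols -/

/-- The two-sided ideal of elements acting as zero modulo `h ^ n`. -/
def actIdeal (σ : ℤˣ) (n : ℕ) : TwoSidedIdeal (CompletedTensor k) :=
  TwoSidedIdeal.mk' {x | ∀ v, (X : Symb k) ^ n ∣ act k σ v x}
    (by simp)
    (fun hx hy v => by rw [map_add]; exact dvd_add (hx v) (hy v))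
    (fun hx v => by rw [map_neg]; exact (hx v).neg_right)
    (fun {x y} hy v => by
      obtain ⟨w, hw⟩ := hy v
      have : ∀ n (w : Symb k), act k σ (X ^ n * w) x = X ^ n * act k σ w x := by
        intro n w
        induction n with
        | zero => simp
        | succ n ih => rw [pow_succ', mul_assoc, act_X_mul, ih, mul_assoc]
      rw [act_mul, hw, this]
      exact dvd_mul_right _ _)
    (fun {x y} hx v => by rw [act_mul]; exact hx _)

lemma mem_actIdeal (σ : ℤˣ) (n : ℕ) (x : CompletedTensor k) :
    x ∈ actIdeal k σ n ↔ ∀ v, (X : Symb k) ^ n ∣ act k σ v x := by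
  unfold actIdeal
  rw [TwoSidedIdeal.mem_mk']
  rfl

lemma mem_relIdeal (σ : ℤˣ) (x : CompletedTensor k) :
    x ∈ relIdeal k σ ↔ ∀ n : ℕ, x ∈ TwoSidedIdeal.span
      (Set.range (fun p : Fin 5 × Fin 5 => relator k σ p.1 p.2) ∪ {hT k ^ n}) := by
  unfold relIdeal
  rw [TwoSidedIdeal.mem_iInf]

/-- Membership in the closure means membership in J + (h^n) for all n. Such elements act with values
divisible by h^n, and symbols are h-adically separated. -/
lemma act_eq_zero (σ : ℤˣ) {x : CompletedTensor k} (hx : x ∈ relIdeal k σ) (v : Symb k) :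
    act k σ v x = 0 := by
  have key : ∀ n : ℕ, TwoSidedIdeal.span (Set.range (fun p : Fin 5 × Fin 5 => relator k σ p.1 p.2) ∪
      {hT k ^ n}) ≤ actIdeal k σ n := by
    intro n
    rw [TwoSidedIdeal.span_le]
    rintro y (⟨p, rfl⟩ | rfl) <;> rw [SetLike.mem_coe, mem_actIdeal] <;> intro w
    · simp [act_relator]
    · rw [← mul_one (hT k ^ n), act_hT_pow_mul]
      exact dvd_mul_right _ _
  ext1 n
  have h := (mem_actIdeal k σ (n + 1) x).mp (key (n + 1) ((mem_relIdeal k σ x).mp hx (n + 1))) v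
  exact PowerSeries.X_pow_dvd_iff.mp h n (Nat.lt_succ_self n)

/-! ### Relations in the quantized enveloping algebra -/

lemma proj_surjective (σ : ℤˣ) : Function.Surjective (proj k σ) := fun u => by
  obtain ⟨x, rfl⟩ := RingCon.mk'_surjective (c := (relIdeal k σ).ringCon) u
  exact ⟨x, rfl⟩

lemma proj_eq_zero_iff (σ : ℤˣ) (x : CompletedTensor k) : proj k σ x = 0 ↔ x ∈ relIdeal k σ := by
  rw [← map_zero (proj k σ), TwoSidedIdeal.mem_iff]
  exact RingCon.eq _

lemma proj_smul (σ : ℤˣ) (c : k) (x : CompletedTensor k) :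
    proj k σ (c • x) = c • proj k σ x := rfl

/-- The deformation parameter in `U_h(𝔞)`. -/
def hU (σ : ℤˣ) : U k σ := proj k σ (hT k)

lemma hU_comm (σ : ℤˣ) (u : U k σ) : u * hU k σ = hU k σ * u := by
  obtain ⟨x, rfl⟩ := proj_surjective k σ u
  rw [hU, ← map_mul, ← map_mul]
  exact congrArg _ (powerSeries_X_mul_comm x)

/-- This is where closing the ideal matters: if x is congruent to h^n y modulo the closure, then x
lies in J + (h^n), and this for every n places x in the closure itself. Identities in U_h(𝔞) can
therefore be checked on constants in h. -/
lemma hU_separated (σ : ℤˣ) (u : U k σ)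
    (hu : ∀ n : ℕ, ∃ u', u = (fun w => hU k σ * w)^[n] u') : u = 0 := by
  obtain ⟨x, rfl⟩ := proj_surjective k σ u
  rw [proj_eq_zero_iff, mem_relIdeal]
  intro n
  obtain ⟨u', hu'⟩ := hu n
  obtain ⟨y, rfl⟩ := proj_surjective k σ u'
  rw [mul_left_iterate, hU, ← map_pow] at hu'
  change _ = proj k σ (hT k ^ n) * proj k σ y at hu'
  rw [← map_mul, ← sub_eq_zero, ← map_sub, proj_eq_zero_iff, mem_relIdeal] at hu'
  have h := TwoSidedIdeal.add_mem _ (hu' n) (TwoSidedIdeal.mul_mem_right _ _ y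
    (TwoSidedIdeal.subset_span (Set.mem_union_right (Set.range fun p : Fin 5 × Fin 5 =>
      relator k σ p.1 p.2) (Set.mem_singleton (hT k ^ n)))))
  rwa [sub_add_cancel] at h

/-- Additive maps from power series to `U_h(𝔞)` compatible with `h` are determined by their
values on constants. -/
lemma addMonoidHom_U_eq (σ : ℤˣ) {A : Type*} [Ring A] {f g : PowerSeries A →+ U k σ}
    (hf : ∀ x, f (X * x) = hU k σ * f x) (hg : ∀ x, g (X * x) = hU k σ * g x)
    (hC : ∀ a, f (C a) = g (C a)) (x : PowerSeries A) : f x = g x :=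
  addMonoidHom_eq_of_C (t := fun w => hU k σ * w) (hU_separated k σ)
    (fun _ _ => mul_sub _ _ _) hf hg hC x

lemma proj_relator (σ : ℤˣ) (i j : Fin 5) : proj k σ (relator k σ i j) = 0 := by
  rw [proj_eq_zero_iff, mem_relIdeal]
  exact fun n => TwoSidedIdeal.subset_span (Or.inl ⟨(i, j), rfl⟩)

/-- The elements `c i j` with `[e_i, e_j] = c i j * e_0`. -/
def cU (σ : ℤˣ) (i j : Fin 5) : U k σ := algebraMap k _ (structConst k i j 0) + Q k σ i j

/-- The bracket of 𝔞 takes values in the span of e_0 and each P_{ij} is a multiple of e_0, so one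
factor e_0 can be split off. -/
lemma e_commutator (σ : ℤˣ) (i j : Fin 5) :
    e k σ i * e k σ j - e k σ j * e k σ i = cU k σ i j * e k σ 0 := by
  have h := proj_relator k σ i j
  rw [relator, monT, Finset.sum_eq_single 0 (fun b _ hb => by simp [structConst, hb])
    (by simp), map_sub, map_sub, map_sub, map_mul, map_mul, map_mul, proj_smul] at h
  rw [cU, add_mul, ← Algebra.smul_def]
  rw [sub_sub, sub_eq_zero] at h
  exact h

lemma Q_eq (σ : ℤˣ) (i j : Fin 5) :
    Q k σ i j = proj k σ (halfQuotT k σ i j) - proj k σ (halfQuotT k σ j i) := map_sub _ _ _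

lemma cU_zero_left (σ : ℤˣ) (j : Fin 5) : cU k σ 0 j = 0 := by
  fin_cases j <;> simp [cU, Q_eq, halfQuotT, structConst]

lemma e_zero_comm_e (σ : ℤˣ) (j : Fin 5) : e k σ 0 * e k σ j = e k σ j * e k σ 0 := by
  have := e_commutator k σ 0 j
  rwa [cU_zero_left, zero_mul, sub_eq_zero] at this

/-- Elements commuting with the generators and with `h` are central. -/
lemma central_of_comm_e (σ : ℤˣ) {z : U k σ} (hz : ∀ i, z * e k σ i = e k σ i * z) (u : U k σ) :
    z * u = u * z := by
  obtain ⟨x, rfl⟩ := proj_surjective k σ u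
  refine addMonoidHom_U_eq k σ
    (f := (AddMonoidHom.mulLeft z).comp (proj k σ : CompletedTensor k →+ U k σ))
    (g := (AddMonoidHom.mulRight z).comp (proj k σ : CompletedTensor k →+ U k σ))
    (fun y => ?_) (fun y => ?_) (fun a => ?_) x
  · change z * proj k σ (hT k * y) = hU k σ * (z * proj k σ y)
    rw [map_mul, ← mul_assoc, ← mul_assoc, ← hU, hU_comm]
  · change proj k σ (hT k * y) * z = hU k σ * (proj k σ y * z)
    rw [map_mul, ← mul_assoc, hU]
  · change z * proj k σ (C a) = proj k σ (C a) * z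
    induction a with
    | grade0 r =>
      have : proj k σ (C (algebraMap k _ r)) = r • (1 : U k σ) := by
        rw [← map_one (proj k σ), ← proj_smul]
        congr 1
        ext n
        rw [PowerSeries.coeff_C, PowerSeries.coeff_smul, PowerSeries.coeff_one]
        split_ifs <;> simp [Algebra.algebraMap_eq_smul_one]
      rw [this, mul_smul_comm, smul_mul_assoc, one_mul, mul_one]
    | grade1 i => exact hz i
    | mul a b ha hb => rw [map_mul, map_mul, ← mul_assoc, ha, mul_assoc, hb, mul_assoc]
    | add a b ha hb => rw [map_add, map_add, mul_add, add_mul, ha, hb]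

lemma e_zero_central (σ : ℤˣ) (u : U k σ) : e k σ 0 * u = u * e k σ 0 :=
  central_of_comm_e k σ (e_zero_comm_e k σ) u

lemma proj_halfQuotT_central (σ : ℤˣ) (i j : Fin 5) (u : U k σ) :
    proj k σ (halfQuotT k σ i j) * u = u * proj k σ (halfQuotT k σ i j) := by
  have h1 : Commute (proj k σ (genT k 0)) u := e_zero_central k σ u
  have h2 : Commute (proj k σ (hT k)) u := (hU_comm k σ u).symm
  change Commute _ u
  unfold halfQuotT
  split <;> simp only [proj_smul, map_mul, map_pow, map_neg, map_zero]
  · exact ((h2.pow_left _).mul_left (h1.pow_left _)).smul_left _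
  · exact ((h2.pow_left _).mul_left (h1.pow_left _)).smul_left _
  · exact (h2.mul_left h1).neg_left
  · exact (h2.mul_left h1).neg_left
  · exact Commute.zero_left _

lemma cU_central (σ : ℤˣ) (i j : Fin 5) (u : U k σ) : cU k σ i j * u = u * cU k σ i j := by
  rw [cU, Q_eq, add_mul, mul_add, Algebra.commutes, sub_mul, mul_sub, proj_halfQuotT_central,
    proj_halfQuotT_central]

/-! ### Normal ordering -/

/-- The normally ordered monomial with exponents `f` in a family of elements. -/
def normalMonomial {R : Type*} [Monoid R] (g : Fin 5 → R) (f : Fin 5 →₀ ℕ) : R :=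
  g 4 ^ f 4 * (g 3 ^ f 3 * (g 2 ^ f 2 * (g 1 ^ f 1 * g 0 ^ f 0)))

/-- The normal ordering of polynomials. -/
def normalOrder : MvPolynomial (Fin 5) k →ₗ[k] FreeAlgebra k (Fin 5) :=
  (MvPolynomial.basisMonomials (Fin 5) k).constr k fun s => normalMonomial (FreeAlgebra.ι k) s

lemma normalOrder_monomial (s : Fin 5 →₀ ℕ) (c : k) :
    normalOrder k (MvPolynomial.monomial s c) = c • normalMonomial (FreeAlgebra.ι k) s := by
  have : MvPolynomial.monomial s c = c • MvPolynomial.basisMonomials (Fin 5) k s := by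
    rw [MvPolynomial.coe_basisMonomials, MvPolynomial.smul_monomial, smul_eq_mul, mul_one]
  rw [this, map_smul, normalOrder, Module.Basis.constr_basis]

/-- The normal ordering of symbols, in the completed tensor algebra. -/
def symT : Symb k →+ CompletedTensor k := mapCoeff (normalOrder k).toAddMonoidHom

/-- The normal ordering of symbols, in `U_h(𝔞)`. -/
def symU (σ : ℤˣ) : Symb k →+ U k σ :=
  (proj k σ : CompletedTensor k →+ U k σ).comp (symT k)

lemma symU_X_mul (σ : ℤˣ) (v : Symb k) : symU k σ (X * v) = hU k σ * symU k σ v := by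
  change proj k σ (symT k (X * v)) = proj k σ (hT k) * proj k σ (symT k v)
  rw [symT, mapCoeff_X_mul, map_mul]
  rfl

lemma symU_smul (σ : ℤˣ) (c : k) (v : Symb k) : symU k σ (c • v) = c • symU k σ v := by
  change proj k σ (symT k (c • v)) = c • proj k σ (symT k v)
  rw [← proj_smul]
  congr 1
  ext1 n
  simp [symT]

lemma C_smul {A : Type*} [Ring A] [Algebra k A] (c : k) (a : A) :
    (C (c • a) : PowerSeries A) = c • C a := by
  ext n
  rw [PowerSeries.coeff_smul, PowerSeries.coeff_C, PowerSeries.coeff_C]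
  split_ifs <;> simp

lemma symU_C_monomial (σ : ℤˣ) (s : Fin 5 →₀ ℕ) (c : k) :
    symU k σ (C (MvPolynomial.monomial s c)) = c • normalMonomial (e k σ) s := by
  change proj k σ (symT k _) = _
  rw [symT, mapCoeff_C, LinearMap.toAddMonoidHom_coe, normalOrder_monomial, C_smul, proj_smul]
  simp only [normalMonomial, map_mul, map_pow]
  rfl

/-- Additive maps from symbols to `U_h(𝔞)` compatible with `h` are determined by their values on
monomials. -/
lemma addMonoidHom_symb_eq (σ : ℤˣ) {f g : Symb k →+ U k σ}
    (hf : ∀ x, f (X * x) = hU k σ * f x) (hg : ∀ x, g (X * x) = hU k σ * g x)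
    (hC : ∀ s c, f (C (MvPolynomial.monomial s c)) = g (C (MvPolynomial.monomial s c)))
    (x : Symb k) : f x = g x := by
  refine addMonoidHom_U_eq k σ hf hg (fun p => ?_) x
  induction p using MvPolynomial.induction_on' with
  | monomial s c => exact hC s c
  | add p q hp hq => rw [map_add, map_add, map_add, hp, hq]

/-- Leibniz rule for the derivation [x, ·], with [x, b] = z central. At n = 0 the truncated exponent
n - 1 is harmless because its coefficient is zero. -/
lemma mul_pow_of_commutator {R : Type*} [Ring R] {x b z : R} (hz : ∀ u, z * u = u * z)
    (h : x * b - b * x = z) (n : ℕ) : x * b ^ n = b ^ n * x + z * (n • b ^ (n - 1)) := by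
  have h' : x * b = b * x + z := by rw [← h]; abel
  induction n with
  | zero => simp
  | succ n ih =>
    rw [pow_succ, ← mul_assoc, ih, add_mul, mul_assoc, h', mul_add, ← mul_assoc,
      Nat.add_sub_cancel, succ_nsmul, mul_add, ← hz (b ^ n), mul_assoc z]
    cases n with
    | zero => simp
    | succ n =>
      simp only [Nat.add_sub_cancel, smul_mul_assoc, ← pow_succ]
      abel

lemma mul_pow_mul_of_commutator {R : Type*} [Ring R] {x b z : R} (hz : ∀ u, z * u = u * z)
    (h : x * b - b * x = z) (n : ℕ) (w : R) :
    x * (b ^ n * w) = b ^ n * (x * w) + z * (n • (b ^ (n - 1) * w)) := by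
  rw [← mul_assoc, mul_pow_of_commutator hz h, add_mul, mul_assoc, mul_assoc, smul_mul_assoc]

lemma proj_hT (σ : ℤˣ) : proj k σ (hT k) = hU k σ := rfl

lemma proj_genT (σ : ℤˣ) (i : Fin 5) : proj k σ (genT k i) = e k σ i := rfl

lemma symU_sx_zero_mul (σ : ℤˣ) (v : Symb k) : symU k σ (sx k 0 * v) = e k σ 0 * symU k σ v := by
  refine addMonoidHom_symb_eq k σ (f := (symU k σ).comp (AddMonoidHom.mulLeft (sx k 0)))
    (g := (AddMonoidHom.mulLeft (e k σ 0)).comp (symU k σ)) (fun x => ?_) (fun x => ?_)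
    (fun s c => ?_) v
  · simp only [AddMonoidHom.comp_apply, AddMonoidHom.coe_mulLeft]
    rw [mul_left_comm, symU_X_mul]
  · simp only [AddMonoidHom.comp_apply, AddMonoidHom.coe_mulLeft]
    rw [symU_X_mul, ← mul_assoc, hU_comm, mul_assoc]
  · simp only [AddMonoidHom.comp_apply, AddMonoidHom.coe_mulLeft]
    rw [sx, ← map_mul, MvPolynomial.X, MvPolynomial.monomial_mul, symU_C_monomial,
      symU_C_monomial, one_mul, mul_smul_comm]
    congr 1
    rw [e_zero_central]
    simp only [normalMonomial, mul_assoc]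
    simp [← pow_succ, add_comm]

lemma symU_comSymb_mul (σ : ℤˣ) {i j : Fin 5} (hij : i < j) (v : Symb k) :
    symU k σ (comSymb k σ i j * v) = cU k σ i j * e k σ 0 * symU k σ v := by
  fin_cases i <;> fin_cases j <;> first | exact absurd hij (by decide) | skip
  all_goals simp [comSymb, cU, Q_eq, halfQuotT, structConst, symU_smul, mul_assoc, proj_smul,
    symU_X_mul, symU_sx_zero_mul, pow_succ, proj_hT, proj_genT,
    Algebra.algebraMap_eq_smul_one]

lemma e_mul_pow_mul (σ : ℤˣ) (i j : Fin 5) (n : ℕ) (w : U k σ) :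
    e k σ i * (e k σ j ^ n * w) = e k σ j ^ n * (e k σ i * w)
      + cU k σ i j * e k σ 0 * (n • (e k σ j ^ (n - 1) * w)) := by
  refine mul_pow_mul_of_commutator (fun u => ?_) (e_commutator k σ i j) n w
  rw [mul_assoc, e_zero_central, ← mul_assoc, cU_central, mul_assoc]

/-- The generator e_i moves right past the powers of e_4, …, e_{i+1} until it joins its own power.
The corrections have central coefficients, which can be pulled to the front, and what they multiply
is ∂_j of the monomial. The truncated subtraction in s - 1_j only matters when s j = 0, where the
coefficient vanishes. -/
lemma e_mul_normalMonomial (σ : ℤˣ) (i : Fin 5) (s : Fin 5 →₀ ℕ) :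
    e k σ i * normalMonomial (e k σ) s = normalMonomial (e k σ) (s + Finsupp.single i 1) +
      ∑ j, if i < j then cU k σ i j * e k σ 0 *
        (s j • normalMonomial (e k σ) (s - Finsupp.single j 1)) else 0 := by
  have hc : ∀ i j u w, u * (cU k σ i j * e k σ 0 * w) = cU k σ i j * e k σ 0 * (u * w) := by
    intro i j u w
    rw [← mul_assoc, ← mul_assoc u, ← cU_central, mul_assoc (cU k σ i j) u, ← e_zero_central,
      ← mul_assoc, mul_assoc]
  have hp : ∀ (i : Fin 5) (n : ℕ) (w : U k σ), e k σ i * (e k σ i ^ n * w) = e k σ i ^ (n + 1) * w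
      := by
    intro i n w
    rw [← mul_assoc, ← pow_succ']
  fin_cases i
  · simp only [Fin.zero_eta]
    rw [e_zero_central]
    simp [normalMonomial, cU_zero_left, mul_assoc, pow_succ]
  · simp [Fin.sum_univ_five, normalMonomial, -nsmul_eq_mul]
    rw [e_mul_pow_mul, e_mul_pow_mul, e_mul_pow_mul, hp]
    simp only [mul_add, hc, mul_smul_comm, add_assoc]
  · simp [Fin.sum_univ_five, normalMonomial, -nsmul_eq_mul]
    rw [e_mul_pow_mul, e_mul_pow_mul, hp]
    simp only [mul_add, hc, mul_smul_comm, add_assoc]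
  · simp [Fin.sum_univ_five, normalMonomial, -nsmul_eq_mul]
    rw [e_mul_pow_mul, hp]
    simp only [mul_smul_comm]
  · simp [Fin.sum_univ_five, normalMonomial, -nsmul_eq_mul]
    rw [hp]

/-- By compatibility with h it suffices to compare on monomials, where `e_mul_normalMonomial` is the
definition of `genAct` term by term. -/
lemma symU_genAct (σ : ℤˣ) (i : Fin 5) (v : Symb k) :
    symU k σ (genAct k σ i v) = e k σ i * symU k σ v := by
  refine addMonoidHom_symb_eq k σ (f := (symU k σ).comp (genAct k σ i).toAddMonoidHom)
    (g := (AddMonoidHom.mulLeft (e k σ i)).comp (symU k σ)) (fun x => ?_) (fun x => ?_)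
    (fun s c => ?_) v
  · simp only [AddMonoidHom.comp_apply, LinearMap.toAddMonoidHom_coe]
    rw [genAct_X_mul, symU_X_mul]
  · simp only [AddMonoidHom.comp_apply, AddMonoidHom.coe_mulLeft]
    rw [symU_X_mul, ← mul_assoc, hU_comm, mul_assoc]
  · simp only [AddMonoidHom.comp_apply, AddMonoidHom.coe_mulLeft, LinearMap.toAddMonoidHom_coe]
    rw [genAct_apply, map_add, map_sum, symU_C_monomial, mul_smul_comm, e_mul_normalMonomial,
      smul_add, Finset.smul_sum, sx, ← map_mul, MvPolynomial.X, MvPolynomial.monomial_mul,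
      symU_C_monomial, one_mul, add_comm s]
    congr 1
    refine Finset.sum_congr rfl fun j _ => ?_
    split_ifs with hij
    · rw [symU_comSymb_mul k σ hij, pd_C, MvPolynomial.pderiv_monomial, symU_C_monomial,
        ← Nat.cast_smul_eq_nsmul k, ← mul_smul_comm, smul_smul]
    · have : comSymb k σ i j = 0 := by
        fin_cases i <;> fin_cases j <;> first | rfl | exact absurd (by decide) hij
      rw [this, zero_mul, map_zero, smul_zero]

/-- Normal ordering intertwines the action on symbols with left multiplication. -/
lemma symU_act (σ : ℤˣ) (x : CompletedTensor k) (v : Symb k) :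
    symU k σ (act k σ v x) = proj k σ x * symU k σ v := by
  refine addMonoidHom_U_eq k σ (f := (symU k σ).comp (act k σ v))
    (g := (AddMonoidHom.mulRight (symU k σ v)).comp (proj k σ : CompletedTensor k →+ U k σ))
    (fun y => ?_) (fun y => ?_) (fun a => ?_) x
  · change symU k σ (act k σ v (hT k * y)) = hU k σ * symU k σ (act k σ v y)
    rw [act_hT_mul, symU_X_mul]
  · change proj k σ (hT k * y) * symU k σ v = hU k σ * (proj k σ y * symU k σ v)
    rw [map_mul, mul_assoc, hU]
  · change symU k σ (act k σ v (C a)) = proj k σ (C a) * symU k σ v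
    rw [act_C]
    induction a generalizing v with
    | grade0 r =>
      rw [AlgHom.commutes, Module.algebraMap_end_apply, symU_smul, Algebra.algebraMap_eq_smul_one,
        C_smul, proj_smul, map_one, map_one, smul_mul_assoc, one_mul]
    | grade1 i =>
      rw [freeAct, FreeAlgebra.lift_ι_apply, symU_genAct]
      rfl
    | mul a b ha hb => rw [map_mul, map_mul, map_mul, Module.End.mul_apply, ha, hb, mul_assoc]
    | add a b ha hb =>
      rw [map_add, map_add, map_add, add_mul, LinearMap.add_apply, map_add, ha, hb]

lemma symU_one (σ : ℤˣ) : symU k σ 1 = 1 := by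
  have := symU_C_monomial k σ 0 1
  simpa [normalMonomial] using this

lemma symU_act_one (σ : ℤˣ) (x : CompletedTensor k) : symU k σ (act k σ 1 x) = proj k σ x := by
  rw [symU_act, symU_one, mul_one]

/-! ### The Poincaré–Birkhoff–Witt bijection. -/

lemma genAct_eq_of_pd (σ : ℤˣ) (i : Fin 5) (v : Symb k) (hv : ∀ j, i < j → pd k j v = 0) :
    genAct k σ i v = sx k i * v := by
  rw [genAct_apply, Finset.sum_eq_zero, add_zero]
  intro j _
  by_cases hij : i < j
  · rw [hv j hij, mul_zero]
  · have : comSymb k σ i j = 0 := by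
      fin_cases i <;> fin_cases j <;> first | rfl | exact absurd (by decide) hij
    rw [this, zero_mul]

lemma pd_sx_pow_mul {i j : Fin 5} (hij : i ≠ j) (n : ℕ) {v : Symb k} (hv : pd k j v = 0) :
    pd k j (sx k i ^ n * v) = 0 := by
  induction n with
  | zero => simpa
  | succ n ih => rw [pow_succ', mul_assoc, pd_mul, ih, pd_sx, if_neg hij, zero_mul, mul_zero,
      add_zero]

lemma act_genT_pow_mul (σ : ℤˣ) (i : Fin 5) (n : ℕ) {v : Symb k} (hv : ∀ j, i < j → pd k j v = 0)
    (x : CompletedTensor k) (hx : act k σ 1 x = v) :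
    act k σ 1 (genT k i ^ n * x) = sx k i ^ n * v := by
  induction n with
  | zero => simpa
  | succ n ih =>
    rw [pow_succ', mul_assoc, act_mul, ih, act_genT, genAct_eq_of_pd, pow_succ', mul_assoc]
    exact fun j hj => pd_sx_pow_mul k hj.ne n (hv j hj)

/-- The monomial is built from the right, starting with e_0. When e_i acts, only variables x_j with
j ≤ i are present, so its derivative terms ∂_j with j > i contribute nothing. -/
lemma act_normalMonomial (σ : ℤˣ) (s : Fin 5 →₀ ℕ) :
    act k σ 1 (normalMonomial (genT k) s) = C (MvPolynomial.monomial s 1) := by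
  have h1 : ∀ j, pd k j (1 : Symb k) = 0 := fun j => by
    rw [← map_one (C (R := MvPolynomial (Fin 5) k)), pd_C]; simp
  have hs : (C (MvPolynomial.monomial s 1) : Symb k) =
      sx k 4 ^ s 4 * (sx k 3 ^ s 3 * (sx k 2 ^ s 2 * (sx k 1 ^ s 1 * (sx k 0 ^ s 0 * 1)))) := by
    rw [MvPolynomial.monomial_eq, Finsupp.prod_fintype _ _ (by simp), Fin.prod_univ_five]
    simp only [map_mul, map_pow, map_one, sx]
    ring
  rw [hs, normalMonomial, ← mul_one (genT k 0 ^ s 0)]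
  have lt1 : ∀ {i j l : Fin 5}, i < j → j < l → i ≠ l := fun h h' => (h.trans h').ne
  refine act_genT_pow_mul k σ 4 _ (fun j hj => ?_) _ (act_genT_pow_mul k σ 3 _ (fun j hj => ?_) _
    (act_genT_pow_mul k σ 2 _ (fun j hj => ?_) _ (act_genT_pow_mul k σ 1 _ (fun j hj => ?_) _
    (act_genT_pow_mul k σ 0 _ (fun j hj => h1 j) _ (act_one k σ 1)))))
  all_goals
    repeat' first
      | exact h1 j
      | refine pd_sx_pow_mul k (by rintro rfl; revert hj; decide) _ ?_

/-- With `symU_act_one` this makes normal ordering a bijection from symbols onto U_h(𝔞). -/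
lemma act_one_symT (σ : ℤˣ) (v : Symb k) : act k σ 1 (symT k v) = v := by
  refine powerSeries_addMonoidHom_eq (f := (act k σ 1).comp (symT k)) (g := AddMonoidHom.id _)
    (fun x => ?_) (fun x => rfl) (fun p => ?_) v
  · rw [AddMonoidHom.comp_apply, symT, mapCoeff_X_mul]
    exact act_hT_mul k σ 1 _
  · simp only [AddMonoidHom.comp_apply, AddMonoidHom.id_apply]
    induction p using MvPolynomial.induction_on' with
    | monomial s c =>
      have : (MvPolynomial.monomial s c : MvPolynomial (Fin 5) k)
          = c • MvPolynomial.monomial s 1 := by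
        rw [MvPolynomial.smul_monomial, smul_eq_mul, mul_one]
      rw [symT, mapCoeff_C, LinearMap.toAddMonoidHom_coe, normalOrder_monomial, C_smul, act_smul,
        this, C_smul, ← act_normalMonomial k σ s]
      simp only [normalMonomial, map_mul, map_pow]
      rfl
    | add p q hp hq => rw [map_add, map_add, map_add, hp, hq]

/-- Normal ordering is injective. -/
lemma symU_injective (σ : ℤˣ) {v : Symb k} (hv : symU k σ v = 0) : v = 0 := by
  rw [← act_one_symT k σ v]
  exact act_eq_zero k σ ((proj_eq_zero_iff k σ _).mp hv) 1

lemma symU_surjective (σ : ℤˣ) : Function.Surjective (symU k σ) := fun u => by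
  obtain ⟨x, rfl⟩ := proj_surjective k σ u
  exact ⟨_, symU_act_one k σ x⟩

/-- The central generator is not a zero divisor. -/
lemma eq_zero_of_e_zero_mul (σ : ℤˣ) {u : U k σ} (hu : e k σ 0 * u = 0) : u = 0 := by
  obtain ⟨v, rfl⟩ := symU_surjective k σ u
  rw [← symU_sx_zero_mul] at hu
  have h0 : sx k 0 ≠ 0 := by
    rw [sx, ne_eq, map_eq_zero_iff C PowerSeries.C_injective]
    exact MvPolynomial.X_ne_zero 0
  rw [(mul_eq_zero.mp (symU_injective k σ hu)).resolve_left h0, map_zero]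

end
/-! ### Koszul complexes of regular sequences in commutative rings -/

/-- `φ` is the quotient by the regular element `y`. -/
structure IsRegularQuotient {S S' : Type*} [CommRing S] [CommRing S'] (φ : S →+* S') (y : S) :
    Prop where
  surj : Function.Surjective φ
  map_eq_zero : φ y = 0
  exists_of_map_eq_zero : ∀ a, φ a = 0 → ∃ b, a = b * y
  eq_zero_of_mul : ∀ a, a * y = 0 → a = 0

namespace Koszul

section Statements
variable {S : Type*} [CommRing S]

/-- Exactness in degree one of the Koszul complex of two elements. -/
def Exact21 (y0 y1 : S) : Prop :=
  ∀ a0 a1, a0 * y0 + a1 * y1 = 0 → ∃ b, a0 = -b * y1 ∧ a1 = b * y0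

/-- Exactness in degree one of the Koszul complex of three elements. -/
def Exact31 (y0 y1 y2 : S) : Prop :=
  ∀ a0 a1 a2, a0 * y0 + a1 * y1 + a2 * y2 = 0 → ∃ b01 b02 b12,
    a0 = -b01 * y1 - b02 * y2 ∧ a1 = b01 * y0 - b12 * y2 ∧ a2 = b02 * y0 + b12 * y1

/-- Exactness in degree two of the Koszul complex of three elements. -/
def Exact32 (y0 y1 y2 : S) : Prop :=
  ∀ b01 b02 b12, -b01 * y1 - b02 * y2 = 0 → b01 * y0 - b12 * y2 = 0 → b02 * y0 + b12 * y1 = 0 →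
    ∃ c, b01 = c * y2 ∧ b02 = -c * y1 ∧ b12 = c * y0

/-- Exactness in degree one of the Koszul complex of four elements. -/
def Exact41 (y0 y1 y2 y3 : S) : Prop :=
  ∀ a0 a1 a2 a3, a0 * y0 + a1 * y1 + a2 * y2 + a3 * y3 = 0 → ∃ b01 b02 b03 b12 b13 b23,
    a0 = -b01 * y1 - b02 * y2 - b03 * y3 ∧ a1 = b01 * y0 - b12 * y2 - b13 * y3 ∧
    a2 = b02 * y0 + b12 * y1 - b23 * y3 ∧ a3 = b03 * y0 + b13 * y1 + b23 * y2

/-- Exactness in degree two of the Koszul complex of four elements. -/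
def Exact42 (y0 y1 y2 y3 : S) : Prop :=
  ∀ b01 b02 b03 b12 b13 b23, -b01 * y1 - b02 * y2 - b03 * y3 = 0 →
    b01 * y0 - b12 * y2 - b13 * y3 = 0 → b02 * y0 + b12 * y1 - b23 * y3 = 0 →
    b03 * y0 + b13 * y1 + b23 * y2 = 0 → ∃ c012 c013 c023 c123,
    b01 = c012 * y2 + c013 * y3 ∧ b02 = -c012 * y1 + c023 * y3 ∧ b03 = -c013 * y1 - c023 * y2 ∧
    b12 = c012 * y0 + c123 * y3 ∧ b13 = c013 * y0 - c123 * y2 ∧ b23 = c023 * y0 + c123 * y1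

/-- Exactness in degree three of the Koszul complex of four elements. -/
def Exact43 (y0 y1 y2 y3 : S) : Prop :=
  ∀ c012 c013 c023 c123, c012 * y2 + c013 * y3 = 0 → -c012 * y1 + c023 * y3 = 0 →
    -c013 * y1 - c023 * y2 = 0 → c012 * y0 + c123 * y3 = 0 → c013 * y0 - c123 * y2 = 0 →
    c023 * y0 + c123 * y1 = 0 →
    ∃ t, c012 = -t * y3 ∧ c013 = t * y2 ∧ c023 = -t * y1 ∧ c123 = t * y0

end Statements

section Descent
variable {S S' : Type*} [CommRing S] [CommRing S'] {φ : S →+* S'} {y0 y1 y2 y3 : S}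
  {z1 z2 z3 : S'}

/-- All descent lemmas here follow one pattern. Modulo y0, the coefficients without index 0 form a
cycle of the Koszul complex with one element fewer. A bounding chain is lifted, the remaining errors
are multiples of y0, and these multiples are the coefficients with index 0. The other equations hold
after multiplication by y0, which can be cancelled. -/
lemma exact21_of_quotient (h : IsRegularQuotient φ y0) (h1 : φ y1 = z1)
    (hz : ∀ a, a * z1 = 0 → a = 0) : Exact21 y0 y1 := by
  intro a0 a1 ha
  have e := congrArg φ ha
  simp only [map_add, map_mul, map_zero, h.map_eq_zero, h1, mul_zero, zero_add] at e
  obtain ⟨b, hb⟩ := h.exists_of_map_eq_zero _ (hz _ e)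
  refine ⟨b, ?_, hb⟩
  refine sub_eq_zero.mp (h.eq_zero_of_mul _ ?_)
  linear_combination ha - y1 * hb

lemma exact31_of_quotient (h : IsRegularQuotient φ y0) (h1 : φ y1 = z1) (h2 : φ y2 = z2)
    (hz : Exact21 z1 z2) : Exact31 y0 y1 y2 := by
  intro a0 a1 a2 ha
  have e := congrArg φ ha
  simp only [map_add, map_mul, map_zero, h.map_eq_zero, h1, h2, mul_zero, zero_add] at e
  obtain ⟨b', e1, e2⟩ := hz _ _ e
  obtain ⟨b12, rfl⟩ := h.surj b'
  obtain ⟨b01, f1⟩ := h.exists_of_map_eq_zero (a1 + b12 * y2) (by simp [e1, h2])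
  obtain ⟨b02, f2⟩ := h.exists_of_map_eq_zero (a2 - b12 * y1) (by simp [e2, h1])
  refine ⟨b01, b02, b12, sub_eq_zero.mp (h.eq_zero_of_mul _ ?_), ?_, ?_⟩
  · linear_combination ha - y1 * f1 - y2 * f2
  · linear_combination f1
  · linear_combination f2

lemma exact32_of_quotient (h : IsRegularQuotient φ y0) (h1 : φ y1 = z1)
    (hz : ∀ a, a * z1 = 0 → a = 0) : Exact32 y0 y1 y2 := by
  intro b01 b02 b12 g0 g1 g2
  have e := congrArg φ g2
  simp only [map_add, map_mul, map_zero, h.map_eq_zero, h1, mul_zero, zero_add] at e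
  obtain ⟨c, f⟩ := h.exists_of_map_eq_zero _ (hz _ e)
  refine ⟨c, sub_eq_zero.mp (h.eq_zero_of_mul _ ?_), sub_eq_zero.mp (h.eq_zero_of_mul _ ?_), f⟩
  · linear_combination g1 + y2 * f
  · linear_combination g2 - y1 * f

lemma exact41_of_quotient (h : IsRegularQuotient φ y0) (h1 : φ y1 = z1) (h2 : φ y2 = z2)
    (h3 : φ y3 = z3) (hz : Exact31 z1 z2 z3) : Exact41 y0 y1 y2 y3 := by
  intro a0 a1 a2 a3 ha
  have e := congrArg φ ha
  simp only [map_add, map_mul, map_zero, h.map_eq_zero, h1, h2, h3, mul_zero, zero_add] at e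
  obtain ⟨b1, b2, b3, e1, e2, e3⟩ := hz _ _ _ e
  obtain ⟨b12, rfl⟩ := h.surj b1
  obtain ⟨b13, rfl⟩ := h.surj b2
  obtain ⟨b23, rfl⟩ := h.surj b3
  obtain ⟨b01, f1⟩ := h.exists_of_map_eq_zero (a1 + b12 * y2 + b13 * y3) (by
    rw [map_add, map_add, map_mul, map_mul, e1, h2, h3]; ring)
  obtain ⟨b02, f2⟩ := h.exists_of_map_eq_zero (a2 - b12 * y1 + b23 * y3) (by
    simp [e2, h1, h3])
  obtain ⟨b03, f3⟩ := h.exists_of_map_eq_zero (a3 - b13 * y1 - b23 * y2) (by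
    simp [e3, h1, h2])
  refine ⟨b01, b02, b03, b12, b13, b23, sub_eq_zero.mp (h.eq_zero_of_mul _ ?_), ?_, ?_, ?_⟩
  · linear_combination ha - y1 * f1 - y2 * f2 - y3 * f3
  · linear_combination f1
  · linear_combination f2
  · linear_combination f3

lemma exact42_of_quotient (h : IsRegularQuotient φ y0) (h1 : φ y1 = z1) (h2 : φ y2 = z2)
    (h3 : φ y3 = z3) (hz : Exact32 z1 z2 z3) : Exact42 y0 y1 y2 y3 := by
  intro b01 b02 b03 b12 b13 b23 g0 g1 g2 g3
  have e1 := congrArg φ g1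
  have e2 := congrArg φ g2
  have e3 := congrArg φ g3
  simp only [map_add, map_sub, map_mul, map_zero, h.map_eq_zero, h1, h2, h3, mul_zero, zero_add,
    zero_sub] at e1 e2 e3
  obtain ⟨c, k1, k2, k3⟩ := hz _ _ _ (by linear_combination e1) e2 e3
  obtain ⟨c123, rfl⟩ := h.surj c
  obtain ⟨c012, f1⟩ := h.exists_of_map_eq_zero (b12 - c123 * y3) (by simp [k1, h3])
  obtain ⟨c013, f2⟩ := h.exists_of_map_eq_zero (b13 + c123 * y2) (by simp [k2, h2])
  obtain ⟨c023, f3⟩ := h.exists_of_map_eq_zero (b23 - c123 * y1) (by simp [k3, h1])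
  refine ⟨c012, c013, c023, c123, sub_eq_zero.mp (h.eq_zero_of_mul _ ?_),
    sub_eq_zero.mp (h.eq_zero_of_mul _ ?_), sub_eq_zero.mp (h.eq_zero_of_mul _ ?_), ?_, ?_, ?_⟩
  · linear_combination g1 + y2 * f1 + y3 * f2
  · linear_combination g2 - y1 * f1 + y3 * f3
  · linear_combination g3 - y1 * f2 - y2 * f3
  · linear_combination f1
  · linear_combination f2
  · linear_combination f3

lemma exact43_of_quotient (h : IsRegularQuotient φ y0) (h1 : φ y1 = z1)
    (hz : ∀ a, a * z1 = 0 → a = 0) : Exact43 y0 y1 y2 y3 := by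
  intro c012 c013 c023 c123 _ _ _ g3 g4 g5
  have e := congrArg φ g5
  simp only [map_add, map_mul, map_zero, h.map_eq_zero, h1, mul_zero, zero_add] at e
  obtain ⟨t, f⟩ := h.exists_of_map_eq_zero _ (hz _ e)
  refine ⟨t, sub_eq_zero.mp (h.eq_zero_of_mul _ ?_), sub_eq_zero.mp (h.eq_zero_of_mul _ ?_),
    sub_eq_zero.mp (h.eq_zero_of_mul _ ?_), f⟩
  · linear_combination g3 - y3 * f
  · linear_combination g4 + y2 * f
  · linear_combination g5 - y1 * f

end Descent

end Koszul

/-! ### Power series over polynomial rings -/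

lemma IsRegularQuotient.powerSeries_map {A B : Type*} [CommRing A] [CommRing B] {f : A →+* B}
    {y : A} (h : IsRegularQuotient f y) :
    IsRegularQuotient (PowerSeries.map f) (C y : PowerSeries A) where
  surj b := by
    choose g hg using h.surj
    exact ⟨PowerSeries.mk fun n => g (coeff n b), by ext n; simp [hg]⟩
  map_eq_zero := by simp [h.map_eq_zero]
  exists_of_map_eq_zero a ha := by
    have h1 : ∀ n, ∃ b, coeff n a = b * y := fun n =>
      h.exists_of_map_eq_zero _ (by rw [← PowerSeries.coeff_map, ha, map_zero])
    choose g hg using h1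
    exact ⟨PowerSeries.mk g, by ext n; simp [hg]⟩
  eq_zero_of_mul a ha := by
    ext n
    have := congrArg (coeff n) ha
    rw [PowerSeries.coeff_mul_C, map_zero] at this
    rw [h.eq_zero_of_mul _ this, map_zero]

noncomputable section

variable (k : Type u) [Field k]

/-- Setting the first variable equal to zero. -/
def dropVar (m : ℕ) : MvPolynomial (Fin (m + 1)) k →ₐ[k] MvPolynomial (Fin m) k :=
  MvPolynomial.aeval (Fin.cons 0 MvPolynomial.X)

lemma dropVar_X_zero (m : ℕ) : dropVar k m (MvPolynomial.X 0) = 0 := by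
  simp [dropVar]

lemma dropVar_X_succ (m : ℕ) (i : Fin m) :
    dropVar k m (MvPolynomial.X i.succ) = MvPolynomial.X i := by
  simp [dropVar]

lemma dropVar_rename (m : ℕ) (p : MvPolynomial (Fin m) k) :
    dropVar k m (MvPolynomial.rename Fin.succ p) = p := by
  rw [dropVar, MvPolynomial.aeval_rename]
  exact MvPolynomial.aeval_X_left_apply p

lemma X_zero_dvd_sub_rename (m : ℕ) (p : MvPolynomial (Fin (m + 1)) k) :
    MvPolynomial.X 0 ∣ p - MvPolynomial.rename Fin.succ (dropVar k m p) := by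
  induction p using MvPolynomial.induction_on with
  | C a => simp [dropVar]
  | add p q hp hq =>
    rw [map_add, map_add, add_sub_add_comm]
    exact dvd_add hp hq
  | mul_X p i hp =>
    rw [map_mul]
    refine Fin.cases ?_ (fun j => ?_) i
    · rw [dropVar_X_zero, mul_zero, map_zero, sub_zero]
      exact dvd_mul_left _ _
    · rw [dropVar_X_succ, map_mul, MvPolynomial.rename_X, ← sub_mul]
      exact hp.mul_right _

lemma dropVar_isRegularQuotient (m : ℕ) :
    IsRegularQuotient (dropVar k m : MvPolynomial (Fin (m + 1)) k →+* MvPolynomial (Fin m) k)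
      (MvPolynomial.X 0) where
  surj p := ⟨_, dropVar_rename k m p⟩
  map_eq_zero := dropVar_X_zero k m
  exists_of_map_eq_zero a ha := by
    have h := X_zero_dvd_sub_rename k m a
    rw [show dropVar k m a = 0 from ha, map_zero, sub_zero] at h
    obtain ⟨b, rfl⟩ := h
    exact ⟨b, mul_comm _ _⟩
  eq_zero_of_mul a ha := (mul_eq_zero.mp ha).resolve_right (MvPolynomial.X_ne_zero 0)

/-- Power series in `h` over a polynomial ring in `m` variables. -/
abbrev PolyH (m : ℕ) : Type u := PowerSeries (MvPolynomial (Fin m) k)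

/-- The variables of `PolyH`. -/
def py {m : ℕ} (i : Fin m) : PolyH k m := C (MvPolynomial.X i)

/-- Setting the first variable equal to zero. -/
def dropH (m : ℕ) : PolyH k (m + 1) →+* PolyH k m :=
  PowerSeries.map (dropVar k m : MvPolynomial (Fin (m + 1)) k →+* MvPolynomial (Fin m) k)

lemma dropH_isRegularQuotient (m : ℕ) : IsRegularQuotient (dropH k m) (py k 0) :=
  (dropVar_isRegularQuotient k m).powerSeries_map

lemma dropH_py_succ (m : ℕ) (i : Fin m) : dropH k m (py k i.succ) = py k i := by
  rw [dropH, py, PowerSeries.map_C]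
  exact congrArg C (dropVar_X_succ k m i)

/-- The variables form a regular sequence: they are set to zero one at a time, down to regularity of
a single variable. -/
lemma polyH_exact41 : Koszul.Exact41 (py k 0) (py k 1) (py k 2) (py k (3 : Fin 4)) :=
  Koszul.exact41_of_quotient (dropH_isRegularQuotient k 3) (dropH_py_succ k 3 0)
    (dropH_py_succ k 3 1) (dropH_py_succ k 3 2) <|
  Koszul.exact31_of_quotient (dropH_isRegularQuotient k 2) (dropH_py_succ k 2 0)
    (dropH_py_succ k 2 1) <|
  Koszul.exact21_of_quotient (dropH_isRegularQuotient k 1) (dropH_py_succ k 1 0)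
    (dropH_isRegularQuotient k 0).eq_zero_of_mul

lemma polyH_exact42 : Koszul.Exact42 (py k 0) (py k 1) (py k 2) (py k (3 : Fin 4)) :=
  Koszul.exact42_of_quotient (dropH_isRegularQuotient k 3) (dropH_py_succ k 3 0)
    (dropH_py_succ k 3 1) (dropH_py_succ k 3 2) <|
  Koszul.exact32_of_quotient (dropH_isRegularQuotient k 2) (dropH_py_succ k 2 0)
    (dropH_isRegularQuotient k 1).eq_zero_of_mul

lemma polyH_exact43 : Koszul.Exact43 (py k 0) (py k 1) (py k 2) (py k (3 : Fin 4)) :=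
  Koszul.exact43_of_quotient (dropH_isRegularQuotient k 3) (dropH_py_succ k 3 0)
    (dropH_isRegularQuotient k 2).eq_zero_of_mul

/-- Setting all variables equal to zero. -/
def constH (m : ℕ) : PolyH k m →+* PowerSeries k := PowerSeries.map MvPolynomial.constantCoeff

lemma constH_dropH (m : ℕ) (s : PolyH k (m + 1)) :
    constH k m (dropH k m s) = constH k (m + 1) s := by
  rw [constH, constH, dropH, ← RingHom.comp_apply, ← PowerSeries.map_comp]
  congr 2
  refine MvPolynomial.ringHom_ext (fun c => by simp) fun i => ?_
  refine Fin.cases ?_ (fun j => ?_) i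
  · simp [dropVar_X_zero]
  · simp [dropVar_X_succ]

/-- Induction on the number of variables: the image under `dropH` is a combination of the later
variables, and after lifting it differs from s by a multiple of the first one. -/
lemma exists_of_constH_eq_zero (m : ℕ) (s : PolyH k m) (hs : constH k m s = 0) :
    ∃ a : Fin m → PolyH k m, s = ∑ i, a i * py k i := by
  induction m with
  | zero =>
    refine ⟨0, ?_⟩
    have : ∀ p : MvPolynomial (Fin 0) k, MvPolynomial.constantCoeff p = 0 → p = 0 := by
      intro p hp
      rw [MvPolynomial.eq_C_of_isEmpty p]
      rw [MvPolynomial.constantCoeff_eq] at hp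
      rw [hp, map_zero]
    rw [Finset.univ_eq_empty, Finset.sum_empty]
    ext1 n
    refine this _ ?_
    rw [← PowerSeries.coeff_map]
    exact congrArg (coeff n) hs
  | succ m ih =>
    obtain ⟨a, ha⟩ := ih (dropH k m s) (by rw [constH_dropH, hs])
    have h := dropH_isRegularQuotient k m
    choose g hg using h.surj
    obtain ⟨b, hb⟩ := h.exists_of_map_eq_zero (s - ∑ i : Fin m, g (a i) * py k i.succ) (by
      rw [map_sub, ha, map_sum, sub_eq_zero]
      exact Finset.sum_congr rfl fun i _ => by rw [map_mul, hg, dropH_py_succ])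
    refine ⟨Fin.cons b fun i => g (a i), ?_⟩
    rw [Fin.sum_univ_succ]
    simp only [Fin.cons_zero, Fin.cons_succ]
    rw [← hb, sub_add_cancel]

/-! ### The quotient by the central generator -/

/-- The map from the completed tensor algebra to the commutative quotient of `U_h(𝔞)` by `e_1`. -/
def toPolyT : CompletedTensor k →+* PolyH k 4 :=
  PowerSeries.map (FreeAlgebra.lift k (Fin.cons 0 MvPolynomial.X : Fin 5 → MvPolynomial (Fin 4) k) :
    FreeAlgebra k (Fin 5) →ₐ[k] MvPolynomial (Fin 4) k).toRingHom

lemma toPolyT_hT : toPolyT k (hT k) = X := PowerSeries.map_X _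

lemma toPolyT_genT_zero : toPolyT k (genT k 0) = 0 := by
  rw [toPolyT, genT, PowerSeries.map_C]; simp

lemma toPolyT_genT_succ (i : Fin 4) : toPolyT k (genT k i.succ) = py k i := by
  rw [toPolyT, genT, PowerSeries.map_C]; simp [py]

lemma toPolyT_relator (σ : ℤˣ) (i j : Fin 5) : toPolyT k (relator k σ i j) = 0 := by
  have h : ∀ c : k, ∀ x, toPolyT k x = 0 → toPolyT k (c • x) = 0 := by
    intro c x hx
    ext1 n
    have := congrArg (coeff n) hx
    rw [toPolyT, PowerSeries.coeff_map, map_zero] at this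
    rw [toPolyT, PowerSeries.coeff_map, PowerSeries.coeff_smul, map_zero]
    simp only [AlgHom.toRingHom_eq_coe, RingHom.coe_coe, map_smul] at this ⊢
    rw [this, smul_zero]
  have hs : toPolyT k (∑ a, structConst k i j a • genT k a) = 0 := by
    rw [map_sum, Finset.sum_eq_zero]
    intro a _
    by_cases ha : a = 0
    · subst ha; exact h _ _ (toPolyT_genT_zero k)
    · simp [structConst, ha]
  rw [relator, monT, map_sub, map_sub, map_sub, hs, map_mul, map_mul, map_mul, toPolyT_genT_zero,
    mul_comm, sub_self, mul_zero, sub_zero, sub_zero]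

lemma toPolyT_eq_zero (σ : ℤˣ) {x : CompletedTensor k} (hx : x ∈ relIdeal k σ) :
    toPolyT k x = 0 := by
  have key : ∀ n : ℕ, (X : PolyH k 4) ^ n ∣ toPolyT k x := by
    intro n
    have h2 : TwoSidedIdeal.span
        (Set.range (fun p : Fin 5 × Fin 5 => relator k σ p.1 p.2) ∪ {hT k ^ n}) ≤
        TwoSidedIdeal.ker ((Ideal.Quotient.mk (Ideal.span {(X : PolyH k 4) ^ n})).comp
          (toPolyT k)) := by
      rw [TwoSidedIdeal.span_le]
      rintro y (⟨p, rfl⟩ | rfl) <;> rw [SetLike.mem_coe, TwoSidedIdeal.mem_ker]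
      · rw [RingHom.comp_apply, toPolyT_relator, map_zero]
      · rw [RingHom.comp_apply, map_pow, toPolyT_hT, Ideal.Quotient.eq_zero_iff_mem]
        exact Ideal.mem_span_singleton_self _
    have h3 := (TwoSidedIdeal.mem_ker _).mp (h2 ((mem_relIdeal k σ x).mp hx n))
    rwa [RingHom.comp_apply, Ideal.Quotient.eq_zero_iff_mem, Ideal.mem_span_singleton] at h3
  ext1 n
  exact PowerSeries.X_pow_dvd_iff.mp (key (n + 1)) n (Nat.lt_succ_self n)

/-- The quotient map of `U_h(𝔞)` by `e_1`. -/
def toPoly (σ : ℤˣ) : U k σ →+* PolyH k 4 :=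
  (relIdeal k σ).ringCon.lift (toPolyT k) (by
    intro x y hxy
    have h := toPolyT_eq_zero k σ ((TwoSidedIdeal.rel_iff _ _ _).mp hxy)
    rwa [map_sub, sub_eq_zero] at h)

lemma toPoly_e_zero (σ : ℤˣ) : toPoly k σ (e k σ 0) = 0 := toPolyT_genT_zero k

lemma toPoly_e_succ (σ : ℤˣ) (i : Fin 4) : toPoly k σ (e k σ i.succ) = py k i :=
  toPolyT_genT_succ k i

/-- The target is commutative, so ordering is immaterial and only x_0 = 0 remains. This transfers
the kernel and the surjectivity of `dropH` to `toPoly`. -/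
lemma toPoly_symU (σ : ℤˣ) (v : Symb k) : toPoly k σ (symU k σ v) = dropH k 4 v := by
  change toPolyT k (symT k v) = _
  ext1 n
  rw [toPolyT, PowerSeries.coeff_map, dropH, PowerSeries.coeff_map, symT, coeff_mapCoeff]
  induction coeff n v using MvPolynomial.induction_on' with
  | add p q hp hq => rw [map_add, map_add, map_add, hp, hq]
  | monomial s c =>
    rw [LinearMap.toAddMonoidHom_coe, normalOrder_monomial, MvPolynomial.monomial_eq,
      Finsupp.prod_fintype _ _ (by simp), Fin.prod_univ_five]
    simp only [normalMonomial, AlgHom.toRingHom_eq_coe, RingHom.coe_coe, map_mul,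
      map_pow, AlgHom.commutes, FreeAlgebra.lift_ι_apply, dropVar, MvPolynomial.aeval_X,
          MvPolynomial.aeval_C,
      Algebra.smul_def]
    ring

lemma exists_of_toPoly_eq_zero (σ : ℤˣ) (u : U k σ) (hu : toPoly k σ u = 0) :
    ∃ w, u = w * e k σ 0 := by
  obtain ⟨v, rfl⟩ := symU_surjective k σ u
  rw [toPoly_symU] at hu
  obtain ⟨w, rfl⟩ := (dropH_isRegularQuotient k 4).exists_of_map_eq_zero v hu
  exact ⟨symU k σ w, by rw [mul_comm, ← e_zero_central, ← symU_sx_zero_mul]; rfl⟩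

lemma toPoly_surjective (σ : ℤˣ) : Function.Surjective (toPoly k σ) := fun s => by
  obtain ⟨v, rfl⟩ := (dropH_isRegularQuotient k 4).surj s
  exact ⟨_, toPoly_symU k σ v⟩

lemma counit_eq (σ : ℤˣ) (u : U k σ) : counit k σ u = constH k 4 (toPoly k σ u) := by
  obtain ⟨x, rfl⟩ := proj_surjective k σ u
  change PowerSeries.map _ x = PowerSeries.map _ (PowerSeries.map _ x)
  rw [← RingHom.comp_apply, ← PowerSeries.map_comp]
  congr 2
  have : (FreeAlgebra.lift k fun _ : Fin 5 => (0 : k)) =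
      (MvPolynomial.aeval (fun _ : Fin 4 => (0 : k))).comp
        (FreeAlgebra.lift k (Fin.cons 0 MvPolynomial.X)) := by
    refine FreeAlgebra.hom_ext (funext fun i => ?_)
    refine Fin.cases ?_ (fun j => ?_) i <;> simp
  rw [this]
  ext a
  simp [MvPolynomial.constantCoeff_eq]

/-- An element killed by the counit is a combination of generators with coefficients on the
left. -/
lemma exists_left_of_counit_eq_zero (σ : ℤˣ) (u : U k σ) (hu : counit k σ u = 0) :
    ∃ a : Fin 5 → U k σ, u = ∑ i, a i * e k σ i := by
  rw [counit_eq] at hu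
  obtain ⟨a, ha⟩ := exists_of_constH_eq_zero k 4 _ hu
  choose g hg using toPoly_surjective k σ
  obtain ⟨b, hb⟩ := exists_of_toPoly_eq_zero k σ (u - ∑ i, g (a i) * e k σ i.succ) (by
    rw [map_sub, ha, map_sum, sub_eq_zero]
    exact Finset.sum_congr rfl fun i _ => by rw [map_mul, hg, toPoly_e_succ])
  refine ⟨Fin.cons b fun i => g (a i), ?_⟩
  rw [Fin.sum_univ_succ]
  simp only [Fin.cons_zero, Fin.cons_succ]
  rw [← hb, sub_add_cancel]

/-- An element killed by the counit is a combination of generators with coefficients on the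
right. -/
lemma exists_right_of_counit_eq_zero (σ : ℤˣ) (u : U k σ) (hu : counit k σ u = 0) :
    ∃ a : Fin 5 → U k σ, u = ∑ i, e k σ i * a i := by
  rw [counit_eq] at hu
  obtain ⟨a, ha⟩ := exists_of_constH_eq_zero k 4 _ hu
  choose g hg using toPoly_surjective k σ
  obtain ⟨b, hb⟩ := exists_of_toPoly_eq_zero k σ (u - ∑ i : Fin 4, e k σ i.succ * g (a i)) (by
    rw [map_sub, ha, map_sum, sub_eq_zero]
    exact Finset.sum_congr rfl fun i _ => by rw [map_mul, hg, toPoly_e_succ, mul_comm])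
  refine ⟨Fin.cons b fun i => g (a i), ?_⟩
  rw [Fin.sum_univ_succ]
  simp only [Fin.cons_zero, Fin.cons_succ]
  rw [e_zero_central, ← hb, sub_add_cancel]

/-! ### Coordinates on the Koszul modules -/

lemma one_tmul_wedge (σ : ℤˣ) {n : ℕ} (p : Fin n → Fin 5) (hp : StrictMono p) :
    (1 : U k σ) ⊗ₜ[k] wedge k p = kosBasis k σ n
      (Set.powersetCard.ofFinEmbEquiv (OrderEmbedding.ofStrictMono p hp)) := by
  rw [kosBasis, Module.Basis.baseChange_apply, exteriorPower.basis_apply,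
    exteriorPower.ιMulti_family, Equiv.symm_apply_apply]
  rfl

lemma kosBasis_eq (σ : ℤˣ) {n : ℕ} (s : Set.powersetCard (Fin 5) n) :
    kosBasis k σ n s = (1 : U k σ) ⊗ₜ[k] wedge k (Set.powersetCard.ofFinEmbEquiv.symm s) := by
  rw [one_tmul_wedge k σ _ (Set.powersetCard.ofFinEmbEquiv.symm s).strictMono]
  congr 1
  rw [eq_comm, ← Equiv.eq_symm_apply]
  rfl

lemma kos_hom_ext (σ : ℤˣ) {n : ℕ} {N : Type*} [AddCommGroup N] [Module (U k σ) N]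
    {f g : Kos k σ n →ₗ[U k σ] N}
    (h : ∀ p : Fin n → Fin 5, StrictMono p → f (1 ⊗ₜ wedge k p) = g (1 ⊗ₜ wedge k p)) : f = g := by
  refine (kosBasis k σ n).ext fun s => ?_
  rw [kosBasis_eq]
  exact h _ (Set.powersetCard.ofFinEmbEquiv.symm s).strictMono

/-- The coordinate along `e_{q 0} ∧ ⋯ ∧ e_{q (n-1)}`. -/
def coord (σ : ℤˣ) {n : ℕ} (q : Fin n → Fin 5) : Kos k σ n →ₗ[U k σ] U k σ :=
  kosLift k σ fun p => if p = q then 1 else 0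

lemma kos_ext (σ : ℤˣ) {n : ℕ} {x y : Kos k σ n}
    (h : ∀ q : Fin n → Fin 5, StrictMono q → coord k σ q x = coord k σ q y) : x = y := by
  refine (kosBasis k σ n).ext_elem fun s => ?_
  have hs : ∀ z, (kosBasis k σ n).repr z s =
      coord k σ (Set.powersetCard.ofFinEmbEquiv.symm s) z := by
    intro z
    have : (kosBasis k σ n).coord s = coord k σ (Set.powersetCard.ofFinEmbEquiv.symm s) := by
      refine (kosBasis k σ n).ext fun t => ?_
      rw [coord, kosLift, Module.Basis.constr_basis, Module.Basis.coord_apply,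
        Module.Basis.repr_self, Finsupp.single_apply]
      simp only [DFunLike.coe_fn_eq, EmbeddingLike.apply_eq_iff_eq]
    rw [← this]
    rfl
  rw [hs, hs]
  exact h _ (Set.powersetCard.ofFinEmbEquiv.symm s).strictMono

/-- The element with prescribed coordinates. -/
def kosMk (σ : ℤˣ) {n : ℕ} (c : (Fin n → Fin 5) → U k σ) : Kos k σ n :=
  ∑ s, c (Set.powersetCard.ofFinEmbEquiv.symm s) • kosBasis k σ n s

lemma coord_kosMk (σ : ℤˣ) {n : ℕ} (c : (Fin n → Fin 5) → U k σ) (q : Fin n → Fin 5)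
    (hq : StrictMono q) : coord k σ q (kosMk k σ c) = c q := by
  rw [kosMk, map_sum, Finset.sum_eq_single
    (Set.powersetCard.ofFinEmbEquiv (OrderEmbedding.ofStrictMono q hq))]
  · rw [map_smul, coord, kosLift, Module.Basis.constr_basis, Equiv.symm_apply_apply]
    simp
  · intro s _ hs
    rw [map_smul, coord, kosLift, Module.Basis.constr_basis, if_neg, smul_zero]
    intro h
    apply hs
    rw [← Equiv.symm_apply_eq]
    exact DFunLike.coe_injective h
  · simp

lemma wedge_eq_zero {n : ℕ} (p : Fin n → Fin 5) (hp : ¬ Function.Injective p) :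
    wedge k p = 0 := by
  rw [wedge]
  exact AlternatingMap.map_eq_zero_of_not_injective _ _ fun h =>
    hp (Function.Injective.of_comp (f := fun i => Pi.basisFun k (Fin 5) i) h)

/-- Bracket terms produce wedges e_0 ∧ e_{p_0} ∧ ⋯, which are increasing or repeat e_0. The
hypothesis on `r` covers exactly these two kinds and avoids signs of permutations. -/
lemma coord_tmul_wedge (σ : ℤˣ) {n : ℕ} (q : Fin n → Fin 5) (hq : StrictMono q) (w : U k σ)
    (r : Fin n → Fin 5) (hr : StrictMono r ∨ ¬ Function.Injective r) :
    coord k σ q (w ⊗ₜ wedge k r) = if r = q then w else 0 := by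
  rcases hr with hr | hr
  · have : w ⊗ₜ[k] wedge k r = w • ((1 : U k σ) ⊗ₜ[k] wedge k r) := by
      rw [TensorProduct.smul_tmul', smul_eq_mul, mul_one]
    rw [this, map_smul, coord, kosLift_apply k σ _ r hr]
    simp
  · rw [wedge_eq_zero k r hr, TensorProduct.tmul_zero, map_zero, if_neg]
    rintro rfl
    exact hr hq.injective

/-! ### The differentials on basis vectors -/

lemma sum_structConst (σ : ℤˣ) {n : ℕ} (i j : Fin 5) (r : Fin n → Fin 5) :
    ∑ a, structConst k i j a • ((1 : U k σ) ⊗ₜ[k] wedge k (Fin.cons a r : Fin (n + 1) → Fin 5)) =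
      algebraMap k (U k σ) (structConst k i j 0) ⊗ₜ wedge k (Fin.cons 0 r) := by
  rw [Finset.sum_eq_single 0, TensorProduct.smul_tmul', Algebra.algebraMap_eq_smul_one]
  · intro b _ hb
    simp [structConst, hb]
  · simp

lemma d1_wedge (σ : ℤˣ) (p : Fin 1 → Fin 5) (hp : StrictMono p) :
    d1 k σ (1 ⊗ₜ wedge k p) = e k σ (p 0) := kosLift_apply k σ _ p hp

/-- The deformation term P/e_0 multiplies the same wedge as the Lie bracket term, and the two merge
into `cU`. -/
lemma d2_wedge (σ : ℤˣ) (p : Fin 2 → Fin 5) (hp : StrictMono p) :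
    d2 k σ (1 ⊗ₜ wedge k p) = e k σ (p 0) ⊗ₜ wedge k ![p 1]
      - e k σ (p 1) ⊗ₜ wedge k ![p 0]
      - cU k σ (p 0) (p 1) ⊗ₜ wedge k ![0] := by
  have h0 : p ∘ Fin.succ = ![p 1] := by
    ext i; fin_cases i; rfl
  have h1 : p ∘ Fin.succAbove 1 = ![p 0] := by
    ext i; fin_cases i; rfl
  have g10 : (Fin.cons 0 (p ∘ Fin.succAbove 1 ∘ Fin.succ) : Fin 1 → Fin 5) = ![0] := by
    ext i; fin_cases i; rfl
  rw [d2, kosLift_apply k σ _ p hp, koszul]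
  simp only [sum_structConst]
  simp [Fin.sum_univ_succ, cU, TensorProduct.add_tmul, h0, h1, g10]
  abel

lemma d3_wedge (σ : ℤˣ) (p : Fin 3 → Fin 5) (hp : StrictMono p) :
    d3 k σ (1 ⊗ₜ wedge k p) = e k σ (p 0) ⊗ₜ wedge k ![p 1, p 2]
      - e k σ (p 1) ⊗ₜ wedge k ![p 0, p 2]
      + e k σ (p 2) ⊗ₜ wedge k ![p 0, p 1]
      - cU k σ (p 0) (p 1) ⊗ₜ wedge k ![0, p 2]
      + cU k σ (p 0) (p 2) ⊗ₜ wedge k ![0, p 1]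
      - cU k σ (p 1) (p 2) ⊗ₜ wedge k ![0, p 0] := by
  have h0 : p ∘ Fin.succ = ![p 1, p 2] := by
    ext i; fin_cases i <;> rfl
  have h1 : p ∘ Fin.succAbove 1 = ![p 0, p 2] := by
    ext i; fin_cases i <;> rfl
  have h2 : p ∘ Fin.succAbove 2 = ![p 0, p 1] := by
    ext i; fin_cases i <;> rfl
  have g10 : (Fin.cons 0 (p ∘ Fin.succAbove 1 ∘ Fin.succ) : Fin 2 → Fin 5) = ![0, p 2] := by
    ext i; fin_cases i <;> rfl
  have g20 : (Fin.cons 0 (p ∘ Fin.succAbove 2 ∘ Fin.succ) : Fin 2 → Fin 5) = ![0, p 1] := by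
    ext i; fin_cases i <;> rfl
  have g21 : (Fin.cons 0 (p ∘ Fin.succAbove 2 ∘ Fin.succAbove 1) : Fin 2 → Fin 5) = ![0, p 0] := by
    ext i; fin_cases i <;> rfl
  rw [d3, kosLift_apply k σ _ p hp, koszul]
  simp only [sum_structConst]
  simp [Fin.sum_univ_succ, cU, TensorProduct.add_tmul, h0, h1, h2, g10, g20, g21]
  abel

lemma koszul_four (σ : ℤˣ) (p : Fin 4 → Fin 5) :
    koszul k σ 2 p = e k σ (p 0) ⊗ₜ wedge k ![p 1, p 2, p 3]
      - e k σ (p 1) ⊗ₜ wedge k ![p 0, p 2, p 3]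
      + e k σ (p 2) ⊗ₜ wedge k ![p 0, p 1, p 3]
      - e k σ (p 3) ⊗ₜ wedge k ![p 0, p 1, p 2]
      - algebraMap k (U k σ) (structConst k (p 0) (p 1) 0) ⊗ₜ wedge k ![0, p 2, p 3]
      + algebraMap k (U k σ) (structConst k (p 0) (p 2) 0) ⊗ₜ wedge k ![0, p 1, p 3]
      - algebraMap k (U k σ) (structConst k (p 0) (p 3) 0) ⊗ₜ wedge k ![0, p 1, p 2]
      - algebraMap k (U k σ) (structConst k (p 1) (p 2) 0) ⊗ₜ wedge k ![0, p 0, p 3]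
      + algebraMap k (U k σ) (structConst k (p 1) (p 3) 0) ⊗ₜ wedge k ![0, p 0, p 2]
      - algebraMap k (U k σ) (structConst k (p 2) (p 3) 0) ⊗ₜ wedge k ![0, p 0, p 1] := by
  have h0 : p ∘ Fin.succ = ![p 1, p 2, p 3] := by
    ext i; fin_cases i <;> rfl
  have h1 : p ∘ Fin.succAbove 1 = ![p 0, p 2, p 3] := by
    ext i; fin_cases i <;> rfl
  have h2 : p ∘ Fin.succAbove 2 = ![p 0, p 1, p 3] := by
    ext i; fin_cases i <;> rfl
  have h3 : p ∘ Fin.succAbove 3 = ![p 0, p 1, p 2] := by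
    ext i; fin_cases i <;> rfl
  have g10 : (Fin.cons 0 (p ∘ Fin.succAbove 1 ∘ Fin.succ) : Fin 3 → Fin 5) = ![0, p 2, p 3] := by
    ext i; fin_cases i <;> rfl
  have g20 : (Fin.cons 0 (p ∘ Fin.succAbove 2 ∘ Fin.succ) : Fin 3 → Fin 5) = ![0, p 1, p 3] := by
    ext i; fin_cases i <;> rfl
  have g21 : (Fin.cons 0 (p ∘ Fin.succAbove 2 ∘ Fin.succAbove 1) : Fin 3 → Fin 5) = ![0, p 0, p 3]
      := by
    ext i; fin_cases i <;> rfl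
  have g30 : (Fin.cons 0 (p ∘ Fin.succAbove 3 ∘ Fin.succ) : Fin 3 → Fin 5) = ![0, p 1, p 2] := by
    ext i; fin_cases i <;> rfl
  have g31 : (Fin.cons 0 (p ∘ Fin.succAbove 3 ∘ Fin.succAbove 1) : Fin 3 → Fin 5) = ![0, p 0, p 2]
      := by
    ext i; fin_cases i <;> rfl
  have g32 : (Fin.cons 0 (p ∘ Fin.succAbove 3 ∘ Fin.succAbove 2) : Fin 3 → Fin 5) = ![0, p 0, p 1]
      := by
    ext i; fin_cases i <;> rfl
  rw [koszul]
  simp only [sum_structConst]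
  simp [Fin.sum_univ_succ, h0, h1, h2, h3, g10, g20, g21, g30, g31, g32]
  abel

/-- Both cases in the definition obey one formula. If p 0 = 0, every bracket term has c_{0j} = 0 or
repeats e_0. -/
lemma d4_wedge (σ : ℤˣ) (p : Fin 4 → Fin 5) (hp : StrictMono p) :
    d4 k σ (1 ⊗ₜ wedge k p) = e k σ (p 0) ⊗ₜ wedge k ![p 1, p 2, p 3]
      - e k σ (p 1) ⊗ₜ wedge k ![p 0, p 2, p 3]
      + e k σ (p 2) ⊗ₜ wedge k ![p 0, p 1, p 3]
      - e k σ (p 3) ⊗ₜ wedge k ![p 0, p 1, p 2]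
      - cU k σ (p 0) (p 1) ⊗ₜ wedge k ![0, p 2, p 3]
      + cU k σ (p 0) (p 2) ⊗ₜ wedge k ![0, p 1, p 3]
      - cU k σ (p 0) (p 3) ⊗ₜ wedge k ![0, p 1, p 2]
      - cU k σ (p 1) (p 2) ⊗ₜ wedge k ![0, p 0, p 3]
      + cU k σ (p 1) (p 3) ⊗ₜ wedge k ![0, p 0, p 2]
      - cU k σ (p 2) (p 3) ⊗ₜ wedge k ![0, p 0, p 1] := by
  rw [d4, kosLift_apply k σ _ p hp, koszul_four]
  have h01 := hp (show (0 : Fin 4) < 1 by decide)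
  have h12 := hp (show (1 : Fin 4) < 2 by decide)
  have h23 := hp (show (2 : Fin 4) < 3 by decide)
  split_ifs with h
  · have hw : ∀ a, wedge k (![0, 0, a] : Fin 3 → Fin 5) = 0 := fun a =>
      wedge_eq_zero k _ fun hi => absurd (@hi 0 1 rfl) (by decide)
    have hs : ∀ j, structConst k 0 j 0 = 0 := fun j => by simp [structConst]
    simp [h, cU_zero_left, hw, hs]
  -- The only increasing quadruple avoiding 0 is (1, 2, 3, 4); the terms missing from the definition
  -- are those with P_{12} = P_{13} = 0 in this numbering.
  · have e0 : p 0 = 1 := by omega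
    have e1 : p 1 = 2 := by omega
    have e2 : p 2 = 3 := by omega
    have e3 : p 3 = 4 := by omega
    have q12 : Q k σ 1 2 = 0 := by simp [Q_eq, halfQuotT]
    have q13 : Q k σ 1 3 = 0 := by simp [Q_eq, halfQuotT]
    simp only [e0, e1, e2, e3, cU, q12, q13, TensorProduct.add_tmul, TensorProduct.zero_tmul]
    abel

lemma d5_wedge (σ : ℤˣ) :
    d5 k σ (1 ⊗ₜ wedge k ![0, 1, 2, 3, 4]) = e k σ 0 ⊗ₜ wedge k ![1, 2, 3, 4]
      - e k σ 1 ⊗ₜ wedge k ![0, 2, 3, 4] + e k σ 2 ⊗ₜ wedge k ![0, 1, 3, 4]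
      - e k σ 3 ⊗ₜ wedge k ![0, 1, 2, 4] + e k σ 4 ⊗ₜ wedge k ![0, 1, 2, 3] := by
  rw [d5, kosLift_apply k σ _ _ (by decide), koszul]
  simp only [sum_structConst]
  have hC : ∀ (l : Fin 5) (m : Fin 4), (if m.castSucc < l then ((-1 : ℤ) ^ ((m : ℕ) + (l : ℕ))) •
      algebraMap k (U k σ) (structConst k ((![0, 1, 2, 3, 4] : Fin 5 → Fin 5) m.castSucc)
        ((![0, 1, 2, 3, 4] : Fin 5 → Fin 5) l) 0) ⊗ₜ[k]
        wedge k (Fin.cons 0 ((![0, 1, 2, 3, 4] : Fin 5 → Fin 5) ∘ l.succAbove ∘ m.succAbove) :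
          Fin 4 → Fin 5) else 0) = 0 := by
    intro l m
    -- No bracket term survives in top degree. If e_0 is one of the two removed vectors, the bracket
    -- is zero; otherwise e_0 stays in the wedge and is repeated.
    by_cases hm : m = 0
    · subst hm
      simp [structConst]
    · split_ifs with h
      · rw [wedge_eq_zero, TensorProduct.tmul_zero, smul_zero]
        intro hi
        refine absurd (@hi 0 1 ?_) (by decide)
        revert l m
        decide
      · rfl
  rw [Finset.sum_eq_zero fun l _ => Finset.sum_eq_zero fun m _ => hC l m, add_zero]
  have h0 : (![0, 1, 2, 3, 4] : Fin 5 → Fin 5) ∘ Fin.succAbove 0 = ![1, 2, 3, 4] := by decide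
  have h1 : (![0, 1, 2, 3, 4] : Fin 5 → Fin 5) ∘ Fin.succAbove 1 = ![0, 2, 3, 4] := by decide
  have h2 : (![0, 1, 2, 3, 4] : Fin 5 → Fin 5) ∘ Fin.succAbove 2 = ![0, 1, 3, 4] := by decide
  have h3 : (![0, 1, 2, 3, 4] : Fin 5 → Fin 5) ∘ Fin.succAbove 3 = ![0, 1, 2, 4] := by decide
  have h4 : (![0, 1, 2, 3, 4] : Fin 5 → Fin 5) ∘ Fin.succAbove 4 = ![0, 1, 2, 3] := by decide
  rw [Fin.sum_univ_five, h0, h1, h2, h3, h4]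
  simp
  abel

/-! ### The differentials in coordinates -/

lemma forall_strictMono_one {P : (Fin 1 → Fin 5) → Prop}
    (h0 : P ![0]) (h1 : P ![1]) (h2 : P ![2]) (h3 : P ![3]) (h4 : P ![4]) :
    ∀ p, StrictMono p → P p := by
  intro p hp
  have key : ∀ a : Fin 5,
      (a = 0) ∨ (a = 1) ∨ (a = 2) ∨ (a = 3) ∨ (a = 4) := by decide
  have e : p = ![p 0] := by ext i; fin_cases i; rfl
  rw [e]
  have h := key (p 0)
  rcases h with h0 | h0 | h0 | h0 | h0 <;>
    rw [h0] <;> assumption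

lemma forall_strictMono_two {P : (Fin 2 → Fin 5) → Prop}
    (h01 : P ![0, 1]) (h02 : P ![0, 2]) (h03 : P ![0, 3]) (h04 : P ![0, 4])
    (h12 : P ![1, 2]) (h13 : P ![1, 3]) (h14 : P ![1, 4]) (h23 : P ![2, 3])
    (h24 : P ![2, 4]) (h34 : P ![3, 4]) :
    ∀ p, StrictMono p → P p := by
  intro p hp
  have key : ∀ a b : Fin 5, a < b →
      (a = 0 ∧ b = 1) ∨ (a = 0 ∧ b = 2) ∨ (a = 0 ∧ b = 3) ∨ (a = 0 ∧ b = 4) ∨ (a = 1 ∧ b = 2) ∨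
      (a = 1 ∧ b = 3) ∨ (a = 1 ∧ b = 4) ∨ (a = 2 ∧ b = 3) ∨ (a = 2 ∧ b = 4) ∨ (a = 3 ∧ b = 4) := by
          decide
  have e : p = ![p 0, p 1] := by ext i; fin_cases i <;> rfl
  rw [e]
  have h := key (p 0) (p 1) (hp (by decide))
  rcases h with ⟨h0, h1⟩ | ⟨h0, h1⟩ | ⟨h0, h1⟩ | ⟨h0, h1⟩ | ⟨h0, h1⟩ | ⟨h0, h1⟩ | ⟨h0, h1⟩ | ⟨h0,
      h1⟩ | ⟨h0, h1⟩ | ⟨h0, h1⟩ <;>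
    rw [h0, h1] <;> assumption

lemma forall_strictMono_three {P : (Fin 3 → Fin 5) → Prop}
    (h012 : P ![0, 1, 2]) (h013 : P ![0, 1, 3]) (h014 : P ![0, 1, 4]) (h023 : P ![0, 2, 3])
    (h024 : P ![0, 2, 4]) (h034 : P ![0, 3, 4]) (h123 : P ![1, 2, 3]) (h124 : P ![1, 2, 4])
    (h134 : P ![1, 3, 4]) (h234 : P ![2, 3, 4]) :
    ∀ p, StrictMono p → P p := by
  intro p hp
  have key : ∀ a b c : Fin 5, a < b → b < c →
      (a = 0 ∧ b = 1 ∧ c = 2) ∨ (a = 0 ∧ b = 1 ∧ c = 3) ∨ (a = 0 ∧ b = 1 ∧ c = 4) ∨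
      (a = 0 ∧ b = 2 ∧ c = 3) ∨ (a = 0 ∧ b = 2 ∧ c = 4) ∨ (a = 0 ∧ b = 3 ∧ c = 4) ∨
      (a = 1 ∧ b = 2 ∧ c = 3) ∨ (a = 1 ∧ b = 2 ∧ c = 4) ∨ (a = 1 ∧ b = 3 ∧ c = 4) ∨
      (a = 2 ∧ b = 3 ∧ c = 4) := by decide
  have e : p = ![p 0, p 1, p 2] := by ext i; fin_cases i <;> rfl
  rw [e]
  have h := key (p 0) (p 1) (p 2) (hp (by decide)) (hp (by decide))
  rcases h with ⟨h0, h1, h2⟩ | ⟨h0, h1, h2⟩ | ⟨h0, h1, h2⟩ | ⟨h0, h1, h2⟩ | ⟨h0, h1, h2⟩ | ⟨h0, h1,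
      h2⟩ | ⟨h0, h1, h2⟩ | ⟨h0, h1, h2⟩ | ⟨h0, h1, h2⟩ | ⟨h0, h1, h2⟩ <;>
    rw [h0, h1, h2] <;> assumption

lemma forall_strictMono_four {P : (Fin 4 → Fin 5) → Prop}
    (h0123 : P ![0, 1, 2, 3]) (h0124 : P ![0, 1, 2, 4]) (h0134 : P ![0, 1, 3, 4])
    (h0234 : P ![0, 2, 3, 4]) (h1234 : P ![1, 2, 3, 4]) :
    ∀ p, StrictMono p → P p := by
  intro p hp
  have key : ∀ a b c d : Fin 5, a < b → b < c → c < d →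
      (a = 0 ∧ b = 1 ∧ c = 2 ∧ d = 3) ∨ (a = 0 ∧ b = 1 ∧ c = 2 ∧ d = 4) ∨
      (a = 0 ∧ b = 1 ∧ c = 3 ∧ d = 4) ∨ (a = 0 ∧ b = 2 ∧ c = 3 ∧ d = 4) ∨
      (a = 1 ∧ b = 2 ∧ c = 3 ∧ d = 4) := by decide
  have e : p = ![p 0, p 1, p 2, p 3] := by ext i; fin_cases i <;> rfl
  rw [e]
  have h := key (p 0) (p 1) (p 2) (p 3) (hp (by decide)) (hp (by decide)) (hp (by decide))
  rcases h with ⟨h0, h1, h2, h3⟩ | ⟨h0, h1, h2, h3⟩ | ⟨h0, h1, h2, h3⟩ | ⟨h0, h1, h2, h3⟩ | ⟨h0,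
      h1, h2, h3⟩ <;>
    rw [h0, h1, h2, h3] <;> assumption

lemma forall_strictMono_five {P : (Fin 5 → Fin 5) → Prop}
    (h01234 : P ![0, 1, 2, 3, 4]) :
    ∀ p, StrictMono p → P p := by
  intro p hp
  have key : ∀ a b c d e : Fin 5, a < b → b < c → c < d → d < e →
      (a = 0 ∧ b = 1 ∧ c = 2 ∧ d = 3 ∧ e = 4) := by omega
  have e : p = ![p 0, p 1, p 2, p 3, p 4] := by ext i; fin_cases i <;> rfl
  rw [e]
  have h := key (p 0) (p 1) (p 2) (p 3) (p 4) (hp (by decide)) (hp (by decide)) (hp (by decide))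
      (hp (by decide))
  obtain ⟨h0, h1, h2, h3, h4⟩ := h
  rwa [h0, h1, h2, h3, h4]

/-! ### Coordinate formulas for the differentials -/

lemma coord_tmul_one (σ : ℤˣ) {a e : Fin 5} (w : U k σ) :
    coord k σ ![a] (w ⊗ₜ wedge k ![e]) = if e = a then w else 0 := by
  rw [coord_tmul_wedge k σ _ (Subsingleton.strictMono _) _ _ (Or.inl (Subsingleton.strictMono _))]
  congr 1
  simp

lemma coord_tmul_two (σ : ℤˣ) {a b e f : Fin 5} (h0 : a < b)
    (g0 : e ≤ f) (w : U k σ) :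
    coord k σ ![a, b] (w ⊗ₜ wedge k ![e, f]) = if e = a ∧ f = b then w else 0 := by
  have hq : StrictMono ![a, b] := by
    rw [Fin.strictMono_iff_lt_succ]
    intro i
    fin_cases i
    assumption
  rw [coord_tmul_wedge k σ _ hq]
  · congr 1
    simp
  · by_cases hr : e < f
    · refine Or.inl (Fin.strictMono_iff_lt_succ.mpr fun i => ?_)
      fin_cases i
      · exact hr
    · right
      intro hi
      apply hr
      exact lt_of_le_of_ne g0 fun h => absurd (@hi 0 1 h) (by decide)

lemma coord_tmul_three (σ : ℤˣ) {a b c e f g : Fin 5} (h0 : a < b) (h1 : b < c)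
    (g0 : e ≤ f) (g1 : f ≤ g) (w : U k σ) :
    coord k σ ![a, b, c] (w ⊗ₜ wedge k ![e, f, g]) = if e = a ∧ f = b ∧ g = c then w else 0 := by
  have hq : StrictMono ![a, b, c] := by
    rw [Fin.strictMono_iff_lt_succ]
    intro i
    fin_cases i <;> assumption
  rw [coord_tmul_wedge k σ _ hq]
  · congr 1
    simp
  · by_cases hr : e < f ∧ f < g
    · refine Or.inl (Fin.strictMono_iff_lt_succ.mpr fun i => ?_)
      fin_cases i
      · exact hr.1
      · exact hr.2
    · right
      intro hi
      apply hr
      refine ⟨?_, ?_⟩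
      · exact lt_of_le_of_ne g0 fun h => absurd (@hi 0 1 h) (by decide)
      · exact lt_of_le_of_ne g1 fun h => absurd (@hi 1 2 h) (by decide)

lemma coord_tmul_four (σ : ℤˣ) {a b c d e f g h : Fin 5} (h0 : a < b) (h1 : b < c) (h2 : c < d)
    (g0 : e ≤ f) (g1 : f ≤ g) (g2 : g ≤ h) (w : U k σ) :
    coord k σ ![a, b, c, d] (w ⊗ₜ wedge k ![e, f, g, h]) = if e = a ∧ f = b ∧ g = c ∧ h = d then w
        else 0 := by
  have hq : StrictMono ![a, b, c, d] := by
    rw [Fin.strictMono_iff_lt_succ]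
    intro i
    fin_cases i <;> assumption
  rw [coord_tmul_wedge k σ _ hq]
  · congr 1
    simp
  · by_cases hr : e < f ∧ f < g ∧ g < h
    · refine Or.inl (Fin.strictMono_iff_lt_succ.mpr fun i => ?_)
      fin_cases i
      · exact hr.1
      · exact hr.2.1
      · exact hr.2.2
    · right
      intro hi
      apply hr
      refine ⟨?_, ?_, ?_⟩
      · exact lt_of_le_of_ne g0 fun h => absurd (@hi 0 1 h) (by decide)
      · exact lt_of_le_of_ne g1 fun h => absurd (@hi 1 2 h) (by decide)
      · exact lt_of_le_of_ne g2 fun h => absurd (@hi 2 3 h) (by decide)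

/-! ### Expansion in the basis of wedges. -/

lemma kos_expand_one (σ : ℤˣ) (x : Kos k σ 1) : x =
    coord k σ ![0] x • ((1 : U k σ) ⊗ₜ wedge k ![0]) +
    coord k σ ![1] x • ((1 : U k σ) ⊗ₜ wedge k ![1]) +
    coord k σ ![2] x • ((1 : U k σ) ⊗ₜ wedge k ![2]) +
    coord k σ ![3] x • ((1 : U k σ) ⊗ₜ wedge k ![3]) +
    coord k σ ![4] x • ((1 : U k σ) ⊗ₜ wedge k ![4]) := by
  refine kos_ext k σ ?_
  refine forall_strictMono_one ?_ ?_ ?_ ?_ ?_ <;>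
    simp (disch := decide) only [map_add, map_smul, coord_tmul_one] <;> simp

lemma kos_expand_two (σ : ℤˣ) (x : Kos k σ 2) : x =
    coord k σ ![0, 1] x • ((1 : U k σ) ⊗ₜ wedge k ![0, 1]) +
    coord k σ ![0, 2] x • ((1 : U k σ) ⊗ₜ wedge k ![0, 2]) +
    coord k σ ![0, 3] x • ((1 : U k σ) ⊗ₜ wedge k ![0, 3]) +
    coord k σ ![0, 4] x • ((1 : U k σ) ⊗ₜ wedge k ![0, 4]) +
    coord k σ ![1, 2] x • ((1 : U k σ) ⊗ₜ wedge k ![1, 2]) +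
    coord k σ ![1, 3] x • ((1 : U k σ) ⊗ₜ wedge k ![1, 3]) +
    coord k σ ![1, 4] x • ((1 : U k σ) ⊗ₜ wedge k ![1, 4]) +
    coord k σ ![2, 3] x • ((1 : U k σ) ⊗ₜ wedge k ![2, 3]) +
    coord k σ ![2, 4] x • ((1 : U k σ) ⊗ₜ wedge k ![2, 4]) +
    coord k σ ![3, 4] x • ((1 : U k σ) ⊗ₜ wedge k ![3, 4]) := by
  refine kos_ext k σ ?_
  refine forall_strictMono_two ?_ ?_ ?_ ?_ ?_ ?_ ?_ ?_ ?_ ?_ <;>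
    simp (disch := decide) only [map_add, map_smul, coord_tmul_two] <;> simp

lemma kos_expand_three (σ : ℤˣ) (x : Kos k σ 3) : x =
    coord k σ ![0, 1, 2] x • ((1 : U k σ) ⊗ₜ wedge k ![0, 1, 2]) +
    coord k σ ![0, 1, 3] x • ((1 : U k σ) ⊗ₜ wedge k ![0, 1, 3]) +
    coord k σ ![0, 1, 4] x • ((1 : U k σ) ⊗ₜ wedge k ![0, 1, 4]) +
    coord k σ ![0, 2, 3] x • ((1 : U k σ) ⊗ₜ wedge k ![0, 2, 3]) +
    coord k σ ![0, 2, 4] x • ((1 : U k σ) ⊗ₜ wedge k ![0, 2, 4]) +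
    coord k σ ![0, 3, 4] x • ((1 : U k σ) ⊗ₜ wedge k ![0, 3, 4]) +
    coord k σ ![1, 2, 3] x • ((1 : U k σ) ⊗ₜ wedge k ![1, 2, 3]) +
    coord k σ ![1, 2, 4] x • ((1 : U k σ) ⊗ₜ wedge k ![1, 2, 4]) +
    coord k σ ![1, 3, 4] x • ((1 : U k σ) ⊗ₜ wedge k ![1, 3, 4]) +
    coord k σ ![2, 3, 4] x • ((1 : U k σ) ⊗ₜ wedge k ![2, 3, 4]) := by
  refine kos_ext k σ ?_
  refine forall_strictMono_three ?_ ?_ ?_ ?_ ?_ ?_ ?_ ?_ ?_ ?_ <;>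
    simp (disch := decide) only [map_add, map_smul, coord_tmul_three] <;> simp

lemma kos_expand_four (σ : ℤˣ) (x : Kos k σ 4) : x =
    coord k σ ![0, 1, 2, 3] x • ((1 : U k σ) ⊗ₜ wedge k ![0, 1, 2, 3]) +
    coord k σ ![0, 1, 2, 4] x • ((1 : U k σ) ⊗ₜ wedge k ![0, 1, 2, 4]) +
    coord k σ ![0, 1, 3, 4] x • ((1 : U k σ) ⊗ₜ wedge k ![0, 1, 3, 4]) +
    coord k σ ![0, 2, 3, 4] x • ((1 : U k σ) ⊗ₜ wedge k ![0, 2, 3, 4]) +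
    coord k σ ![1, 2, 3, 4] x • ((1 : U k σ) ⊗ₜ wedge k ![1, 2, 3, 4]) := by
  refine kos_ext k σ ?_
  refine forall_strictMono_four ?_ ?_ ?_ ?_ ?_ <;>
    simp (disch := decide) only [map_add, map_smul, coord_tmul_four] <;> simp

lemma kos_expand_five (σ : ℤˣ) (x : Kos k σ 5) : x =
    coord k σ ![0, 1, 2, 3, 4] x • ((1 : U k σ) ⊗ₜ wedge k ![0, 1, 2, 3, 4]) := by
  refine kos_ext k σ ?_
  refine forall_strictMono_five ?_
  rw [map_smul, coord_tmul_wedge k σ _ (by decide) _ _ (Or.inl (by decide)), if_pos rfl,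
    smul_eq_mul, mul_one]

/-! ### Coordinates of the differentials. -/

lemma d1_eq (σ : ℤˣ) (x : Kos k σ 1) : d1 k σ x =
    coord k σ ![0] x * e k σ 0 + coord k σ ![1] x * e k σ 1 + coord k σ ![2] x * e k σ 2 +
      coord k σ ![3] x * e k σ 3 + coord k σ ![4] x * e k σ 4 := by
  conv_lhs => rw [kos_expand_one k σ x]
  simp (disch := exact Subsingleton.strictMono _) only [map_add, map_smul, d1_wedge, smul_eq_mul]
  rfl

lemma coord_d2_0 (σ : ℤˣ) (x : Kos k σ 2) : coord k σ ![0] (d2 k σ x) =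
    -(coord k σ ![0, 1] x * e k σ 1) - coord k σ ![0, 2] x * e k σ 2
    - coord k σ ![0, 3] x * e k σ 3 - coord k σ ![0, 4] x * e k σ 4
    - coord k σ ![1, 2] x * cU k σ 1 2 - coord k σ ![1, 3] x * cU k σ 1 3
    - coord k σ ![1, 4] x * cU k σ 1 4 - coord k σ ![2, 3] x * cU k σ 2 3
    - coord k σ ![2, 4] x * cU k σ 2 4 - coord k σ ![3, 4] x * cU k σ 3 4 := by
  conv_lhs => rw [kos_expand_two k σ x]
  simp (disch := decide) [d2_wedge, coord_tmul_one, cU_zero_left]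
  abel

/-- Here, as in every coordinate without index 0, no `cU` occurs. Modulo e_0 such coordinates are
given by the undeformed commutative Koszul differential. -/
lemma coord_d2_1 (σ : ℤˣ) (x : Kos k σ 2) : coord k σ ![1] (d2 k σ x) =
    coord k σ ![0, 1] x * e k σ 0 - coord k σ ![1, 2] x * e k σ 2
    - coord k σ ![1, 3] x * e k σ 3 - coord k σ ![1, 4] x * e k σ 4 := by
  conv_lhs => rw [kos_expand_two k σ x]
  simp (disch := decide) [d2_wedge, coord_tmul_one, cU_zero_left]
  abel

lemma coord_d2_2 (σ : ℤˣ) (x : Kos k σ 2) : coord k σ ![2] (d2 k σ x) =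
    coord k σ ![0, 2] x * e k σ 0 + coord k σ ![1, 2] x * e k σ 1
    - coord k σ ![2, 3] x * e k σ 3 - coord k σ ![2, 4] x * e k σ 4 := by
  conv_lhs => rw [kos_expand_two k σ x]
  simp (disch := decide) [d2_wedge, coord_tmul_one, cU_zero_left]
  abel

lemma coord_d2_3 (σ : ℤˣ) (x : Kos k σ 2) : coord k σ ![3] (d2 k σ x) =
    coord k σ ![0, 3] x * e k σ 0 + coord k σ ![1, 3] x * e k σ 1
    + coord k σ ![2, 3] x * e k σ 2 - coord k σ ![3, 4] x * e k σ 4 := by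
  conv_lhs => rw [kos_expand_two k σ x]
  simp (disch := decide) [d2_wedge, coord_tmul_one, cU_zero_left]
  abel

lemma coord_d2_4 (σ : ℤˣ) (x : Kos k σ 2) : coord k σ ![4] (d2 k σ x) =
    coord k σ ![0, 4] x * e k σ 0 + coord k σ ![1, 4] x * e k σ 1
    + coord k σ ![2, 4] x * e k σ 2 + coord k σ ![3, 4] x * e k σ 3 := by
  conv_lhs => rw [kos_expand_two k σ x]
  simp (disch := decide) [d2_wedge, coord_tmul_one, cU_zero_left]

lemma coord_d3_01 (σ : ℤˣ) (x : Kos k σ 3) : coord k σ ![0, 1] (d3 k σ x) =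
    coord k σ ![0, 1, 2] x * e k σ 2 + coord k σ ![0, 1, 3] x * e k σ 3
    + coord k σ ![0, 1, 4] x * e k σ 4 - coord k σ ![1, 2, 3] x * cU k σ 2 3
    - coord k σ ![1, 2, 4] x * cU k σ 2 4 - coord k σ ![1, 3, 4] x * cU k σ 3 4 := by
  conv_lhs => rw [kos_expand_three k σ x]
  simp (disch := decide) [d3_wedge, coord_tmul_two, cU_zero_left]
  abel

lemma coord_d3_02 (σ : ℤˣ) (x : Kos k σ 3) : coord k σ ![0, 2] (d3 k σ x) =
    -(coord k σ ![0, 1, 2] x * e k σ 1) + coord k σ ![0, 2, 3] x * e k σ 3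
    + coord k σ ![0, 2, 4] x * e k σ 4 + coord k σ ![1, 2, 3] x * cU k σ 1 3
    + coord k σ ![1, 2, 4] x * cU k σ 1 4 - coord k σ ![2, 3, 4] x * cU k σ 3 4 := by
  conv_lhs => rw [kos_expand_three k σ x]
  simp (disch := decide) [d3_wedge, coord_tmul_two, cU_zero_left]
  abel

lemma coord_d3_03 (σ : ℤˣ) (x : Kos k σ 3) : coord k σ ![0, 3] (d3 k σ x) =
    -(coord k σ ![0, 1, 3] x * e k σ 1) - coord k σ ![0, 2, 3] x * e k σ 2
    + coord k σ ![0, 3, 4] x * e k σ 4 - coord k σ ![1, 2, 3] x * cU k σ 1 2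
    + coord k σ ![1, 3, 4] x * cU k σ 1 4 + coord k σ ![2, 3, 4] x * cU k σ 2 4 := by
  conv_lhs => rw [kos_expand_three k σ x]
  simp (disch := decide) [d3_wedge, coord_tmul_two, cU_zero_left]
  abel

lemma coord_d3_04 (σ : ℤˣ) (x : Kos k σ 3) : coord k σ ![0, 4] (d3 k σ x) =
    -(coord k σ ![0, 1, 4] x * e k σ 1) - coord k σ ![0, 2, 4] x * e k σ 2
    - coord k σ ![0, 3, 4] x * e k σ 3 - coord k σ ![1, 2, 4] x * cU k σ 1 2
    - coord k σ ![1, 3, 4] x * cU k σ 1 3 - coord k σ ![2, 3, 4] x * cU k σ 2 3 := by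
  conv_lhs => rw [kos_expand_three k σ x]
  simp (disch := decide) [d3_wedge, coord_tmul_two, cU_zero_left]
  abel

lemma coord_d3_12 (σ : ℤˣ) (x : Kos k σ 3) : coord k σ ![1, 2] (d3 k σ x) =
    coord k σ ![0, 1, 2] x * e k σ 0 + coord k σ ![1, 2, 3] x * e k σ 3
    + coord k σ ![1, 2, 4] x * e k σ 4 := by
  conv_lhs => rw [kos_expand_three k σ x]
  simp (disch := decide) [d3_wedge, coord_tmul_two, cU_zero_left]

lemma coord_d3_13 (σ : ℤˣ) (x : Kos k σ 3) : coord k σ ![1, 3] (d3 k σ x) =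
    coord k σ ![0, 1, 3] x * e k σ 0 - coord k σ ![1, 2, 3] x * e k σ 2
    + coord k σ ![1, 3, 4] x * e k σ 4 := by
  conv_lhs => rw [kos_expand_three k σ x]
  simp (disch := decide) [d3_wedge, coord_tmul_two, cU_zero_left]
  abel

lemma coord_d3_14 (σ : ℤˣ) (x : Kos k σ 3) : coord k σ ![1, 4] (d3 k σ x) =
    coord k σ ![0, 1, 4] x * e k σ 0 - coord k σ ![1, 2, 4] x * e k σ 2
    - coord k σ ![1, 3, 4] x * e k σ 3 := by
  conv_lhs => rw [kos_expand_three k σ x]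
  simp (disch := decide) [d3_wedge, coord_tmul_two, cU_zero_left]
  abel

lemma coord_d3_23 (σ : ℤˣ) (x : Kos k σ 3) : coord k σ ![2, 3] (d3 k σ x) =
    coord k σ ![0, 2, 3] x * e k σ 0 + coord k σ ![1, 2, 3] x * e k σ 1
    + coord k σ ![2, 3, 4] x * e k σ 4 := by
  conv_lhs => rw [kos_expand_three k σ x]
  simp (disch := decide) [d3_wedge, coord_tmul_two, cU_zero_left]

lemma coord_d3_24 (σ : ℤˣ) (x : Kos k σ 3) : coord k σ ![2, 4] (d3 k σ x) =
    coord k σ ![0, 2, 4] x * e k σ 0 + coord k σ ![1, 2, 4] x * e k σ 1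
    - coord k σ ![2, 3, 4] x * e k σ 3 := by
  conv_lhs => rw [kos_expand_three k σ x]
  simp (disch := decide) [d3_wedge, coord_tmul_two, cU_zero_left]
  abel

lemma coord_d3_34 (σ : ℤˣ) (x : Kos k σ 3) : coord k σ ![3, 4] (d3 k σ x) =
    coord k σ ![0, 3, 4] x * e k σ 0 + coord k σ ![1, 3, 4] x * e k σ 1
    + coord k σ ![2, 3, 4] x * e k σ 2 := by
  conv_lhs => rw [kos_expand_three k σ x]
  simp (disch := decide) [d3_wedge, coord_tmul_two, cU_zero_left]

lemma coord_d4_012 (σ : ℤˣ) (x : Kos k σ 4) : coord k σ ![0, 1, 2] (d4 k σ x) =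
    -(coord k σ ![0, 1, 2, 3] x * e k σ 3) - coord k σ ![0, 1, 2, 4] x * e k σ 4
    - coord k σ ![1, 2, 3, 4] x * cU k σ 3 4 := by
  conv_lhs => rw [kos_expand_four k σ x]
  simp (disch := decide) [d4_wedge, coord_tmul_three, cU_zero_left]
  abel

lemma coord_d4_013 (σ : ℤˣ) (x : Kos k σ 4) : coord k σ ![0, 1, 3] (d4 k σ x) =
    coord k σ ![0, 1, 2, 3] x * e k σ 2 - coord k σ ![0, 1, 3, 4] x * e k σ 4
    + coord k σ ![1, 2, 3, 4] x * cU k σ 2 4 := by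
  conv_lhs => rw [kos_expand_four k σ x]
  simp (disch := decide) [d4_wedge, coord_tmul_three, cU_zero_left]
  abel

lemma coord_d4_014 (σ : ℤˣ) (x : Kos k σ 4) : coord k σ ![0, 1, 4] (d4 k σ x) =
    coord k σ ![0, 1, 2, 4] x * e k σ 2 + coord k σ ![0, 1, 3, 4] x * e k σ 3
    - coord k σ ![1, 2, 3, 4] x * cU k σ 2 3 := by
  conv_lhs => rw [kos_expand_four k σ x]
  simp (disch := decide) [d4_wedge, coord_tmul_three, cU_zero_left]
  abel

lemma coord_d4_023 (σ : ℤˣ) (x : Kos k σ 4) : coord k σ ![0, 2, 3] (d4 k σ x) =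
    -(coord k σ ![0, 1, 2, 3] x * e k σ 1) - coord k σ ![0, 2, 3, 4] x * e k σ 4
    - coord k σ ![1, 2, 3, 4] x * cU k σ 1 4 := by
  conv_lhs => rw [kos_expand_four k σ x]
  simp (disch := decide) [d4_wedge, coord_tmul_three, cU_zero_left]
  abel

lemma coord_d4_024 (σ : ℤˣ) (x : Kos k σ 4) : coord k σ ![0, 2, 4] (d4 k σ x) =
    -(coord k σ ![0, 1, 2, 4] x * e k σ 1) + coord k σ ![0, 2, 3, 4] x * e k σ 3
    + coord k σ ![1, 2, 3, 4] x * cU k σ 1 3 := by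
  conv_lhs => rw [kos_expand_four k σ x]
  simp (disch := decide) [d4_wedge, coord_tmul_three, cU_zero_left]

lemma coord_d4_034 (σ : ℤˣ) (x : Kos k σ 4) : coord k σ ![0, 3, 4] (d4 k σ x) =
    -(coord k σ ![0, 1, 3, 4] x * e k σ 1) - coord k σ ![0, 2, 3, 4] x * e k σ 2
    - coord k σ ![1, 2, 3, 4] x * cU k σ 1 2 := by
  conv_lhs => rw [kos_expand_four k σ x]
  simp (disch := decide) [d4_wedge, coord_tmul_three, cU_zero_left]
  abel

lemma coord_d4_123 (σ : ℤˣ) (x : Kos k σ 4) : coord k σ ![1, 2, 3] (d4 k σ x) =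
    coord k σ ![0, 1, 2, 3] x * e k σ 0 - coord k σ ![1, 2, 3, 4] x * e k σ 4 := by
  conv_lhs => rw [kos_expand_four k σ x]
  simp (disch := decide) [d4_wedge, coord_tmul_three, cU_zero_left]
  abel

lemma coord_d4_124 (σ : ℤˣ) (x : Kos k σ 4) : coord k σ ![1, 2, 4] (d4 k σ x) =
    coord k σ ![0, 1, 2, 4] x * e k σ 0 + coord k σ ![1, 2, 3, 4] x * e k σ 3 := by
  conv_lhs => rw [kos_expand_four k σ x]
  simp (disch := decide) [d4_wedge, coord_tmul_three, cU_zero_left]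

lemma coord_d4_134 (σ : ℤˣ) (x : Kos k σ 4) : coord k σ ![1, 3, 4] (d4 k σ x) =
    coord k σ ![0, 1, 3, 4] x * e k σ 0 - coord k σ ![1, 2, 3, 4] x * e k σ 2 := by
  conv_lhs => rw [kos_expand_four k σ x]
  simp (disch := decide) [d4_wedge, coord_tmul_three, cU_zero_left]
  abel

lemma coord_d4_234 (σ : ℤˣ) (x : Kos k σ 4) : coord k σ ![2, 3, 4] (d4 k σ x) =
    coord k σ ![0, 2, 3, 4] x * e k σ 0 + coord k σ ![1, 2, 3, 4] x * e k σ 1 := by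
  conv_lhs => rw [kos_expand_four k σ x]
  simp (disch := decide) [d4_wedge, coord_tmul_three, cU_zero_left]

lemma coord_d5_0123 (σ : ℤˣ) (x : Kos k σ 5) : coord k σ ![0, 1, 2, 3] (d5 k σ x) =
    coord k σ ![0, 1, 2, 3, 4] x * e k σ 4 := by
  conv_lhs => rw [kos_expand_five k σ x]
  simp (disch := decide) [d5_wedge, coord_tmul_four]

lemma coord_d5_0124 (σ : ℤˣ) (x : Kos k σ 5) : coord k σ ![0, 1, 2, 4] (d5 k σ x) =
    -(coord k σ ![0, 1, 2, 3, 4] x * e k σ 3) := by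
  conv_lhs => rw [kos_expand_five k σ x]
  simp (disch := decide) [d5_wedge, coord_tmul_four]

lemma coord_d5_0134 (σ : ℤˣ) (x : Kos k σ 5) : coord k σ ![0, 1, 3, 4] (d5 k σ x) =
    coord k σ ![0, 1, 2, 3, 4] x * e k σ 2 := by
  conv_lhs => rw [kos_expand_five k σ x]
  simp (disch := decide) [d5_wedge, coord_tmul_four]

lemma coord_d5_0234 (σ : ℤˣ) (x : Kos k σ 5) : coord k σ ![0, 2, 3, 4] (d5 k σ x) =
    -(coord k σ ![0, 1, 2, 3, 4] x * e k σ 1) := by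
  conv_lhs => rw [kos_expand_five k σ x]
  simp (disch := decide) [d5_wedge, coord_tmul_four]

lemma coord_d5_1234 (σ : ℤˣ) (x : Kos k σ 5) : coord k σ ![1, 2, 3, 4] (d5 k σ x) =
    coord k σ ![0, 1, 2, 3, 4] x * e k σ 0 := by
  conv_lhs => rw [kos_expand_five k σ x]
  simp (disch := decide) [d5_wedge, coord_tmul_four]

/-! ### The Koszul differentials square to zero -/

/-- Reordering of generators into increasing order. -/
lemma e_mul_e_of_lt (σ : ℤˣ) {i j : Fin 5} (_ : i < j) :
    e k σ j * e k σ i = e k σ i * e k σ j - cU k σ i j * e k σ 0 := by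
  rw [← e_commutator]; abel

lemma e_mul_cU (σ : ℤˣ) (i j l : Fin 5) : e k σ l * cU k σ i j = cU k σ i j * e k σ l :=
  (cU_central k σ i j _).symm

lemma d1_d2 (σ : ℤˣ) (x : Kos k σ 2) : d1 k σ (d2 k σ x) = 0 := by
  rw [d1_eq]
  simp (disch := decide) only [coord_d2_0, coord_d2_1, coord_d2_2, coord_d2_3, coord_d2_4,
    add_mul, sub_mul, neg_mul, mul_assoc, cU_zero_left, e_mul_e_of_lt, mul_sub, zero_mul, sub_zero]
  abel

/-- Generators are rewritten in increasing order and the central `cU` moved in front of them. The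
terms c_{ij} e_0 arising from reordering cancel those of the bracket part, leaving an identity of
abelian groups. -/
lemma d2_d3 (σ : ℤˣ) (x : Kos k σ 3) : d2 k σ (d3 k σ x) = 0 := by
  refine kos_ext k σ (forall_strictMono_one ?_ ?_ ?_ ?_ ?_) <;>
    rw [map_zero]
  all_goals
    simp (disch := decide) only [coord_d2_0, coord_d2_1, coord_d2_2, coord_d2_3, coord_d2_4,
      coord_d3_01, coord_d3_02, coord_d3_03, coord_d3_04, coord_d3_12, coord_d3_13,
      coord_d3_14, coord_d3_23, coord_d3_24, coord_d3_34,
      add_mul, sub_mul, neg_mul, mul_assoc, e_mul_e_of_lt, e_mul_cU, mul_sub, cU_zero_left,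
      zero_mul, sub_zero]
    abel

lemma d3_d4 (σ : ℤˣ) (x : Kos k σ 4) : d3 k σ (d4 k σ x) = 0 := by
  refine kos_ext k σ (forall_strictMono_two ?_ ?_ ?_ ?_ ?_ ?_ ?_ ?_ ?_ ?_) <;>
    rw [map_zero]
  all_goals
    simp (disch := decide) only [coord_d3_01, coord_d3_02, coord_d3_03, coord_d3_04, coord_d3_12,
        coord_d3_13,
      coord_d3_14, coord_d3_23, coord_d3_24, coord_d3_34,
      coord_d4_012, coord_d4_013, coord_d4_014, coord_d4_023, coord_d4_024, coord_d4_034,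
      coord_d4_123, coord_d4_124, coord_d4_134, coord_d4_234,
      add_mul, sub_mul, neg_mul, mul_assoc, e_mul_e_of_lt, e_mul_cU, mul_sub, cU_zero_left,
      zero_mul, sub_zero]
    abel

lemma d4_d5 (σ : ℤˣ) (x : Kos k σ 5) : d4 k σ (d5 k σ x) = 0 := by
  refine kos_ext k σ (forall_strictMono_three ?_ ?_ ?_ ?_ ?_ ?_ ?_ ?_ ?_ ?_) <;>
    rw [map_zero]
  all_goals
    simp (disch := decide) only [coord_d4_012, coord_d4_013, coord_d4_014, coord_d4_023,
        coord_d4_024, coord_d4_034,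
      coord_d4_123, coord_d4_124, coord_d4_134, coord_d4_234,
      coord_d5_0123, coord_d5_0124, coord_d5_0134, coord_d5_0234, coord_d5_1234,
      neg_mul, mul_assoc, e_mul_e_of_lt, e_mul_cU, mul_sub, cU_zero_left,
      zero_mul, sub_zero]
    abel

/-! ### Exactness of the Koszul complex -/

lemma toPoly_e_one (σ : ℤˣ) : toPoly k σ (e k σ 1) = py k 0 := toPoly_e_succ k σ 0
lemma toPoly_e_two (σ : ℤˣ) : toPoly k σ (e k σ 2) = py k 1 := toPoly_e_succ k σ 1
lemma toPoly_e_three (σ : ℤˣ) : toPoly k σ (e k σ 3) = py k 2 := toPoly_e_succ k σ 2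
lemma toPoly_e_four (σ : ℤˣ) : toPoly k σ (e k σ 4) = py k 3 := toPoly_e_succ k σ 3

lemma eq_zero_of_mul_e_zero (σ : ℤˣ) {u : U k σ} (hu : u * e k σ 0 = 0) : u = 0 :=
  eq_zero_of_e_zero_mul k σ (by rw [e_zero_central, hu])

lemma exact_d1_d0 (σ : ℤˣ) : Function.Exact (d1 k σ) (d0 k σ) := by
  intro x
  constructor
  · intro hx
    obtain ⟨a, ha⟩ := exists_left_of_counit_eq_zero k σ x hx
    refine ⟨kosMk k σ fun p => a (p 0), ?_⟩
    rw [d1_eq, ha, Fin.sum_univ_five]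
    simp only [coord_kosMk k σ _ _ (Subsingleton.strictMono _)]
    rfl
  · rintro ⟨y, rfl⟩
    have he : ∀ i, counit k σ (e k σ i) = 0 := counitT_genT k
    change counit k σ (d1 k σ y) = 0
    simp only [d1_eq, map_add, map_mul, he, mul_zero, add_zero]

lemma d0_surjective (σ : ℤˣ) : Function.Surjective (d0 k σ) := fun r =>
  ⟨algebraMap (PowerSeries k) (U k σ) r, (counit k σ).commutes r⟩

lemma exists_kos_two (σ : ℤˣ) (b01 b02 b03 b04 b12 b13 b14 b23 b24 b34 : U k σ) : ∃ y : Kos k σ 2,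
      coord k σ ![0, 1] y = b01 ∧ coord k σ ![0, 2] y = b02 ∧ coord k σ ![0, 3] y = b03 ∧
      coord k σ ![0, 4] y = b04 ∧ coord k σ ![1, 2] y = b12 ∧ coord k σ ![1, 3] y = b13 ∧
      coord k σ ![1, 4] y = b14 ∧ coord k σ ![2, 3] y = b23 ∧ coord k σ ![2, 4] y = b24 ∧
      coord k σ ![3, 4] y = b34 := by
  refine ⟨b01 • (1 ⊗ₜ wedge k ![0, 1]) + b02 • (1 ⊗ₜ wedge k ![0, 2]) +
      b03 • (1 ⊗ₜ wedge k ![0, 3]) + b04 • (1 ⊗ₜ wedge k ![0, 4]) +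
      b12 • (1 ⊗ₜ wedge k ![1, 2]) + b13 • (1 ⊗ₜ wedge k ![1, 3]) +
      b14 • (1 ⊗ₜ wedge k ![1, 4]) + b23 • (1 ⊗ₜ wedge k ![2, 3]) +
      b24 • (1 ⊗ₜ wedge k ![2, 4]) + b34 • (1 ⊗ₜ wedge k ![3, 4]), ?_, ?_, ?_, ?_, ?_, ?_, ?_, ?_,
          ?_, ?_⟩ <;>
    simp (disch := decide) only [map_add, map_smul, coord_tmul_two] <;> simp

lemma exists_kos_three (σ : ℤˣ) (b012 b013 b014 b023 b024 b034 b123 b124 b134 b234 : U k σ) : ∃ y :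
    Kos k σ 3,
      coord k σ ![0, 1, 2] y = b012 ∧ coord k σ ![0, 1, 3] y = b013 ∧
      coord k σ ![0, 1, 4] y = b014 ∧ coord k σ ![0, 2, 3] y = b023 ∧
      coord k σ ![0, 2, 4] y = b024 ∧ coord k σ ![0, 3, 4] y = b034 ∧
      coord k σ ![1, 2, 3] y = b123 ∧ coord k σ ![1, 2, 4] y = b124 ∧
      coord k σ ![1, 3, 4] y = b134 ∧ coord k σ ![2, 3, 4] y = b234 := by
  refine ⟨b012 • (1 ⊗ₜ wedge k ![0, 1, 2]) + b013 • (1 ⊗ₜ wedge k ![0, 1, 3]) +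
      b014 • (1 ⊗ₜ wedge k ![0, 1, 4]) + b023 • (1 ⊗ₜ wedge k ![0, 2, 3]) +
      b024 • (1 ⊗ₜ wedge k ![0, 2, 4]) + b034 • (1 ⊗ₜ wedge k ![0, 3, 4]) +
      b123 • (1 ⊗ₜ wedge k ![1, 2, 3]) + b124 • (1 ⊗ₜ wedge k ![1, 2, 4]) +
      b134 • (1 ⊗ₜ wedge k ![1, 3, 4]) + b234 • (1 ⊗ₜ wedge k ![2, 3, 4]), ?_, ?_, ?_, ?_, ?_, ?_,
          ?_, ?_, ?_, ?_⟩ <;>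
    simp (disch := decide) only [map_add, map_smul, coord_tmul_three] <;> simp

lemma exists_kos_four (σ : ℤˣ) (b0123 b0124 b0134 b0234 b1234 : U k σ) : ∃ y : Kos k σ 4,
      coord k σ ![0, 1, 2, 3] y = b0123 ∧ coord k σ ![0, 1, 2, 4] y = b0124 ∧
      coord k σ ![0, 1, 3, 4] y = b0134 ∧ coord k σ ![0, 2, 3, 4] y = b0234 ∧
      coord k σ ![1, 2, 3, 4] y = b1234 := by
  refine ⟨b0123 • (1 ⊗ₜ wedge k ![0, 1, 2, 3]) + b0124 • (1 ⊗ₜ wedge k ![0, 1, 2, 4]) +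
      b0134 • (1 ⊗ₜ wedge k ![0, 1, 3, 4]) + b0234 • (1 ⊗ₜ wedge k ![0, 2, 3, 4]) +
      b1234 • (1 ⊗ₜ wedge k ![1, 2, 3, 4]), ?_, ?_, ?_, ?_, ?_⟩ <;>
    simp (disch := decide) only [map_add, map_smul, coord_tmul_four] <;> simp

/-- The model for the next exactness proofs. A cycle is corrected by a boundary lifted from the
quotient by e_0, then by the boundary of a chain of wedges with e_0; what is left is supported on
wedges with e_0 and vanishes by regularity of e_0. -/
lemma exact_d2_d1 (σ : ℤˣ) : Function.Exact (d2 k σ) (d1 k σ) := by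
  intro x
  refine ⟨fun hx => ?_, ?_⟩
  swap
  · rintro ⟨y, rfl⟩
    exact d1_d2 k σ y
  have h1 := congrArg (toPoly k σ) ((d1_eq k σ x).symm.trans hx)
  simp only [map_add, map_mul, map_zero, toPoly_e_zero, toPoly_e_one, toPoly_e_two, toPoly_e_three,
      toPoly_e_four,
    mul_zero] at h1
  obtain ⟨c12, c13, c14, c23, c24, c34, r1, r2, r3, r4⟩ := polyH_exact41 k (toPoly k σ (coord k σ
      ![1] x))
    (toPoly k σ (coord k σ ![2] x))
    (toPoly k σ (coord k σ ![3] x))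
    (toPoly k σ (coord k σ ![4] x))
    (by linear_combination h1)
  obtain ⟨b12, rfl⟩ := toPoly_surjective k σ c12
  obtain ⟨b13, rfl⟩ := toPoly_surjective k σ c13
  obtain ⟨b14, rfl⟩ := toPoly_surjective k σ c14
  obtain ⟨b23, rfl⟩ := toPoly_surjective k σ c23
  obtain ⟨b24, rfl⟩ := toPoly_surjective k σ c24
  obtain ⟨b34, rfl⟩ := toPoly_surjective k σ c34
  obtain ⟨y, -, -, -, -, y12, y13, y14, y23, y24, y34⟩ := exists_kos_two k σ 0 0 0 0 b12 b13 b14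
      b23 b24 b34
  -- After subtraction of the lifted boundary, each coordinate away from e_0 is zero in the
  -- quotient, hence of the form w e_0.
  obtain ⟨w1, s1⟩ := exists_of_toPoly_eq_zero k σ (coord k σ ![1] (x - d2 k σ y)) (by
    simp only [map_sub, map_mul, coord_d2_1, y12, y13, y14,
      toPoly_e_zero, toPoly_e_two, toPoly_e_three, toPoly_e_four, mul_zero]
    linear_combination r1)
  obtain ⟨w2, s2⟩ := exists_of_toPoly_eq_zero k σ (coord k σ ![2] (x - d2 k σ y)) (by
    simp only [map_sub, map_add, map_mul, coord_d2_2, y12, y23, y24,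
      toPoly_e_zero, toPoly_e_one, toPoly_e_three, toPoly_e_four, mul_zero]
    linear_combination r2)
  obtain ⟨w3, s3⟩ := exists_of_toPoly_eq_zero k σ (coord k σ ![3] (x - d2 k σ y)) (by
    simp only [map_sub, map_add, map_mul, coord_d2_3, y13, y23, y34,
      toPoly_e_zero, toPoly_e_one, toPoly_e_two, toPoly_e_four, mul_zero]
    linear_combination r3)
  obtain ⟨w4, s4⟩ := exists_of_toPoly_eq_zero k σ (coord k σ ![4] (x - d2 k σ y)) (by
    simp only [map_sub, map_add, map_mul, coord_d2_4, y14, y24, y34,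
      toPoly_e_zero, toPoly_e_one, toPoly_e_two, toPoly_e_three, mul_zero]
    linear_combination r4)
  -- The boundary of e_0 ∧ e_i has coordinate e_0 along e_i and no other coordinate away from e_0,
  -- so the quotients w_i are the right coefficients.
  obtain ⟨y', y01, y02, y03, y04, z12, z13, z14, z23, z24, z34⟩ := exists_kos_two k σ w1 w2 w3 w4 0
      0 0 0 0 0
  have hz : d1 k σ (x - d2 k σ y - d2 k σ y') = 0 := by
    rw [map_sub, map_sub, hx, d1_d2, d1_d2, sub_zero, sub_zero]
  have t1 : coord k σ ![1] (x - d2 k σ y - d2 k σ y') = 0 := by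
    rw [map_sub, s1, coord_d2_1, y01]
    simp [z12, z13, z14]
  have t2 : coord k σ ![2] (x - d2 k σ y - d2 k σ y') = 0 := by
    rw [map_sub, s2, coord_d2_2, y02]
    simp [z12, z23, z24]
  have t3 : coord k σ ![3] (x - d2 k σ y - d2 k σ y') = 0 := by
    rw [map_sub, s3, coord_d2_3, y03]
    simp [z13, z23, z34]
  have t4 : coord k σ ![4] (x - d2 k σ y - d2 k σ y') = 0 := by
    rw [map_sub, s4, coord_d2_4, y04]
    simp [z14, z24, z34]
  refine ⟨y + y', ?_⟩
  rw [map_add, eq_comm, ← sub_eq_zero, ← sub_sub]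
  generalize x - d2 k σ y - d2 k σ y' = z at *
  have t0 : coord k σ ![0] z = 0 := by
    have h := (d1_eq k σ z).symm.trans hz
    simp only [t1, t2, t3, t4, zero_mul, add_zero] at h
    exact eq_zero_of_mul_e_zero k σ h
  exact kos_ext k σ (forall_strictMono_one
    (t0.trans (map_zero _).symm) (t1.trans (map_zero _).symm) (t2.trans (map_zero _).symm)
    (t3.trans (map_zero _).symm) (t4.trans (map_zero _).symm))

lemma exact_d3_d2 (σ : ℤˣ) : Function.Exact (d3 k σ) (d2 k σ) := by
  intro x
  refine ⟨fun hx => ?_, ?_⟩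
  swap
  · rintro ⟨y, rfl⟩
    exact d2_d3 k σ y
  have h1 := congrArg (fun z => toPoly k σ (coord k σ ![1] z)) hx
  have h2 := congrArg (fun z => toPoly k σ (coord k σ ![2] z)) hx
  have h3 := congrArg (fun z => toPoly k σ (coord k σ ![3] z)) hx
  have h4 := congrArg (fun z => toPoly k σ (coord k σ ![4] z)) hx
  simp only [map_zero, coord_d2_1, coord_d2_2, coord_d2_3, coord_d2_4] at h1 h2 h3 h4
  simp only [map_add, map_mul, map_sub, toPoly_e_zero, toPoly_e_one, toPoly_e_two, toPoly_e_three,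
      toPoly_e_four,
    mul_zero] at h1 h2 h3 h4
  obtain ⟨c123, c124, c134, c234, r12, r13, r14, r23, r24, r34⟩ := polyH_exact42 k (toPoly k σ
      (coord k σ ![1, 2] x))
    (toPoly k σ (coord k σ ![1, 3] x))
    (toPoly k σ (coord k σ ![1, 4] x))
    (toPoly k σ (coord k σ ![2, 3] x))
    (toPoly k σ (coord k σ ![2, 4] x))
    (toPoly k σ (coord k σ ![3, 4] x))
    (by linear_combination h1)
    (by linear_combination h2)
    (by linear_combination h3)
    (by linear_combination h4)
  obtain ⟨b123, rfl⟩ := toPoly_surjective k σ c123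
  obtain ⟨b124, rfl⟩ := toPoly_surjective k σ c124
  obtain ⟨b134, rfl⟩ := toPoly_surjective k σ c134
  obtain ⟨b234, rfl⟩ := toPoly_surjective k σ c234
  obtain ⟨y, -, -, -, -, -, -, y123, y124, y134, y234⟩ := exists_kos_three k σ 0 0 0 0 0 0 b123
      b124 b134 b234
  obtain ⟨w12, s12⟩ := exists_of_toPoly_eq_zero k σ (coord k σ ![1, 2] (x - d3 k σ y)) (by
    simp only [map_sub, map_add, map_mul, coord_d3_12, y123, y124,
      toPoly_e_zero, toPoly_e_three, toPoly_e_four, mul_zero]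
    linear_combination r12)
  obtain ⟨w13, s13⟩ := exists_of_toPoly_eq_zero k σ (coord k σ ![1, 3] (x - d3 k σ y)) (by
    simp only [map_sub, map_add, map_mul, coord_d3_13, y123, y134,
      toPoly_e_zero, toPoly_e_two, toPoly_e_four, mul_zero]
    linear_combination r13)
  obtain ⟨w14, s14⟩ := exists_of_toPoly_eq_zero k σ (coord k σ ![1, 4] (x - d3 k σ y)) (by
    simp only [map_sub, map_mul, coord_d3_14, y124, y134,
      toPoly_e_zero, toPoly_e_two, toPoly_e_three, mul_zero]
    linear_combination r14)
  obtain ⟨w23, s23⟩ := exists_of_toPoly_eq_zero k σ (coord k σ ![2, 3] (x - d3 k σ y)) (by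
    simp only [map_sub, map_add, map_mul, coord_d3_23, y123, y234,
      toPoly_e_zero, toPoly_e_one, toPoly_e_four, mul_zero]
    linear_combination r23)
  obtain ⟨w24, s24⟩ := exists_of_toPoly_eq_zero k σ (coord k σ ![2, 4] (x - d3 k σ y)) (by
    simp only [map_sub, map_add, map_mul, coord_d3_24, y124, y234,
      toPoly_e_zero, toPoly_e_one, toPoly_e_three, mul_zero]
    linear_combination r24)
  obtain ⟨w34, s34⟩ := exists_of_toPoly_eq_zero k σ (coord k σ ![3, 4] (x - d3 k σ y)) (by
    simp only [map_sub, map_add, map_mul, coord_d3_34, y134, y234,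
      toPoly_e_zero, toPoly_e_one, toPoly_e_two, mul_zero]
    linear_combination r34)
  obtain ⟨y', y012, y013, y014, y023, y024, y034, z123, z124, z134, z234⟩ := exists_kos_three k σ
      w12 w13 w14 w23 w24 w34 0 0 0 0
  have hz : d2 k σ (x - d3 k σ y - d3 k σ y') = 0 := by
    rw [map_sub, map_sub, hx, d2_d3, d2_d3, sub_zero, sub_zero]
  have t12 : coord k σ ![1, 2] (x - d3 k σ y - d3 k σ y') = 0 := by
    rw [map_sub, s12, coord_d3_12, y012]
    simp [z123, z124]
  have t13 : coord k σ ![1, 3] (x - d3 k σ y - d3 k σ y') = 0 := by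
    rw [map_sub, s13, coord_d3_13, y013]
    simp [z123, z134]
  have t14 : coord k σ ![1, 4] (x - d3 k σ y - d3 k σ y') = 0 := by
    rw [map_sub, s14, coord_d3_14, y014]
    simp [z124, z134]
  have t23 : coord k σ ![2, 3] (x - d3 k σ y - d3 k σ y') = 0 := by
    rw [map_sub, s23, coord_d3_23, y023]
    simp [z123, z234]
  have t24 : coord k σ ![2, 4] (x - d3 k σ y - d3 k σ y') = 0 := by
    rw [map_sub, s24, coord_d3_24, y024]
    simp [z124, z234]
  have t34 : coord k σ ![3, 4] (x - d3 k σ y - d3 k σ y') = 0 := by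
    rw [map_sub, s34, coord_d3_34, y034]
    simp [z134, z234]
  refine ⟨y + y', ?_⟩
  rw [map_add, eq_comm, ← sub_eq_zero, ← sub_sub]
  generalize x - d3 k σ y - d3 k σ y' = z at *
  -- With the coordinates away from e_0 gone, the coordinate of the boundary along e_1 is z_{01}
  -- e_0.
  have t01 : coord k σ ![0, 1] z = 0 := by
    have h := congrArg (coord k σ ![1]) hz
    simp only [coord_d2_1, t12, t13, t14, zero_mul, sub_zero, map_zero] at h
    exact eq_zero_of_mul_e_zero k σ h
  have t02 : coord k σ ![0, 2] z = 0 := by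
    have h := congrArg (coord k σ ![2]) hz
    simp only [coord_d2_2, t12, t23, t24, zero_mul, add_zero, sub_zero, map_zero] at h
    exact eq_zero_of_mul_e_zero k σ h
  have t03 : coord k σ ![0, 3] z = 0 := by
    have h := congrArg (coord k σ ![3]) hz
    simp only [coord_d2_3, t13, t23, t34, zero_mul, add_zero, sub_zero, map_zero] at h
    exact eq_zero_of_mul_e_zero k σ h
  have t04 : coord k σ ![0, 4] z = 0 := by
    have h := congrArg (coord k σ ![4]) hz
    simp only [coord_d2_4, t14, t24, t34, zero_mul, add_zero, map_zero] at h
    exact eq_zero_of_mul_e_zero k σ h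
  exact kos_ext k σ (forall_strictMono_two
    (t01.trans (map_zero _).symm) (t02.trans (map_zero _).symm) (t03.trans (map_zero _).symm)
    (t04.trans (map_zero _).symm) (t12.trans (map_zero _).symm) (t13.trans (map_zero _).symm)
    (t14.trans (map_zero _).symm) (t23.trans (map_zero _).symm) (t24.trans (map_zero _).symm)
    (t34.trans (map_zero _).symm))

lemma exact_d4_d3 (σ : ℤˣ) : Function.Exact (d4 k σ) (d3 k σ) := by
  intro x
  refine ⟨fun hx => ?_, ?_⟩
  swap
  · rintro ⟨y, rfl⟩
    exact d3_d4 k σ y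
  have h12 := congrArg (fun z => toPoly k σ (coord k σ ![1, 2] z)) hx
  have h13 := congrArg (fun z => toPoly k σ (coord k σ ![1, 3] z)) hx
  have h14 := congrArg (fun z => toPoly k σ (coord k σ ![1, 4] z)) hx
  have h23 := congrArg (fun z => toPoly k σ (coord k σ ![2, 3] z)) hx
  have h24 := congrArg (fun z => toPoly k σ (coord k σ ![2, 4] z)) hx
  have h34 := congrArg (fun z => toPoly k σ (coord k σ ![3, 4] z)) hx
  simp only [map_zero, coord_d3_12, coord_d3_13, coord_d3_14, coord_d3_23, coord_d3_24,
      coord_d3_34] at h12 h13 h14 h23 h24 h34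
  simp only [map_add, map_mul, map_sub, toPoly_e_zero, toPoly_e_one, toPoly_e_two, toPoly_e_three,
      toPoly_e_four,
    mul_zero] at h12 h13 h14 h23 h24 h34
  obtain ⟨c1234, r123, r124, r134, r234⟩ := polyH_exact43 k (toPoly k σ (coord k σ ![1, 2, 3] x))
    (toPoly k σ (coord k σ ![1, 2, 4] x))
    (toPoly k σ (coord k σ ![1, 3, 4] x))
    (toPoly k σ (coord k σ ![2, 3, 4] x))
    (by linear_combination h12)
    (by linear_combination h13)
    (by linear_combination h14)
    (by linear_combination h23)
    (by linear_combination h24)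
    (by linear_combination h34)
  obtain ⟨b1234, rfl⟩ := toPoly_surjective k σ c1234
  obtain ⟨y, -, -, -, -, y1234⟩ := exists_kos_four k σ 0 0 0 0 b1234
  obtain ⟨w123, s123⟩ := exists_of_toPoly_eq_zero k σ (coord k σ ![1, 2, 3] (x - d4 k σ y)) (by
    simp only [map_sub, map_mul, coord_d4_123, y1234,
      toPoly_e_zero, toPoly_e_four, mul_zero]
    linear_combination r123)
  obtain ⟨w124, s124⟩ := exists_of_toPoly_eq_zero k σ (coord k σ ![1, 2, 4] (x - d4 k σ y)) (by
    simp only [map_sub, map_add, map_mul, coord_d4_124, y1234,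
      toPoly_e_zero, toPoly_e_three, mul_zero]
    linear_combination r124)
  obtain ⟨w134, s134⟩ := exists_of_toPoly_eq_zero k σ (coord k σ ![1, 3, 4] (x - d4 k σ y)) (by
    simp only [map_sub, map_mul, coord_d4_134, y1234,
      toPoly_e_zero, toPoly_e_two, mul_zero]
    linear_combination r134)
  obtain ⟨w234, s234⟩ := exists_of_toPoly_eq_zero k σ (coord k σ ![2, 3, 4] (x - d4 k σ y)) (by
    simp only [map_sub, map_add, map_mul, coord_d4_234, y1234,
      toPoly_e_zero, toPoly_e_one, mul_zero]
    linear_combination r234)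
  obtain ⟨y', y0123, y0124, y0134, y0234, z1234⟩ := exists_kos_four k σ w123 w124 w134 w234 0
  have hz : d3 k σ (x - d4 k σ y - d4 k σ y') = 0 := by
    rw [map_sub, map_sub, hx, d3_d4, d3_d4, sub_zero, sub_zero]
  have t123 : coord k σ ![1, 2, 3] (x - d4 k σ y - d4 k σ y') = 0 := by
    rw [map_sub, s123, coord_d4_123, y0123]
    simp [z1234]
  have t124 : coord k σ ![1, 2, 4] (x - d4 k σ y - d4 k σ y') = 0 := by
    rw [map_sub, s124, coord_d4_124, y0124]
    simp [z1234]
  have t134 : coord k σ ![1, 3, 4] (x - d4 k σ y - d4 k σ y') = 0 := by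
    rw [map_sub, s134, coord_d4_134, y0134]
    simp [z1234]
  have t234 : coord k σ ![2, 3, 4] (x - d4 k σ y - d4 k σ y') = 0 := by
    rw [map_sub, s234, coord_d4_234, y0234]
    simp [z1234]
  refine ⟨y + y', ?_⟩
  rw [map_add, eq_comm, ← sub_eq_zero, ← sub_sub]
  generalize x - d4 k σ y - d4 k σ y' = z at *
  have t012 : coord k σ ![0, 1, 2] z = 0 := by
    have h := congrArg (coord k σ ![1, 2]) hz
    simp only [coord_d3_12, t123, t124, zero_mul, add_zero, map_zero] at h
    exact eq_zero_of_mul_e_zero k σ h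
  have t013 : coord k σ ![0, 1, 3] z = 0 := by
    have h := congrArg (coord k σ ![1, 3]) hz
    simp only [coord_d3_13, t123, t134, zero_mul, add_zero, sub_zero, map_zero] at h
    exact eq_zero_of_mul_e_zero k σ h
  have t014 : coord k σ ![0, 1, 4] z = 0 := by
    have h := congrArg (coord k σ ![1, 4]) hz
    simp only [coord_d3_14, t124, t134, zero_mul, sub_zero, map_zero] at h
    exact eq_zero_of_mul_e_zero k σ h
  have t023 : coord k σ ![0, 2, 3] z = 0 := by
    have h := congrArg (coord k σ ![2, 3]) hz
    simp only [coord_d3_23, t123, t234, zero_mul, add_zero, map_zero] at h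
    exact eq_zero_of_mul_e_zero k σ h
  have t024 : coord k σ ![0, 2, 4] z = 0 := by
    have h := congrArg (coord k σ ![2, 4]) hz
    simp only [coord_d3_24, t124, t234, zero_mul, add_zero, sub_zero, map_zero] at h
    exact eq_zero_of_mul_e_zero k σ h
  have t034 : coord k σ ![0, 3, 4] z = 0 := by
    have h := congrArg (coord k σ ![3, 4]) hz
    simp only [coord_d3_34, t134, t234, zero_mul, add_zero, map_zero] at h
    exact eq_zero_of_mul_e_zero k σ h
  exact kos_ext k σ (forall_strictMono_three
    (t012.trans (map_zero _).symm) (t013.trans (map_zero _).symm)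
    (t014.trans (map_zero _).symm) (t023.trans (map_zero _).symm)
    (t024.trans (map_zero _).symm) (t034.trans (map_zero _).symm)
    (t123.trans (map_zero _).symm) (t124.trans (map_zero _).symm)
    (t134.trans (map_zero _).symm) (t234.trans (map_zero _).symm))

lemma exact_d5_d4 (σ : ℤˣ) : Function.Exact (d5 k σ) (d4 k σ) := by
  intro x
  refine ⟨fun hx => ?_, ?_⟩
  swap
  · rintro ⟨y, rfl⟩
    exact d4_d5 k σ y
  have h123 := congrArg (fun z => toPoly k σ (coord k σ ![1, 2, 3] z)) hx
  have h124 := congrArg (fun z => toPoly k σ (coord k σ ![1, 2, 4] z)) hx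
  have h134 := congrArg (fun z => toPoly k σ (coord k σ ![1, 3, 4] z)) hx
  have h234 := congrArg (fun z => toPoly k σ (coord k σ ![2, 3, 4] z)) hx
  simp only [map_zero, coord_d4_123, coord_d4_124, coord_d4_134, coord_d4_234]
    at h123 h124 h134 h234
  simp only [map_add, map_mul, map_sub, toPoly_e_zero, toPoly_e_one, toPoly_e_two, toPoly_e_three,
      toPoly_e_four,
    mul_zero] at h123 h124 h134 h234
  -- At the left end the commutative Koszul complex has a single coefficient, annihilated by the
  -- regular element y_0; no lifted boundary is needed.
  obtain ⟨w1234, s1234⟩ := exists_of_toPoly_eq_zero k σ (coord k σ ![1, 2, 3, 4] x)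
    ((dropH_isRegularQuotient k 3).eq_zero_of_mul _ (by linear_combination h234))
  let y' : Kos k σ 5 := w1234 • (1 ⊗ₜ wedge k ![0, 1, 2, 3, 4])
  have y01234 : coord k σ ![0, 1, 2, 3, 4] y' = w1234 := by
    rw [map_smul, coord_tmul_wedge k σ _ (by decide) _ _ (Or.inl (by decide)), if_pos rfl,
      smul_eq_mul, mul_one]
  have hz : d4 k σ (x - d5 k σ y') = 0 := by rw [map_sub, hx, d4_d5, sub_zero]
  have t1234 : coord k σ ![1, 2, 3, 4] (x - d5 k σ y') = 0 := by
    rw [map_sub, s1234, coord_d5_1234, y01234, sub_self]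
  refine ⟨y', ?_⟩
  rw [eq_comm, ← sub_eq_zero]
  generalize x - d5 k σ y' = z at *
  have t0123 : coord k σ ![0, 1, 2, 3] z = 0 := by
    have h := congrArg (coord k σ ![1, 2, 3]) hz
    simp only [coord_d4_123, t1234, zero_mul, sub_zero, map_zero] at h
    exact eq_zero_of_mul_e_zero k σ h
  have t0124 : coord k σ ![0, 1, 2, 4] z = 0 := by
    have h := congrArg (coord k σ ![1, 2, 4]) hz
    simp only [coord_d4_124, t1234, zero_mul, add_zero, map_zero] at h
    exact eq_zero_of_mul_e_zero k σ h
  have t0134 : coord k σ ![0, 1, 3, 4] z = 0 := by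
    have h := congrArg (coord k σ ![1, 3, 4]) hz
    simp only [coord_d4_134, t1234, zero_mul, sub_zero, map_zero] at h
    exact eq_zero_of_mul_e_zero k σ h
  have t0234 : coord k σ ![0, 2, 3, 4] z = 0 := by
    have h := congrArg (coord k σ ![2, 3, 4]) hz
    simp only [coord_d4_234, t1234, zero_mul, add_zero, map_zero] at h
    exact eq_zero_of_mul_e_zero k σ h
  exact kos_ext k σ (forall_strictMono_four
    (t0123.trans (map_zero _).symm) (t0124.trans (map_zero _).symm)
    (t0134.trans (map_zero _).symm) (t0234.trans (map_zero _).symm)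
    (t1234.trans (map_zero _).symm))

lemma d5_injective (σ : ℤˣ) : Function.Injective (d5 k σ) := by
  rw [injective_iff_map_eq_zero]
  intro x hx
  refine kos_ext k σ (forall_strictMono_five ?_)
  rw [map_zero]
  refine eq_zero_of_mul_e_zero k σ ?_
  rw [← coord_d5_1234, hx, map_zero]

/-! ### The Koszul resolution -/

/-- The terms of the Koszul resolution. -/
def resX (σ : ℤˣ) : ℕ → ModuleCat.{u} (U k σ)
  | 0 => ModuleCat.of (U k σ) (U k σ)
  | n + 1 => ModuleCat.of (U k σ) (Kos k σ (n + 1))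

/-- The differentials of the Koszul resolution. -/
def resD (σ : ℤˣ) : ∀ n, resX k σ (n + 1) ⟶ resX k σ n
  | 0 => ModuleCat.ofHom (d1 k σ)
  | 1 => ModuleCat.ofHom (d2 k σ)
  | 2 => ModuleCat.ofHom (d3 k σ)
  | 3 => ModuleCat.ofHom (d4 k σ)
  | 4 => ModuleCat.ofHom (d5 k σ)
  | _ + 5 => 0

lemma kos_subsingleton (σ : ℤˣ) (n : ℕ) : Subsingleton (Kos k σ (n + 6)) := by
  refine ⟨fun x y => kos_ext k σ fun q hq => ?_⟩
  have := Fintype.card_le_of_injective q hq.injective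
  simp at this

lemma resD_exact (σ : ℤˣ) : ∀ n, Function.Exact (resD k σ (n + 1)).hom (resD k σ n).hom
  | 0 => exact_d2_d1 k σ
  | 1 => exact_d3_d2 k σ
  | 2 => exact_d4_d3 k σ
  | 3 => exact_d5_d4 k σ
  | 4 => by
    intro x
    refine ⟨fun hx => ⟨0, ?_⟩, ?_⟩
    · rw [map_zero]
      -- Next to the zero map, exactness is injectivity of `d5`.
      exact (d5_injective k σ (hx.trans (map_zero _).symm)).symm
    · rintro ⟨y, rfl⟩
      exact map_zero (d5 k σ)
  | n + 5 => fun x => by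
    have : x = 0 := (kos_subsingleton k σ n).elim _ _
    subst this
    exact ⟨fun _ => ⟨0, map_zero _⟩, fun _ => map_zero _⟩

lemma resD_comp (σ : ℤˣ) (n : ℕ) : resD k σ (n + 1) ≫ resD k σ n = 0 := by
  ext x
  exact (resD_exact k σ n).apply_apply_eq_zero x

/-- The Koszul complex. -/
def resComplex (σ : ℤˣ) : ChainComplex (ModuleCat.{u} (U k σ)) ℕ :=
  ChainComplex.of (resX k σ) (resD k σ) (resD_comp k σ)

lemma resComplex_d (σ : ℤˣ) (n : ℕ) : (resComplex k σ).d (n + 1) n = resD k σ n :=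
  ChainComplex.of_d _ _ _

lemma resComplex_projective (σ : ℤˣ) (n : ℕ) : Projective ((resComplex k σ).X n) := by
  cases n with
  | zero =>
    have h : Projective (ModuleCat.of (U k σ) (U k σ)) :=
      ModuleCat.projective_of_free (M := ModuleCat.of (U k σ) (U k σ))
        (Module.Basis.singleton PUnit.{u + 1} (U k σ))
    exact h
  | succ n =>
    have h : Projective (ModuleCat.of (U k σ) (Kos k σ (n + 1))) :=
      ModuleCat.projective_of_free (M := ModuleCat.of (U k σ) (Kos k σ (n + 1)))
        (kosBasis k σ (n + 1))
    exact h

/-- The augmentation of the Koszul complex. -/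
def resπ (σ : ℤˣ) : resComplex k σ ⟶
    (ChainComplex.single₀ _).obj (ModuleCat.of (U k σ) (Triv k σ)) :=
  (ChainComplex.toSingle₀Equiv _ _).symm ⟨ModuleCat.ofHom (d0 k σ), by
    rw [resComplex_d]
    ext x
    exact (exact_d1_d0 k σ).apply_apply_eq_zero x⟩

lemma resComplex_exactAt_succ (σ : ℤˣ) (n : ℕ) : (resComplex k σ).ExactAt (n + 1) := by
  rw [HomologicalComplex.exactAt_iff' _ (n + 2) (n + 1) n (by simp) (by simp),
    ShortComplex.ShortExact.moduleCat_exact_iff_function_exact]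
  change Function.Exact ((resComplex k σ).d (n + 2) (n + 1)).hom ((resComplex k σ).d (n + 1) n).hom
  rw [resComplex_d, resComplex_d]
  exact resD_exact k σ n

lemma resπ_quasiIso (σ : ℤˣ) : QuasiIso (resπ k σ) := ⟨fun n => by
  cases n with
  | zero =>
    rw [ChainComplex.quasiIsoAt₀_iff, ShortComplex.quasiIso_iff_of_zeros' _ rfl rfl rfl]
    constructor
    · rw [ShortComplex.ShortExact.moduleCat_exact_iff_function_exact]
      exact exact_d1_d0 k σ
    · rw [ModuleCat.epi_iff_surjective]
      exact d0_surjective k σ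
  | succ n =>
    rw [quasiIsoAt_iff_exactAt' _ _ (ChainComplex.exactAt_succ_single_obj _ _)]
    exact resComplex_exactAt_succ k σ n⟩

/-- The Koszul resolution of the trivial module. -/
def koszulResolution (σ : ℤˣ) : ProjectiveResolution (ModuleCat.of (U k σ) (Triv k σ)) where
  complex := resComplex k σ
  projective := resComplex_projective k σ
  π := resπ k σ
  quasiIso := resπ_quasiIso k σ

/-! ### The top extension group -/

/-- The functional on `U_h(𝔞) ⊗ ⋀^5 𝔞` sending the basis vector to `u`. -/
def topFunctional (σ : ℤˣ) (u : U k σ) :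
    (koszulResolution k σ).complex.X 5 ⟶ ModuleCat.of (U k σ) (U k σ) :=
  ModuleCat.ofHom (rightMul k σ u ∘ₗ coord k σ ![0, 1, 2, 3, 4])

lemma d_comp_topFunctional (σ : ℤˣ) (u : U k σ) :
    (koszulResolution k σ).complex.d 6 5 ≫ topFunctional k σ u = 0 := by
  have : (koszulResolution k σ).complex.d 6 5 = 0 := resComplex_d k σ 5
  rw [this, Limits.zero_comp]

/-- The class in `Ext^5` of the functional sending the basis vector to `u`. -/
def topClass (σ : ℤˣ) : U k σ →+ Ext5 k σ :=
  AddMonoidHom.mk' (fun u => (koszulResolution k σ).extMk (topFunctional k σ u) 6 rfl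
    (d_comp_topFunctional k σ u)) fun u v => by
      rw [ProjectiveResolution.add_extMk]
      congr 1
      ext x
      exact mul_add _ u v

lemma topClass_apply (σ : ℤˣ) (u : U k σ) : topClass k σ u = (koszulResolution k σ).extMk
    (topFunctional k σ u) 6 rfl (d_comp_topFunctional k σ u) := rfl

lemma kos_five_hom_eq (σ : ℤˣ) {f g : Kos k σ 5 →ₗ[U k σ] U k σ}
    (h : f (1 ⊗ₜ wedge k ![0, 1, 2, 3, 4]) = g (1 ⊗ₜ wedge k ![0, 1, 2, 3, 4])) : f = g :=
  kos_hom_ext k σ (forall_strictMono_five h)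

lemma coord_top (σ : ℤˣ) :
    coord k σ ![0, 1, 2, 3, 4] (1 ⊗ₜ wedge k ![0, 1, 2, 3, 4]) = 1 := by
  rw [coord_tmul_wedge k σ _ (by decide) _ _ (Or.inl (by decide)), if_pos rfl]

lemma topClass_surjective (σ : ℤˣ) : Function.Surjective (topClass k σ) := by
  intro x
  obtain ⟨f, hf, rfl⟩ := (koszulResolution k σ).extMk_surjective x 6 rfl
  refine ⟨f.hom ((1 : U k σ) ⊗ₜ[k] wedge k ![0, 1, 2, 3, 4] : Kos k σ 5), ?_⟩
  rw [topClass_apply]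
  congr 1
  refine ModuleCat.hom_ext (kos_five_hom_eq k σ ?_)
  change coord k σ ![0, 1, 2, 3, 4] _ * _ = _
  rw [coord_top, one_mul]
  rfl

lemma counit_e (σ : ℤˣ) (i : Fin 5) : counit k σ (e k σ i) = 0 := counitT_genT k i

/-- A left linear G on the fourth term sends ∂_5 of the top wedge to an alternating sum of e_i ·
G(wedge without e_i). The coboundaries thus fill the right ideal ∑ e_i U, which is the kernel of the
counit. -/
lemma topClass_eq_zero_iff (σ : ℤˣ) (u : U k σ) : topClass k σ u = 0 ↔ counit k σ u = 0 := by
  rw [topClass_apply, ProjectiveResolution.extMk_eq_zero_iff _ _ _ _ _ 4 rfl]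
  have hd : (koszulResolution k σ).complex.d 5 4 = ModuleCat.ofHom (d5 k σ) := resComplex_d k σ 4
  rw [hd]
  constructor
  · rintro ⟨g, hg⟩
    obtain ⟨G, hG⟩ : ∃ G : Kos k σ 4 →ₗ[U k σ] U k σ, ∀ y : Kos k σ 4, G y = g.hom y :=
      ⟨g.hom, fun _ => rfl⟩
    have h : G (d5 k σ (1 ⊗ₜ wedge k ![0, 1, 2, 3, 4])) =
        coord k σ ![0, 1, 2, 3, 4] (1 ⊗ₜ wedge k ![0, 1, 2, 3, 4]) * u :=
      (hG _).trans (LinearMap.congr_fun (congrArg ModuleCat.Hom.hom hg)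
        ((1 : U k σ) ⊗ₜ[k] wedge k ![0, 1, 2, 3, 4] : Kos k σ 5))
    rw [coord_top, one_mul] at h
    have ht : ∀ (i : Fin 5) (w : ⋀[k]^4 (Fin 5 → k)),
        counit k σ (G (e k σ i ⊗ₜ[k] w)) = 0 := by
      intro i w
      have : (e k σ i ⊗ₜ[k] w : Kos k σ 4) = e k σ i • ((1 : U k σ) ⊗ₜ[k] w) := by
        rw [TensorProduct.smul_tmul', smul_eq_mul, mul_one]
      rw [this, map_smul, smul_eq_mul, map_mul, counit_e, zero_mul]
    rw [← h, d5_wedge]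
    simp only [map_add, map_sub, ht, add_zero, sub_zero]
  · intro hu
    obtain ⟨a, rfl⟩ := exists_right_of_counit_eq_zero k σ u hu
    -- G takes the value ± a_i on the wedge omitting e_i, with the sign it carries in `d5`, so that
    -- the signs cancel in the composite.
    refine ⟨ModuleCat.ofHom (rightMul k σ (a 0) ∘ₗ coord k σ ![1, 2, 3, 4]
      - rightMul k σ (a 1) ∘ₗ coord k σ ![0, 2, 3, 4]
      + rightMul k σ (a 2) ∘ₗ coord k σ ![0, 1, 3, 4]
      - rightMul k σ (a 3) ∘ₗ coord k σ ![0, 1, 2, 4]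
      + rightMul k σ (a 4) ∘ₗ coord k σ ![0, 1, 2, 3]), ?_⟩
    refine ModuleCat.hom_ext (kos_five_hom_eq k σ ?_)
    change coord k σ ![1, 2, 3, 4] (d5 k σ _) * a 0 - coord k σ ![0, 2, 3, 4] (d5 k σ _) * a 1
      + coord k σ ![0, 1, 3, 4] (d5 k σ _) * a 2 - coord k σ ![0, 1, 2, 4] (d5 k σ _) * a 3
      + coord k σ ![0, 1, 2, 3] (d5 k σ _) * a 4 = coord k σ ![0, 1, 2, 3, 4] _ * _
    simp only [coord_d5_1234, coord_d5_0234, coord_d5_0134, coord_d5_0124, coord_d5_0123,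
      coord_top, one_mul, Fin.sum_univ_five, neg_mul]
    abel

/-! ### Right multiplication and scalars on the top extension group. -/

lemma extRightMul_topClass (σ : ℤˣ) (u v : U k σ) :
    extRightMul k σ u (topClass k σ v) = topClass k σ (v * u) := by
  rw [topClass_apply, topClass_apply]
  refine ((koszulResolution k σ).extMk_comp_mk₀ _ 6 rfl _ _).trans ?_
  congr 1
  ext x
  exact mul_assoc _ v u

/-- Scalars act through the second argument by left multiplication, which is right multiplication
because k[[h]] is central. -/
lemma smul_eq_extRightMul (σ : ℤˣ) (r : PowerSeries k) (x : Ext5 k σ) :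
    r • x = extRightMul k σ (algebraMap _ _ r) x := by
  rw [Abelian.Ext.smul_eq_comp_mk₀]
  change _ = x.comp (Abelian.Ext.mk₀ (ModuleCat.ofHom
    (rightMul k σ (algebraMap _ _ r)))) (add_zero 5)
  congr 2
  refine ModuleCat.hom_ext (LinearMap.ext fun y => ?_)
  change algebraMap (PowerSeries k) (U k σ) r * y = y * algebraMap (PowerSeries k) (U k σ) r
  exact Algebra.commutes _ _

lemma topClass_eq_iff (σ : ℤˣ) (u v : U k σ) :
    topClass k σ u = topClass k σ v ↔ counit k σ u = counit k σ v := by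
  rw [← sub_eq_zero, ← map_sub, topClass_eq_zero_iff, map_sub, sub_eq_zero]

/-- On the class of v the two sides are the classes of v u and v ε_h(u). A class depends only on the
counit of its representative, and the counit is multiplicative. -/
lemma extRightMul_eq_counit_smul (σ : ℤˣ) (u : U k σ) (x : Ext5 k σ) :
    extRightMul k σ u x = counit k σ u • x := by
  obtain ⟨v, rfl⟩ := topClass_surjective k σ x
  rw [smul_eq_extRightMul, extRightMul_topClass, extRightMul_topClass, topClass_eq_iff, map_mul,
    map_mul, AlgHom.commutes]
  rfl

/-- The top extension group is free of rank one over `k[[h]]`. -/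
def ext5Equiv (σ : ℤˣ) : Ext5 k σ ≃ₗ[PowerSeries k] PowerSeries k :=
  -- The class of 1 is a generator: r times it is the class of r, and the counit restores r.
  (LinearEquiv.ofBijective (LinearMap.toSpanSingleton (PowerSeries k) (Ext5 k σ)
    (topClass k σ 1)) (by
      have h : ∀ r : PowerSeries k, LinearMap.toSpanSingleton (PowerSeries k) (Ext5 k σ)
          (topClass k σ 1) r = topClass k σ (algebraMap _ _ r) := fun r => by
        rw [LinearMap.toSpanSingleton_apply, smul_eq_extRightMul, extRightMul_topClass, one_mul]
      have hc : ∀ r : PowerSeries k, counit k σ (algebraMap _ _ r) = r := fun r =>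
        (counit k σ).commutes r
      constructor
      · intro r s hrs
        rwa [h, h, topClass_eq_iff, hc, hc] at hrs
      · intro x
        obtain ⟨u, rfl⟩ := topClass_surjective k σ x
        exact ⟨counit k σ u, by rw [h, topClass_eq_iff, hc]⟩)).symm

end
end QuantumKoszul

theorem mainTheorem12 (k : Type*) [Field k] [CharZero k] (σ : ℤˣ) :
    (Function.Injective (QuantumKoszul.d5 k σ) ∧
      Function.Exact (QuantumKoszul.d5 k σ) (QuantumKoszul.d4 k σ) ∧
      Function.Exact (QuantumKoszul.d4 k σ) (QuantumKoszul.d3 k σ) ∧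
      Function.Exact (QuantumKoszul.d3 k σ) (QuantumKoszul.d2 k σ) ∧
      Function.Exact (QuantumKoszul.d2 k σ) (QuantumKoszul.d1 k σ) ∧
      Function.Exact (QuantumKoszul.d1 k σ) (QuantumKoszul.d0 k σ) ∧
      Function.Surjective (QuantumKoszul.d0 k σ)) ∧
    Nonempty (QuantumKoszul.Ext5 k σ ≃ₗ[PowerSeries k] PowerSeries k) ∧
    ∃ θ : QuantumKoszul.U k σ →ₐ[PowerSeries k] PowerSeries k,
      (∀ (u : QuantumKoszul.U k σ) (x : QuantumKoszul.Ext5 k σ),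
        QuantumKoszul.extRightMul k σ u x = θ u • x) ∧
      (∀ i : Fin 5, θ (QuantumKoszul.e k σ i) = 0) ∧
      θ = QuantumKoszul.counit k σ := by
  exact ⟨⟨QuantumKoszul.d5_injective k σ, QuantumKoszul.exact_d5_d4 k σ,
    QuantumKoszul.exact_d4_d3 k σ, QuantumKoszul.exact_d3_d2 k σ, QuantumKoszul.exact_d2_d1 k σ,
    QuantumKoszul.exact_d1_d0 k σ, QuantumKoszul.d0_surjective k σ⟩,
    ⟨QuantumKoszul.ext5Equiv k σ⟩, QuantumKoszul.counit k σ,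
    QuantumKoszul.extRightMul_eq_counit_smul k σ, QuantumKoszul.counit_e k σ, rfl⟩
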